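/- Let $n\ge 2$, $0\le m\le n$, let $\Pi=(0,1)\times\mathbb R$, and let $BC^1(\Pi)$ be the space of functions $u:\overline\Pi\to\mathbb R$ such that $u,\partial_xu,\partial_tu$ are bounded and continuous on $\overline\Pi=[0,1]\times\mathbb R$. Let $a_j, b_{jk}\in BC^1(\Pi)$ and $p_{jk}\in\mathbb R$ ($1\le j,k\le n$), and suppose that for some $\Lambda_0>0$ one has $a_j\ge\Lambda_0$ on $\overline\Pi$ for $j\le m$ and $a_j\le-\Lambda_0$ on $\overline\Pi$ for $j>m$. Put $x_j=0$ for $j\le m$, $x_j=1$ for $j>m$, and $$(Pu)_j(t)=\sum_{k=1}^m p_{jk}u_k(1,t)+\sum_{k=m+1}^n p_{jk}u_k(0,t),\qquad j\le n .$$ Consider, for $\tau\in\mathbb R$, the problem $$\partial_tu_j+a_j(x,t)\partial_xu_j+\sum_{k=1}^n b_{jk}(x,t)u_k=0\ \ (0<x<1,\ t>\tau),\qquad u_j(x_j,t)=(Pu)_j(t)\ \ (t\ge\tau),\qquad u(\cdot,\tau)=\varphi,\qquad j\le n. \tag{1}$$ For $\varphi\in L^2(0,1)^n$, an $L^2$-generalized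 solution of (1) is a continuous map $u:[\tau,\infty)\to L^2(0,1)^n$ such that, for every sequence $\varphi^l\in C_0^\infty((0,1))^n$ with $\varphi^l\to\varphi$ in $L^2(0,1)^n$, there are classical solutions $u^l$ of (1) with initial values $\varphi^l$, continuously differentiable on $[0,1]\times[\tau,\infty)$, such that $\|u^l(\cdot,\theta)-u(\theta)\|_{L^2(0,1)^n}\to0$ uniformly in $\theta\in[\tau,t]$ for every $t>\tau$. An evolution family on a Banach space $X$ is a family $\{U(t,\tau)\}_{t\ge\tau}$ of bounded linear operators on $X$ with $U(\tau,\tau)=I$, $U(t,s)U(s,\tau)=U(t,\tau)$ for $t\ge s\ge\tau$, and $(t,\tau)\mapsto U(t,\tau)\varphi$ continuous on $\{t\ge\tau\}$ for all $\varphi\in X$. An evolution family on $L^2(0,1)^n$ is generated by (1) if $t\mapsto U(t,\tau)\varphi$ is an $L^2$-generalized solution of (1) for all $\tau\in\mathbb R$ and $\varphi\in L^2(0,1)^n$. For $x\in[0,1]$ and $t\in\mathbb R$ let $\xi\in[0,1]\mapsto\omega_j(\xi,x,t)$ be the solution of $\partial_\xi\omega_j(\xi,x,t)=1/a_j(\xi,\omega_j(\xi,x,t))$,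 $\omega_j(x,x,t)=t$; put $$c_j(\xi,x,t)=\exp\int_x^\xi\Big(\frac{b_{jj}}{a_j}\Big)(\eta,\omega_j(\eta,x,t))\,d\eta,\qquad (Cv)_j(x,t)=c_j(x_j,x,t)\,v_j(\omega_j(x_j,x,t)).$$ Assume that there is $k\in\mathbb N$ such that $(CP)^ku\equiv0$ on $\overline\Pi$ for all $u\in C(\overline\Pi)^n$, and that for all $j\ne k$ there is $\beta_{jk}\in BC^1(\Pi)$ with $b_{jk}=\beta_{jk}(a_k-a_j)$ on $\overline\Pi$. Then (1) generates an evolution family on $L^2(0,1)^n$, and the evolution family $\{U(t,\tau)\}_{t\ge\tau}$ generated by (1) is smoothing from $L^2(0,1)^n$ to $C^1([0,1])^n$: there is $T>0$ such that for all $\tau\in\mathbb R$ and all $t\ge\tau+T$ the operator $U(t,\tau)$ maps $L^2(0,1)^n$ into $C^1([0,1])^n$ and is bounded as an operator from $L^2(0,1)^n$ to $C^1([0,1])^n$. -/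

import Mathlib

open Set Filter Topology MeasureTheory
open scoped ContDiff

noncomputable section

namespace HypSmoothing

/-! Functions of `(x, t)` are modelled as total functions `ℝ → ℝ → ℝ`; only their values on the
closed strip `[0,1] × ℝ` (or on `[0,1] × [τ,∞)`) are ever used.  Components `1, …, m` are the
indices `j : Fin n` with `j.val < m`, components `m+1, …, n` those with `m ≤ j.val`. -/

/-- `u` is continuously differentiable on `I × J`, with partial derivatives `ux`, `ut`
(one-sided at boundary points), everything continuous on `I × J`. -/
structure HasC1Partials (I J : Set ℝ) (u ux ut : ℝ → ℝ → ℝ) : Prop where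
  cont : ContinuousOn (fun z : ℝ × ℝ => u z.1 z.2) (I ×ˢ J)
  cont_x : ContinuousOn (fun z : ℝ × ℝ => ux z.1 z.2) (I ×ˢ J)
  cont_t : ContinuousOn (fun z : ℝ × ℝ => ut z.1 z.2) (I ×ˢ J)
  deriv_x : ∀ x ∈ I, ∀ t ∈ J, HasDerivWithinAt (fun y => u y t) (ux x t) I x
  deriv_t : ∀ x ∈ I, ∀ t ∈ J, HasDerivWithinAt (fun s => u x s) (ut x t) J t

/-- Boundedness on the closed strip `[0,1] × ℝ`. -/
def BddOnStrip (u : ℝ → ℝ → ℝ) : Prop :=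
  ∃ M : ℝ, ∀ x ∈ Icc (0 : ℝ) 1, ∀ t : ℝ, |u x t| ≤ M

/-- The space `BC¹(Π)`, `Π = (0,1) × ℝ`: `u`, `∂ₓu`, `∂ₜu` are bounded and continuous on the
closed strip. -/
def IsBC1 (u : ℝ → ℝ → ℝ) : Prop :=
  ∃ ux ut : ℝ → ℝ → ℝ, HasC1Partials (Icc 0 1) univ u ux ut ∧
    BddOnStrip u ∧ BddOnStrip ux ∧ BddOnStrip ut

/-- `w : [0,1] → ℝ` solves `w'(ξ) = 1 / a(ξ, w(ξ))`, `w(x) = t`. -/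
def IsCharacteristic (a : ℝ → ℝ → ℝ) (x t : ℝ) (w : ℝ → ℝ) : Prop :=
  w x = t ∧ ∀ ξ ∈ Icc (0 : ℝ) 1, HasDerivWithinAt w (1 / a ξ (w ξ)) (Icc 0 1) ξ

open Classical in
/-- The characteristic `ω(ξ, x, t)` of the speed `a` through the point `(x, t)`: the solution of the
initial value problem `IsCharacteristic` (which exists and is unique on `[0,1]` for the speeds
considered here; the value in the `else` branch is irrelevant). -/
def omega (a : ℝ → ℝ → ℝ) (ξ x t : ℝ) : ℝ :=
  if h : ∃ w, IsCharacteristic a x t w then h.choose ξ else t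

variable {n : ℕ}

/-- `c_j(ξ,x,t) = exp ∫_x^ξ (b_jj / a_j)(η, ω_j(η,x,t)) dη`. -/
def cCoef (a : Fin n → ℝ → ℝ → ℝ) (b : Fin n → Fin n → ℝ → ℝ → ℝ) (j : Fin n)
    (ξ x t : ℝ) : ℝ :=
  Real.exp (∫ η in x..ξ, b j j η (omega (a j) η x t) / a j η (omega (a j) η x t))

/-- The endpoint `x_j` at which the `j`-th component enters: `0` for the first `m`
components and `1` for the others. -/
def xIn (m : ℕ) (j : Fin n) : ℝ := if j.val < m then 0 else 1

/-- The endpoint at which the `j`-th component leaves: `1` for the first `m`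
components and `0` for the others. -/
def xOut (m : ℕ) (j : Fin n) : ℝ := if j.val < m then 1 else 0

/-- The boundary operator
`(Pu)_j(t) = ∑_{k ≤ m} p_jk u_k(1,t) + ∑_{k > m} p_jk u_k(0,t)`. -/
def opP (m : ℕ) (p : Fin n → Fin n → ℝ) (u : Fin n → ℝ → ℝ → ℝ) : Fin n → ℝ → ℝ :=
  fun j t => ∑ k, p j k * u k (xOut m k) t

/-- The operator `(Cv)_j(x,t) = c_j(x_j,x,t) v_j(ω_j(x_j,x,t))`. -/
def opC (m : ℕ) (a : Fin n → ℝ → ℝ → ℝ) (b : Fin n → Fin n → ℝ → ℝ → ℝ)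
    (v : Fin n → ℝ → ℝ) : Fin n → ℝ → ℝ → ℝ :=
  fun j x t => cCoef a b j (xIn m j) x t * v j (omega (a j) (xIn m j) x t)

/-- The extinction condition: for some `k`, `(CP)^k u ≡ 0` on the closed strip for all continuous
`u` on the closed strip. -/
def ExtinctionCondition (m : ℕ) (a : Fin n → ℝ → ℝ → ℝ) (b : Fin n → Fin n → ℝ → ℝ → ℝ)
    (p : Fin n → Fin n → ℝ) : Prop :=
  ∃ k : ℕ, ∀ u : Fin n → ℝ → ℝ → ℝ,
    (∀ j, ContinuousOn (fun z : ℝ × ℝ => u j z.1 z.2) (Icc 0 1 ×ˢ univ)) →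
    ∀ j, ∀ x ∈ Icc (0 : ℝ) 1, ∀ t : ℝ, ((fun w => opC m a b (opP m p w))^[k] u) j x t = 0

/-- `u` is a classical (continuously differentiable up to the boundary) solution, in
`(0,1) × (τ,∞)`, of `∂ₜu + a ∂ₓu + b u = 0` with the reflection boundary conditions
`u_j(x_j, t) = (Pu)_j(t)` and the initial condition `u(·, τ) = φ`. -/
def IsClassicalSolution (m : ℕ) (a : Fin n → ℝ → ℝ → ℝ) (b : Fin n → Fin n → ℝ → ℝ → ℝ)
    (p : Fin n → Fin n → ℝ) (τ : ℝ) (φ : Fin n → ℝ → ℝ) (u : Fin n → ℝ → ℝ → ℝ) : Prop :=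
  (∃ ux ut : Fin n → ℝ → ℝ → ℝ,
    (∀ j, HasC1Partials (Icc 0 1) (Ici τ) (u j) (ux j) (ut j)) ∧
    ∀ j, ∀ x ∈ Ioo (0 : ℝ) 1, ∀ t ∈ Ioi τ,
      ut j x t + a j x t * ux j x t + ∑ k, b j k x t * u k x t = 0) ∧
  (∀ j, ∀ t ∈ Ici τ, u j (xIn m j) t = opP m p u j t) ∧
  (∀ j, ∀ x ∈ Icc (0 : ℝ) 1, u j x τ = φ j x)

/-- Lebesgue measure on `(0,1)`. -/
abbrev μ01 : Measure ℝ := volume.restrict (Ioo 0 1)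

/-- The Banach space `L²(0,1)ⁿ` with the maximum norm over components. -/
abbrev L2 (n : ℕ) : Type := Fin n → Lp ℝ 2 μ01

open Classical in
/-- The class in `L²(0,1)ⁿ` of an `n`-tuple of square integrable functions (it is applied only to
tuples that are continuous on `[0,1]`; the `else` branch is irrelevant). -/
def toL2 (f : Fin n → ℝ → ℝ) : L2 n :=
  fun j => if h : MemLp (f j) 2 μ01 then h.toLp (f j) else 0

/-- `C₀^∞` functions: smooth, with compact support in `(0,1)`. -/
def IsTestFunction (φ : Fin n → ℝ → ℝ) : Prop :=
  ∀ j, ContDiff ℝ ∞ (φ j) ∧ HasCompactSupport (φ j) ∧ tsupport (φ j) ⊆ Ioo 0 1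

/-- `u : [τ,∞) → L²(0,1)ⁿ` is the `L²`-generalized solution with initial value `φ`: it is continuous,
and for every sequence of `C₀^∞` functions converging to `φ` in `L²(0,1)ⁿ` the corresponding
classical solutions exist and converge to `u` in `L²(0,1)ⁿ`, uniformly on every `[τ, t]`. -/
def IsL2Solution (m : ℕ) (a : Fin n → ℝ → ℝ → ℝ) (b : Fin n → Fin n → ℝ → ℝ → ℝ)
    (p : Fin n → Fin n → ℝ) (τ : ℝ) (φ : L2 n) (u : ℝ → L2 n) : Prop :=
  ContinuousOn u (Ici τ) ∧
  ∀ φl : ℕ → Fin n → ℝ → ℝ, (∀ l, IsTestFunction (φl l)) →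
    Tendsto (fun l => toL2 (φl l)) atTop (𝓝 φ) →
    ∃ ul : ℕ → Fin n → ℝ → ℝ → ℝ,
      (∀ l, IsClassicalSolution m a b p τ (φl l) (ul l)) ∧
      ∀ t > τ, TendstoUniformlyOn (fun l θ => toL2 (fun j x => ul l j x θ)) u atTop (Icc τ t)

/-- Evolution families `{U(t,τ)}_{t ≥ τ}` of bounded linear operators on a normed space.  The values
`U t τ` with `t < τ` are irrelevant. -/
structure IsEvolutionFamily {X : Type*} [NormedAddCommGroup X] [NormedSpace ℝ X]
    (U : ℝ → ℝ → X →L[ℝ] X) : Prop where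
  refl : ∀ τ, U τ τ = ContinuousLinearMap.id ℝ X
  comp : ∀ τ s t, τ ≤ s → s ≤ t → (U t s).comp (U s τ) = U t τ
  strongly_continuous : ∀ φ : X,
    ContinuousOn (fun q : ℝ × ℝ => U q.1 q.2 φ) {q | q.2 ≤ q.1}

/-- `U` is the evolution family on `L²(0,1)ⁿ` generated by the boundary value problem: it maps an
initial value `φ` at time `τ` to the value at time `t` of the `L²`-generalized solution. -/
def IsGeneratedBy (m : ℕ) (a : Fin n → ℝ → ℝ → ℝ) (b : Fin n → Fin n → ℝ → ℝ → ℝ)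
    (p : Fin n → Fin n → ℝ) (U : ℝ → ℝ → L2 n →L[ℝ] L2 n) : Prop :=
  IsEvolutionFamily U ∧ ∀ (τ : ℝ) (φ : L2 n), IsL2Solution m a b p τ φ (fun t => U t τ φ)

/-- The family `V` is smoothing from `L²(0,1)ⁿ` to `C¹([0,1])ⁿ`: for some `T > 0` and all
`t ≥ τ + T`, `V(t,τ)` maps `L²(0,1)ⁿ` into `C¹([0,1])ⁿ` and is bounded for the norm
`max_j (sup |v_j| + sup |v_j'|)`. -/
def IsSmoothingL2C1 (V : ℝ → ℝ → L2 n →L[ℝ] L2 n) : Prop :=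
  ∃ T : ℝ, 0 < T ∧ ∀ τ t : ℝ, τ + T ≤ t → ∃ K : ℝ, ∀ φ : L2 n, ∃ v : Fin n → ℝ → ℝ,
    ∀ j, ContDiffOn ℝ 1 (v j) (Icc 0 1) ∧ (V t τ φ j : ℝ → ℝ) =ᵐ[μ01] v j ∧
      ∀ x ∈ Icc (0 : ℝ) 1, ∀ y ∈ Icc (0 : ℝ) 1,
        |v j x| + |derivWithin (v j) (Icc 0 1) y| ≤ K * ‖φ‖

end HypSmoothing

end

/-! The proof combines an energy estimate, classical solvability for test functions, and a gain of
regularity for classical solutions.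

Energy. Each component gets a weight that is a small `ε` at its inflow end and `1 + ε` at its
outflow end. For `ε` small compared with the reflection coefficients, the outgoing flux absorbs the
reflected incoming flux (`boundary_flux_nonpos`), and a Gronwall argument gives the `L²` bound
`IsSol.normSq_le`.

Existence. For a test function, subtract from the solution its first order Taylor polynomial in
time. The remainder solves a Volterra equation along the characteristics, with a source that
vanishes at the initial time. The Neumann series converges, together with its time derivatives, in
an exponential weight (`Causal.step`, `exists_causal_fixedPoint`), and the space derivative is
recovered from the derivative along characteristics (`exists_classicalSolution`). The energy
estimate and the density of test functions extend the solution operators to `L²` and give an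
evolution family (`evol_toL2`, `isGeneratedBy_evol`).

Smoothing. Integration along characteristics writes `u - CPu` as an integral of the other components
(`sub_opCP_eq`). Differentiating in time produces `∂ₜu_i` under the integral. The condition `b_jk =
β_jk (a_k - a_j)` puts the factor `1/a_j - 1/a_i` into the kernel, and that factor times `∂ₜu_i` is,
up to terms without derivatives, the derivative of `u_i` along the `j`-th characteristic.
Integration by parts (`integral_by_parts_along`) therefore bounds `∂ₜ(u - CPu)` by values and line
integrals of `|u|`, collected in the operator `maj`. Applying `CP` repeatedly, telescoping, and
using `(CP)^k = 0` bounds `∂ₜu` itself by `maj^[k]` of `|u|` (`exists_deriv_bound`).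

The bootstrap in `exists_apriori_bound` then runs as follows. The energy controls space integrals of
`|u|` at each time; Fubini along characteristics converts them into time integrals at each fixed
`x`; the derivative bound controls the time integrals of `|∂ₜu|`; a one-dimensional Sobolev
inequality yields a supremum bound for `u`; the derivative bound, used pointwise, yields one for
`∂ₜu`; and the equation yields `∂ₓu`. For an arbitrary generated family, approximating classical
solutions are Cauchy in `C¹` at the final time (`isSmoothing_of_isGeneratedBy`). -/

noncomputable section
namespace HypSmoothing

/-! ### Projection to the unit interval and elementary calculus -/

/-- The nearest-point projection of the line onto `[0,1]`. -/
def pj (x : ℝ) : ℝ := max 0 (min 1 x)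

theorem pj_mem (x : ℝ) : pj x ∈ Icc (0 : ℝ) 1 :=
  ⟨le_max_left _ _, max_le zero_le_one (min_le_left _ _)⟩

theorem pj_of_mem {x : ℝ} (hx : x ∈ Icc (0 : ℝ) 1) : pj x = x := by
  simp [pj, hx.1, hx.2]

@[simp] theorem pj_pj (x : ℝ) : pj (pj x) = pj x := pj_of_mem (pj_mem x)

@[fun_prop] theorem continuous_pj : Continuous pj := by unfold pj; fun_prop

/-- Differentiation under the integral sign for integrands continuous with their derivative. -/
theorem hasDerivAt_integral_param {k kt : ℝ → ℝ → ℝ} (X Y t : ℝ)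
    (hk : Continuous fun z : ℝ × ℝ => k z.1 z.2) (hkt : Continuous fun z : ℝ × ℝ => kt z.1 z.2)
    (hd : ∀ ξ s, HasDerivAt (fun r => k ξ r) (kt ξ s) s) :
    HasDerivAt (fun s => ∫ ξ in X..Y, k ξ s) (∫ ξ in X..Y, kt ξ t) t := by
  obtain ⟨C, hC⟩ := (isCompact_uIcc (a := X) (b := Y)).prod
    (isCompact_closedBall t 1) |>.exists_bound_of_continuousOn hkt.continuousOn
  refine (intervalIntegral.hasDerivAt_integral_of_dominated_loc_of_deriv_le
    (F := fun s ξ => k ξ s) (F' := fun s ξ => kt ξ s) (bound := fun _ => C)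
    (Metric.closedBall_mem_nhds t one_pos) ?_ ?_ ?_ ?_ ?_ ?_).2
  · exact Eventually.of_forall fun s => (by fun_prop : Continuous fun ξ => k ξ s).aestronglyMeasurable
  · exact (by fun_prop : Continuous fun ξ => k ξ t).intervalIntegrable _ _
  · exact (by fun_prop : Continuous fun ξ => kt ξ t).aestronglyMeasurable
  · exact Eventually.of_forall fun ξ hξ s hs => hC (ξ, s) ⟨uIoc_subset_uIcc hξ, hs⟩
  · exact intervalIntegrable_const
  · exact Eventually.of_forall fun ξ _ s _ => hd ξ s

/-- Moving the time argument along a curve `r` changes `u` to first order by `ut * r'`. -/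
theorem hasDerivWithinAt_time_shift {u ut : ℝ → ℝ → ℝ} {r : ℝ → ℝ} {r' x : ℝ} {I : Set ℝ}
    (hut : Continuous fun z : ℝ × ℝ => ut z.1 z.2)
    (hd : ∀ y s, HasDerivAt (fun s => u y s) (ut y s) s)
    (hr : HasDerivWithinAt r r' I x) :
    HasDerivWithinAt (fun y => u y (r y) - u y (r x)) (ut x (r x) * r') I x := by
  have hslope : ∀ y, u y (r y) - u y (r x) =
      (∫ θ in (0 : ℝ)..1, ut y (r x + θ * (r y - r x))) * (r y - r x) := by
    intro y
    have := intervalIntegral.integral_eq_sub_of_hasDerivAt (a := (0 : ℝ)) (b := 1)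
      (f := fun θ => u y (r x + θ * (r y - r x)))
      (f' := fun θ => ut y (r x + θ * (r y - r x)) * (r y - r x)) ?_ ?_
    · rw [intervalIntegral.integral_mul_const] at this
      rw [this]; simp
    · intro θ _
      have h1 : HasDerivAt (fun θ : ℝ => r x + θ * (r y - r x)) (r y - r x) θ := by
        simpa using ((hasDerivAt_id θ).mul_const (r y - r x)).const_add (r x)
      exact (hd y _).comp θ h1
    · exact (by fun_prop : Continuous fun θ => ut y (r x + θ * (r y - r x)) * (r y - r x)).intervalIntegrable _ _
  have hq : ContinuousWithinAt (fun y => ∫ θ in (0 : ℝ)..1, ut y (r x + θ * (r y - r x))) I x := by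
    have : Continuous fun z : ℝ × ℝ => ∫ θ in (0 : ℝ)..1, ut z.1 (r x + θ * (z.2 - r x)) := by
      apply intervalIntegral.continuous_parametric_intervalIntegral_of_continuous' 
      unfold Function.uncurry; fun_prop
    exact this.continuousAt.comp_continuousWithinAt (f := fun y => (y, r y))
      (continuousWithinAt_id.prodMk hr.continuousWithinAt)
  have h0 : (∫ θ in (0 : ℝ)..1, ut x (r x + θ * (r x - r x))) = ut x (r x) := by simp
  rw [hasDerivWithinAt_iff_tendsto_slope] at hr ⊢
  have := (hq.mono (sdiff_subset (t := {x}))).tendsto.mul hr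
  rw [h0] at this
  refine this.congr fun y => ?_
  simp only [slope_def_field, hslope y, sub_self, sub_zero]
  ring

/-- The chain rule along a curve, for a function with continuous time derivative. -/
theorem hasDerivWithinAt_along {u ut : ℝ → ℝ → ℝ} {r : ℝ → ℝ} {r' x ux : ℝ} {I : Set ℝ}
    (hut : Continuous fun z : ℝ × ℝ => ut z.1 z.2)
    (hd : ∀ y s, HasDerivAt (fun s => u y s) (ut y s) s)
    (hr : HasDerivWithinAt r r' I x)
    (hx : HasDerivWithinAt (fun y => u y (r x)) ux I x) :
    HasDerivWithinAt (fun y => u y (r y)) (ux + ut x (r x) * r') I x := by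
  refine (hx.add (hasDerivWithinAt_time_shift hut hd hr)).congr_of_eventuallyEq ?_ ?_
  · exact Eventually.of_forall fun y => by simp
  · simp

/-- Recovering the space derivative from the derivative along a curve. -/
theorem hasDerivWithinAt_of_along {u ut : ℝ → ℝ → ℝ} {r : ℝ → ℝ} {r' x g : ℝ} {I : Set ℝ}
    (hut : Continuous fun z : ℝ × ℝ => ut z.1 z.2)
    (hd : ∀ y s, HasDerivAt (fun s => u y s) (ut y s) s)
    (hr : HasDerivWithinAt r r' I x)
    (hx : HasDerivWithinAt (fun y => u y (r y)) g I x) :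
    HasDerivWithinAt (fun y => u y (r x)) (g - ut x (r x) * r') I x := by
  refine (hx.sub (hasDerivWithinAt_time_shift hut hd hr)).congr_of_eventuallyEq ?_ ?_
  · exact Eventually.of_forall fun y => by simp
  · simp

/-- Newton–Leibniz on a subinterval of `[0,1]`. -/
theorem integral_eq_sub_of_hasDerivWithinAt_Icc {g g' : ℝ → ℝ} {X Y : ℝ}
    (hX : X ∈ Icc (0 : ℝ) 1) (hY : Y ∈ Icc (0 : ℝ) 1) (hg' : Continuous g')
    (hg : ∀ ξ ∈ Icc (0 : ℝ) 1, HasDerivWithinAt g (g' ξ) (Icc 0 1) ξ) :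
    ∫ ξ in X..Y, g' ξ = g Y - g X := by
  have hsub : uIcc X Y ⊆ Icc (0 : ℝ) 1 := uIcc_subset_Icc hX hY
  refine intervalIntegral.integral_eq_sub_of_hasDeriv_right
    (fun ξ hξ => ((hg ξ (hsub hξ)).continuousWithinAt).mono hsub) (fun ξ hξ => ?_)
    (hg'.intervalIntegrable _ _)
  have hX' : 0 ≤ min X Y := le_min hX.1 hY.1
  have hY' : max X Y ≤ 1 := max_le hX.2 hY.2
  have h0 : 0 < ξ := hX'.trans_lt hξ.1
  have h1 : ξ < 1 := hξ.2.trans_le hY'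
  exact ((hg ξ ⟨h0.le, h1.le⟩).hasDerivAt (Icc_mem_nhds h0 h1)).hasDerivWithinAt

/-- The fundamental theorem of calculus within `[0,1]`. -/
theorem hasDerivWithinAt_integral_Icc {g : ℝ → ℝ} (hg : Continuous g) (X ξ : ℝ) (I : Set ℝ) :
    HasDerivWithinAt (fun y => ∫ η in X..y, g η) (g ξ) I ξ :=
  (intervalIntegral.integral_hasDerivAt_right (hg.intervalIntegrable _ _)
    hg.stronglyMeasurable.stronglyMeasurableAtFilter hg.continuousAt).hasDerivWithinAt

theorem abs_integral_le_mul {g : ℝ → ℝ} {C : ℝ} (h : ∀ x, |g x| ≤ C) (X Y : ℝ) :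
    |∫ x in X..Y, g x| ≤ C * |Y - X| := by
  have := intervalIntegral.norm_integral_le_of_norm_le_const (a := X) (b := Y) (f := g) (C := C)
    fun x _ => h x
  rwa [Real.norm_eq_abs] at this

/-- Continuity of an integral whose integrand and bounds depend on a parameter. -/
theorem continuous_integral_param {Z : Type*} [TopologicalSpace Z] {F : Z → ℝ → ℝ} {r s : Z → ℝ}
    (hF : Continuous fun q : Z × ℝ => F q.1 q.2) (hr : Continuous r) (hs : Continuous s) :
    Continuous fun z => ∫ η in (r z)..(s z), F z η := by
  have h1 : Continuous fun z => ∫ η in (0 : ℝ)..(s z), F z η :=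
    intervalIntegral.continuous_parametric_intervalIntegral_of_continuous hF hs
  have h2 : Continuous fun z => ∫ η in (0 : ℝ)..(r z), F z η :=
    intervalIntegral.continuous_parametric_intervalIntegral_of_continuous hF hr
  refine (h1.sub h2).congr fun z => ?_
  have hi : ∀ c d, IntervalIntegrable (F z) volume c d :=
    fun c d => (hF.comp (Continuous.prodMk_right z)).intervalIntegrable _ _
  exact intervalIntegral.integral_interval_sub_left (hi _ _) (hi _ _)

/-- Solutions of the linear equation `D' = q D` on `[0,1]`. -/
theorem eq_mul_exp_of_hasDerivWithinAt {D q : ℝ → ℝ} (hq : Continuous q)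
    (hD : ∀ ξ ∈ Icc (0 : ℝ) 1, HasDerivWithinAt D (q ξ * D ξ) (Icc 0 1) ξ)
    {x ξ : ℝ} (hx : x ∈ Icc (0 : ℝ) 1) (hξ : ξ ∈ Icc (0 : ℝ) 1) :
    D ξ = D x * Real.exp (∫ η in x..ξ, q η) := by
  have h : ∀ y ∈ Icc (0 : ℝ) 1,
      HasDerivWithinAt (fun y => D y * Real.exp (-∫ η in x..y, q η)) 0 (Icc 0 1) y := by
    intro y hy
    refine ((hD y hy).mul (hasDerivWithinAt_integral_Icc hq x y (Icc 0 1)).neg.exp).congr_deriv ?_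
    ring
  have := integral_eq_sub_of_hasDerivWithinAt_Icc hx hξ continuous_const h
  simp only [intervalIntegral.integral_zero, intervalIntegral.integral_same, neg_zero, Real.exp_zero, mul_one] at this
  have h2 : D x = D ξ * Real.exp (-∫ η in x..ξ, q η) := by linarith
  rw [h2, mul_assoc, ← Real.exp_add]; simp

/-! ### Systems with coefficients extended to the plane -/

/-- `g` is constant in `x` outside `[0,1]`, `C¹` on the closed strip with partial derivatives
`gx`, `gt`, and all these functions are bounded by `M`. -/
structure StripC1 (M : ℝ) (g gx gt : ℝ → ℝ → ℝ) : Prop where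
  cont : Continuous fun z : ℝ × ℝ => g z.1 z.2
  cont_x : Continuous fun z : ℝ × ℝ => gx z.1 z.2
  cont_t : Continuous fun z : ℝ × ℝ => gt z.1 z.2
  proj : ∀ x t, g (pj x) t = g x t
  deriv_x : ∀ x ∈ Icc (0 : ℝ) 1, ∀ t, HasDerivWithinAt (fun y => g y t) (gx x t) (Icc 0 1) x
  deriv_t : ∀ x t, HasDerivAt (fun s => g x s) (gt x t) t
  bound : ∀ x t, |g x t| ≤ M
  bound_x : ∀ x t, |gx x t| ≤ M
  bound_t : ∀ x t, |gt x t| ≤ M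

/-- A hyperbolic system satisfying the sign and the Levy conditions, together with bounds for the
coefficients and their derivatives. -/
structure Sys (n m : ℕ) where
  (a aX aT : Fin n → ℝ → ℝ → ℝ)
  (b bX bT : Fin n → Fin n → ℝ → ℝ → ℝ)
  (β βX βT : Fin n → Fin n → ℝ → ℝ → ℝ)
  (p : Fin n → Fin n → ℝ)
  (Λ M : ℝ)
  Λ_pos : 0 < Λ
  one_le_M : 1 ≤ M
  ha : ∀ j, StripC1 M (a j) (aX j) (aT j)
  hb : ∀ j k, StripC1 M (b j k) (bX j k) (bT j k)
  hβ : ∀ j k, StripC1 M (β j k) (βX j k) (βT j k)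
  hp : ∀ j k, |p j k| ≤ M
  sign_pos : ∀ j : Fin n, j.val < m → ∀ x t, Λ ≤ a j x t
  sign_neg : ∀ j : Fin n, ¬ j.val < m → ∀ x t, a j x t ≤ -Λ
  levy : ∀ j k, j ≠ k → ∀ x t, b j k x t = β j k x t * (a k x t - a j x t)

namespace Sys

variable {n m : ℕ} (S : Sys n m) (j : Fin n)

theorem M_pos : 0 < S.M := one_pos.trans_le S.one_le_M

theorem Λ_le_abs (x t : ℝ) : S.Λ ≤ |S.a j x t| := by
  by_cases h : j.val < m
  · exact (S.sign_pos j h x t).trans (le_abs_self _)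
  · have := S.sign_neg j h x t
    exact (by linarith : S.Λ ≤ -S.a j x t).trans (neg_le_abs _)

theorem a_ne (x t : ℝ) : S.a j x t ≠ 0 := abs_pos.1 (S.Λ_pos.trans_le (S.Λ_le_abs j x t))

/-- The reciprocal speed. -/
def f (x t : ℝ) : ℝ := 1 / S.a j x t

/-- The time derivative of the reciprocal speed. -/
def fT (x t : ℝ) : ℝ := -S.aT j x t / S.a j x t ^ 2

/-- A bound for the time needed to cross the strip. -/
def δ : ℝ := 1 / S.Λ

/-- A Lipschitz constant of the reciprocal speeds. -/
def L : ℝ := S.M / S.Λ ^ 2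

theorem δ_pos : 0 < S.δ := one_div_pos.2 S.Λ_pos

theorem L_nonneg : 0 ≤ S.L := by have := S.M_pos; unfold L; positivity

@[fun_prop] theorem continuous_a : Continuous fun z : ℝ × ℝ => S.a j z.1 z.2 := (S.ha j).cont

@[fun_prop] theorem continuous_f : Continuous fun z : ℝ × ℝ => S.f j z.1 z.2 :=
  continuous_const.div (S.continuous_a j) fun z => S.a_ne j z.1 z.2

@[fun_prop] theorem continuous_fT : Continuous fun z : ℝ × ℝ => S.fT j z.1 z.2 :=
  ((S.ha j).cont_t.neg).div ((S.continuous_a j).pow 2) fun z => pow_ne_zero 2 (S.a_ne j z.1 z.2)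

theorem hasDerivAt_f (x t : ℝ) : HasDerivAt (fun s => S.f j x s) (S.fT j x t) t := by
  have := ((S.ha j).deriv_t x t).inv (S.a_ne j x t)
  simp only [f, fT, one_div]
  exact this

theorem abs_f_le (x t : ℝ) : |S.f j x t| ≤ S.δ := by
  rw [f, δ, abs_div, abs_one]
  exact one_div_le_one_div_of_le S.Λ_pos (S.Λ_le_abs j x t)

theorem abs_fT_le (x t : ℝ) : |S.fT j x t| ≤ S.L := by
  rw [fT, L, abs_div, abs_neg, abs_pow]
  have h := S.Λ_le_abs j x t
  have := S.Λ_pos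
  have := S.M_pos
  have := (S.ha j).bound_t x t
  gcongr

theorem f_lower_pos (h : j.val < m) (x t : ℝ) : 1 / S.M ≤ S.f j x t :=
  one_div_le_one_div_of_le (S.Λ_pos.trans_le (S.sign_pos j h x t))
    ((le_abs_self _).trans ((S.ha j).bound x t))

theorem f_upper_neg (h : ¬ j.val < m) (x t : ℝ) : S.f j x t ≤ -(1 / S.M) := by
  have h1 : 0 < -S.a j x t := by linarith [S.sign_neg j h x t, S.Λ_pos]
  have h2 : 1 / S.M ≤ 1 / (-S.a j x t) :=
    one_div_le_one_div_of_le h1 ((neg_le_abs _).trans ((S.ha j).bound x t))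
  rw [one_div_neg_eq_neg_one_div] at h2
  unfold f; linarith

/-! ### Characteristics -/

/-- The mean slope of the reciprocal speed between two times. -/
def slopeF (x s₁ s₂ : ℝ) : ℝ := ∫ θ in (0 : ℝ)..1, S.fT j x (s₂ + θ * (s₁ - s₂))

/-- Having an equality here, not merely a Lipschitz bound, makes the difference of two
characteristics satisfy a linear differential equation. Uniqueness, continuity and differentiability
in the initial data are all read off from its explicit solution. -/
theorem f_sub_f (x s₁ s₂ : ℝ) : S.f j x s₁ - S.f j x s₂ = S.slopeF j x s₁ s₂ * (s₁ - s₂) := by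
  have := intervalIntegral.integral_eq_sub_of_hasDerivAt (a := (0 : ℝ)) (b := 1)
    (f := fun θ => S.f j x (s₂ + θ * (s₁ - s₂)))
    (f' := fun θ => S.fT j x (s₂ + θ * (s₁ - s₂)) * (s₁ - s₂)) ?_ ?_
  · rw [intervalIntegral.integral_mul_const] at this
    rw [slopeF, this]; simp
  · intro θ _
    have h1 : HasDerivAt (fun θ : ℝ => s₂ + θ * (s₁ - s₂)) (s₁ - s₂) θ := by
      simpa using ((hasDerivAt_id θ).mul_const (s₁ - s₂)).const_add s₂
    exact (S.hasDerivAt_f j x _).comp θ h1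
  · exact (by fun_prop : Continuous fun θ =>
      S.fT j x (s₂ + θ * (s₁ - s₂)) * (s₁ - s₂)).intervalIntegrable _ _

@[fun_prop] theorem continuous_slopeF :
    Continuous fun z : ℝ × ℝ × ℝ => S.slopeF j z.1 z.2.1 z.2.2 := by
  apply intervalIntegral.continuous_parametric_intervalIntegral_of_continuous'
  unfold Function.uncurry; fun_prop

theorem slopeF_self (x s : ℝ) : S.slopeF j x s s = S.fT j x s := by simp [slopeF]

theorem abs_slopeF_le (x s₁ s₂ : ℝ) : |S.slopeF j x s₁ s₂| ≤ S.L := by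
  have := intervalIntegral.norm_integral_le_of_norm_le_const (a := (0 : ℝ)) (b := 1) (C := S.L)
    (f := fun θ => S.fT j x (s₂ + θ * (s₁ - s₂))) fun θ _ => S.abs_fT_le j _ _
  simpa [slopeF] using this

theorem abs_f_sub_f_le (x s₁ s₂ : ℝ) : |S.f j x s₁ - S.f j x s₂| ≤ S.L * |s₁ - s₂| := by
  rw [f_sub_f, abs_mul]
  exact mul_le_mul_of_nonneg_right (S.abs_slopeF_le j x s₁ s₂) (abs_nonneg _)

/-- Picard–Lindelöf applies on all of `[0,1]` at once, because the reciprocal speed is globally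
bounded by `δ` and globally Lipschitz in time. -/
theorem exists_isCharacteristic {x : ℝ} (hx : x ∈ Icc (0 : ℝ) 1) (t : ℝ) :
    ∃ w, IsCharacteristic (S.a j) x t w := by
  have hPL : IsPicardLindelof (S.f j) (⟨x, hx⟩ : Icc (0 : ℝ) 1) t
      ⟨S.δ, S.δ_pos.le⟩ 0 ⟨S.δ, S.δ_pos.le⟩ ⟨S.L, S.L_nonneg⟩ := by
    refine ⟨fun y _ => ?_, fun s _ => ?_, fun y _ s _ => S.abs_f_le j y s, ?_⟩
    · refine LipschitzOnWith.of_dist_le_mul fun s₁ _ s₂ _ => ?_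
      exact S.abs_f_sub_f_le j y s₁ s₂
    · exact (by fun_prop : Continuous fun y => S.f j y s).continuousOn
    -- A curve of slope at most `δ` over a length at most 1 stays in the ball of radius `δ` about
    -- `t`, so no subinterval is needed.
    · have h1 : max (1 - x) (x - 0) ≤ 1 := max_le (by linarith [hx.1]) (by linarith [hx.2])
      have := mul_le_mul_of_nonneg_left h1 S.δ_pos.le
      rw [mul_one] at this
      change S.δ * max (1 - x) (x - 0) ≤ S.δ - ((0 : NNReal) : ℝ)
      rwa [NNReal.coe_zero, sub_zero S.δ]
  obtain ⟨w, hw, hw'⟩ := hPL.exists_eq_forall_mem_Icc_hasDerivWithinAt₀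
  exact ⟨w, hw, hw'⟩

theorem isCharacteristic_omega {x : ℝ} (hx : x ∈ Icc (0 : ℝ) 1) (t : ℝ) :
    IsCharacteristic (S.a j) x t (fun ξ => omega (S.a j) ξ x t) := by
  have h := S.exists_isCharacteristic j hx t
  have h2 : (fun ξ => omega (S.a j) ξ x t) = h.choose := by
    funext ξ; simp [omega, h]
  rw [h2]; exact h.choose_spec

/-- The characteristic of the `j`-th speed through `(x, t)`, with both space variables projected
to `[0,1]`. -/
def W (ξ x t : ℝ) : ℝ := omega (S.a j) (pj ξ) (pj x) t

@[simp] theorem W_pj_left (ξ x t : ℝ) : S.W j (pj ξ) x t = S.W j ξ x t := by simp [W]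

@[simp] theorem W_pj_right (ξ x t : ℝ) : S.W j ξ (pj x) t = S.W j ξ x t := by simp [W]

theorem W_eq_omega {ξ x : ℝ} (hξ : ξ ∈ Icc (0 : ℝ) 1) (hx : x ∈ Icc (0 : ℝ) 1) (t : ℝ) :
    S.W j ξ x t = omega (S.a j) ξ x t := by rw [W, pj_of_mem hξ, pj_of_mem hx]

@[simp] theorem W_self (x t : ℝ) : S.W j x x t = t :=
  (S.isCharacteristic_omega j (pj_mem x) t).1

theorem hasDerivWithinAt_W {ξ : ℝ} (hξ : ξ ∈ Icc (0 : ℝ) 1) (x t : ℝ) :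
    HasDerivWithinAt (fun ξ => S.W j ξ x t) (S.f j ξ (S.W j ξ x t)) (Icc 0 1) ξ := by
  have h := (S.isCharacteristic_omega j (pj_mem x) t).2 ξ hξ
  refine (h.congr (fun y hy => by simp only [W, pj_of_mem hy]) (by simp only [W, pj_of_mem hξ])).congr_deriv ?_
  simp only [W, pj_of_mem hξ, f]

theorem continuous_W_left (x t : ℝ) : Continuous fun ξ => S.W j ξ x t := by
  have h : ContinuousOn (fun ξ => S.W j ξ x t) (Icc 0 1) :=
    fun ξ hξ => (S.hasDerivWithinAt_W j hξ x t).continuousWithinAt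
  exact (h.comp_continuous continuous_pj pj_mem).congr fun ξ => S.W_pj_left j ξ x t

/-- Exact formula for the difference of two characteristics. -/
theorem W_sub_W (ξ y x x' t t' : ℝ) :
    S.W j ξ x t - S.W j ξ x' t' = (S.W j y x t - S.W j y x' t') *
      Real.exp (∫ η in (pj y)..(pj ξ), S.slopeF j η (S.W j η x t) (S.W j η x' t')) := by
  have h1 := S.continuous_W_left j x t
  have h2 := S.continuous_W_left j x' t'
  have := eq_mul_exp_of_hasDerivWithinAt (D := fun ξ => S.W j ξ x t - S.W j ξ x' t')
    (q := fun η => S.slopeF j η (S.W j η x t) (S.W j η x' t')) (by fun_prop)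
    (fun ξ hξ => ((S.hasDerivWithinAt_W j hξ x t).sub
      (S.hasDerivWithinAt_W j hξ x' t')).congr_deriv (S.f_sub_f j _ _ _)) (pj_mem y) (pj_mem ξ)
  simpa using this

/-- Uniqueness: the two curves agree at `ξ`, so the prefactor in `W_sub_W` vanishes. -/
theorem W_comp (η ξ x t : ℝ) : S.W j η ξ (S.W j ξ x t) = S.W j η x t := by
  have := S.W_sub_W j η ξ ξ x (S.W j ξ x t) t
  simpa [sub_eq_zero] using this

theorem W_eq_add_integral (ξ ξ' x t : ℝ) :
    ∫ η in (pj ξ)..(pj ξ'), S.f j η (S.W j η x t) = S.W j ξ' x t - S.W j ξ x t := by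
  have h1 := S.continuous_W_left j x t
  have := integral_eq_sub_of_hasDerivWithinAt_Icc (pj_mem ξ) (pj_mem ξ')
    (g' := fun η => S.f j η (S.W j η x t)) (by fun_prop)
    (fun η hη => S.hasDerivWithinAt_W j hη x t)
  simpa using this

theorem abs_W_sub_W_le (ξ ξ' x t : ℝ) :
    |S.W j ξ' x t - S.W j ξ x t| ≤ S.δ * |pj ξ' - pj ξ| := by
  rw [← W_eq_add_integral]
  exact abs_integral_le_mul (fun η => S.abs_f_le j _ _) _ _

theorem abs_pj_sub_le_one (x y : ℝ) : |pj x - pj y| ≤ 1 :=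
  abs_le.2 ⟨by linarith [(pj_mem x).1, (pj_mem y).2], by linarith [(pj_mem x).2, (pj_mem y).1]⟩

theorem abs_W_sub_le (ξ x t : ℝ) : |S.W j ξ x t - t| ≤ S.δ := by
  have h := S.abs_W_sub_W_le j x ξ x t
  rw [W_self] at h
  exact h.trans (mul_le_of_le_one_right S.δ_pos.le (abs_pj_sub_le_one _ _))

/-- Speeds are at most `M`, so crossing a distance takes at least that distance divided by `M`. -/
theorem W_mono_of_pos (h : j.val < m) {ξ ξ' : ℝ} (hle : pj ξ ≤ pj ξ') (x t : ℝ) :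
    (pj ξ' - pj ξ) / S.M ≤ S.W j ξ' x t - S.W j ξ x t := by
  rw [← W_eq_add_integral]
  have h1 := S.continuous_W_left j x t
  have := intervalIntegral.integral_mono_on (μ := volume) hle
    (f := fun _ => 1 / S.M) (g := fun η => S.f j η (S.W j η x t)) intervalIntegrable_const
    ((by fun_prop : Continuous fun η => S.f j η (S.W j η x t)).intervalIntegrable _ _)
    fun η _ => S.f_lower_pos j h _ _
  simpa [div_eq_mul_inv] using this

theorem W_anti_of_neg (h : ¬ j.val < m) {ξ ξ' : ℝ} (hle : pj ξ ≤ pj ξ') (x t : ℝ) :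
    (pj ξ' - pj ξ) / S.M ≤ S.W j ξ x t - S.W j ξ' x t := by
  have h2 := S.W_eq_add_integral j ξ ξ' x t
  have h1 := S.continuous_W_left j x t
  have := intervalIntegral.integral_mono_on (μ := volume) hle
    (g := fun _ => -(1 / S.M)) (f := fun η => S.f j η (S.W j η x t))
    ((by fun_prop : Continuous fun η => S.f j η (S.W j η x t)).intervalIntegrable _ _)
    intervalIntegrable_const fun η _ => S.f_upper_neg j h _ _
  rw [h2, intervalIntegral.integral_const, smul_eq_mul] at this
  rw [div_eq_mul_one_div]; linarith

/-- Along a characteristic the time determines the position. -/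
theorem eq_of_W_eq {ξ ξ' x t : ℝ} (hξ : ξ ∈ Icc (0 : ℝ) 1) (hξ' : ξ' ∈ Icc (0 : ℝ) 1)
    (h : S.W j ξ x t = S.W j ξ' x t) : ξ = ξ' := by
  wlog hle : ξ ≤ ξ' generalizing ξ ξ'
  · exact (this hξ' hξ h.symm (le_of_not_ge hle)).symm
  have hle' : pj ξ ≤ pj ξ' := by rwa [pj_of_mem hξ, pj_of_mem hξ']
  have hM := S.M_pos
  have : (pj ξ' - pj ξ) / S.M ≤ 0 := by
    by_cases hj : j.val < m
    · have := S.W_mono_of_pos j hj hle' x t; linarith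
    · have := S.W_anti_of_neg j hj hle' x t; linarith
  rw [pj_of_mem hξ, pj_of_mem hξ', div_nonpos_iff] at this
  rcases this with h | h <;> linarith [h.1, h.2]

theorem xIn_mem : xIn m j ∈ Icc (0 : ℝ) 1 := by unfold xIn; split_ifs <;> simp

theorem xOut_mem : xOut m j ∈ Icc (0 : ℝ) 1 := by unfold xOut; split_ifs <;> simp

/-- Going back towards the inflow boundary, time decreases at least at rate `1 / M`. -/
theorem W_le_of_between {ξ x : ℝ} (hx : x ∈ Icc (0 : ℝ) 1) (hξ : ξ ∈ uIcc (xIn m j) x) (t : ℝ) :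
    S.W j ξ x t ≤ t - |x - ξ| / S.M := by
  have hξ1 : ξ ∈ Icc (0 : ℝ) 1 := uIcc_subset_Icc (xIn_mem j) hx hξ
  by_cases hj : j.val < m
  · simp only [xIn, hj, if_true, uIcc_of_le hx.1] at hξ
    have := S.W_mono_of_pos j hj (ξ := ξ) (ξ' := x) (by rw [pj_of_mem hξ1, pj_of_mem hx]; exact hξ.2) x t
    rw [pj_of_mem hξ1, pj_of_mem hx, W_self] at this
    rw [abs_of_nonneg (by linarith [hξ.2])]; linarith
  · simp only [xIn, hj, if_false, uIcc_of_ge hx.2] at hξ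
    have := S.W_anti_of_neg j hj (ξ := x) (ξ' := ξ) (by rw [pj_of_mem hξ1, pj_of_mem hx]; exact hξ.1) x t
    rw [pj_of_mem hξ1, pj_of_mem hx, W_self] at this
    rw [abs_sub_comm, abs_of_nonneg (by linarith [hξ.1])]; linarith

theorem W_le_self_of_between {ξ x : ℝ} (hx : x ∈ Icc (0 : ℝ) 1) (hξ : ξ ∈ uIcc (xIn m j) x)
    (t : ℝ) : S.W j ξ x t ≤ t :=
  (S.W_le_of_between j hx hξ t).trans
    (sub_le_self _ (div_nonneg (abs_nonneg _) S.M_pos.le))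

theorem abs_integral_slopeF_le (y ξ x x' t t' : ℝ) :
    |∫ η in (pj y)..(pj ξ), S.slopeF j η (S.W j η x t) (S.W j η x' t')| ≤ S.L := by
  refine (abs_integral_le_mul (fun η => S.abs_slopeF_le j _ _ _) _ _).trans ?_
  exact mul_le_of_le_one_right S.L_nonneg (abs_pj_sub_le_one _ _)

/-- The two curves are compared at the point `x`, where the first equals `t` and the second has
moved from `t'` by at most `δ |pj x - pj x'|`; the exponential factor in `W_sub_W` then transports
the difference to `ξ`. -/
theorem abs_W_sub_W_le_initial (ξ x x' t t' : ℝ) :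
    |S.W j ξ x t - S.W j ξ x' t'| ≤ (|t - t'| + S.δ * |pj x - pj x'|) * Real.exp S.L := by
  rw [S.W_sub_W j ξ x, abs_mul, W_self, abs_of_pos (Real.exp_pos _)]
  have hδ := S.δ_pos
  gcongr ?_ * Real.exp ?_
  · have h := S.abs_W_sub_W_le j x' x x' t'
    rw [W_self] at h
    have := abs_sub_le t t' (S.W j x x' t')
    rw [abs_sub_comm t' _] at this
    linarith
  · exact (le_abs_self _).trans (S.abs_integral_slopeF_le j _ _ _ _ _ _)

/-- Lipschitz dependence on the initial point is uniform in `ξ`, so joint continuity reduces to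
continuity in `ξ` for one fixed initial point. -/
theorem continuous_W : Continuous fun z : ℝ × ℝ × ℝ => S.W j z.1 z.2.1 z.2.2 := by
  rw [continuous_iff_continuousAt]
  rintro ⟨ξ₀, x₀, t₀⟩
  rw [ContinuousAt, tendsto_iff_dist_tendsto_zero]
  refine squeeze_zero (fun _ => dist_nonneg)
    (g := fun z : ℝ × ℝ × ℝ => (|z.2.2 - t₀| + S.δ * |pj z.2.1 - pj x₀|) * Real.exp S.L +
      |S.W j z.1 x₀ t₀ - S.W j ξ₀ x₀ t₀|) (fun z => ?_) ?_
  · rw [Real.dist_eq]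
    exact (abs_sub_le _ (S.W j z.1 x₀ t₀) _).trans
      (add_le_add_left (S.abs_W_sub_W_le_initial j _ _ _ _ _) _)
  · have hc := S.continuous_W_left j x₀ t₀
    have : Continuous fun z : ℝ × ℝ × ℝ =>
      (|z.2.2 - t₀| + S.δ * |pj z.2.1 - pj x₀|) * Real.exp S.L +
      |S.W j z.1 x₀ t₀ - S.W j ξ₀ x₀ t₀| := by fun_prop
    have h := this.tendsto (ξ₀, x₀, t₀)
    simpa using h

@[fun_prop] theorem continuous_W_comp {X : Type*} [TopologicalSpace X] {u v w : X → ℝ}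
    (hu : Continuous u) (hv : Continuous v) (hw : Continuous w) :
    Continuous fun z => S.W j (u z) (v z) (w z) :=
  (S.continuous_W j).comp (hu.prodMk (hv.prodMk hw))

/-- The derivative of the characteristic with respect to the initial time. -/
def WT (ξ x t : ℝ) : ℝ := Real.exp (∫ η in (pj x)..(pj ξ), S.fT j η (S.W j η x t))

theorem WT_pos (ξ x t : ℝ) : 0 < S.WT j ξ x t := Real.exp_pos _

/-- By `W_sub_W` the difference quotient in the initial time equals the exponential of an integrated
mean slope. This is continuous in `s` and becomes `WT` at `s = t`. -/
theorem hasDerivAt_W (ξ x t : ℝ) : HasDerivAt (fun s => S.W j ξ x s) (S.WT j ξ x t) t := by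
  rw [hasDerivAt_iff_tendsto_slope]
  have hc : Continuous fun s : ℝ => Real.exp (∫ η in (pj x)..(pj ξ),
      S.slopeF j η (S.W j η x s) (S.W j η x t)) := by
    refine Real.continuous_exp.comp ?_
    apply intervalIntegral.continuous_parametric_intervalIntegral_of_continuous'
    unfold Function.uncurry; fun_prop
  have h := (hc.tendsto t).mono_left (nhdsWithin_le_nhds (s := {t}ᶜ))
  simp only [slopeF_self] at h
  refine h.congr' ?_
  filter_upwards [self_mem_nhdsWithin] with s hs
  have hs' : s - t ≠ 0 := sub_ne_zero.2 hs
  rw [slope_def_field, S.W_sub_W j ξ x x x s t, W_self, W_self]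
  field_simp

theorem abs_integral_fT_le (x y ξ t : ℝ) :
    |∫ η in (pj y)..(pj ξ), S.fT j η (S.W j η x t)| ≤ S.L := by
  refine (abs_integral_le_mul (fun η => S.abs_fT_le j _ _) _ _).trans ?_
  exact mul_le_of_le_one_right S.L_nonneg (abs_pj_sub_le_one _ _)

theorem WT_le (ξ x t : ℝ) : S.WT j ξ x t ≤ Real.exp S.L :=
  Real.exp_le_exp.2 ((le_abs_self _).trans (S.abs_integral_fT_le j _ _ _ _))

theorem le_WT (ξ x t : ℝ) : Real.exp (-S.L) ≤ S.WT j ξ x t :=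
  Real.exp_le_exp.2 (neg_le_of_abs_le (S.abs_integral_fT_le j _ _ _ _))

@[fun_prop] theorem continuous_WT_comp {X : Type*} [TopologicalSpace X] {u v w : X → ℝ}
    (hu : Continuous u) (hv : Continuous v) (hw : Continuous w) :
    Continuous fun z => S.WT j (u z) (v z) (w z) := by
  have : Continuous fun z : ℝ × ℝ × ℝ => S.WT j z.1 z.2.1 z.2.2 := by
    unfold WT
    exact Real.continuous_exp.comp
      (continuous_integral_param (by fun_prop) (by fun_prop) (by fun_prop))
  exact this.comp (hu.prodMk (hv.prodMk hw))

theorem hasDerivWithinAt_WT {ξ : ℝ} (hξ : ξ ∈ Icc (0 : ℝ) 1) (x t : ℝ) :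
    HasDerivWithinAt (fun ξ => S.WT j ξ x t) (S.fT j ξ (S.W j ξ x t) * S.WT j ξ x t)
      (Icc 0 1) ξ := by
  have h := (hasDerivWithinAt_integral_Icc (g := fun η => S.fT j η (S.W j η x t))
    (by fun_prop) (pj x) ξ (Icc 0 1)).exp
  refine (h.congr (fun y hy => by simp only [WT, pj_of_mem hy])
    (by simp only [WT, pj_of_mem hξ])).congr_deriv ?_
  simp only [WT, pj_of_mem hξ, mul_comm]

end Sys

/-! ### Classical solutions and their extension to the plane -/

variable {n m : ℕ}

/-- Solutions for `t ≥ τ` of the boundary value problem with source `g`, extended to the plane so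
that they are continuous and continuously differentiable in time everywhere. -/
structure Sys.IsSol (S : Sys n m) (τ : ℝ) (g u uX uT : Fin n → ℝ → ℝ → ℝ) : Prop where
  cont : ∀ j, Continuous fun z : ℝ × ℝ => u j z.1 z.2
  cont_x : ∀ j, Continuous fun z : ℝ × ℝ => uX j z.1 z.2
  cont_t : ∀ j, Continuous fun z : ℝ × ℝ => uT j z.1 z.2
  proj : ∀ j x t, u j (pj x) t = u j x t
  deriv_x : ∀ j, ∀ x ∈ Icc (0 : ℝ) 1, ∀ t ≥ τ,
    HasDerivWithinAt (fun y => u j y t) (uX j x t) (Icc 0 1) x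
  deriv_t : ∀ j x t, HasDerivAt (fun s => u j x s) (uT j x t) t
  pde : ∀ j, ∀ x ∈ Icc (0 : ℝ) 1, ∀ t ≥ τ,
    uT j x t + S.a j x t * uX j x t + ∑ k, S.b j k x t * u k x t = g j x t
  bc : ∀ j, ∀ t ≥ τ, u j (xIn m j) t = opP m S.p u j t

/-- Extension to the plane of a function that is `C¹` on `[0,1] × [τ,∞)`. -/
def extendTime (τ : ℝ) (u ut : ℝ → ℝ → ℝ) (x t : ℝ) : ℝ :=
  u (pj x) (max t τ) + (min t τ - τ) * ut (pj x) τ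

theorem extendTime_of_mem {τ : ℝ} (u ut : ℝ → ℝ → ℝ) {x t : ℝ} (hx : x ∈ Icc (0 : ℝ) 1)
    (ht : τ ≤ t) : extendTime τ u ut x t = u x t := by
  simp [extendTime, pj_of_mem hx, ht]

theorem continuous_proj_max {v : ℝ → ℝ → ℝ} {τ : ℝ}
    (hv : ContinuousOn (fun z : ℝ × ℝ => v z.1 z.2) (Icc 0 1 ×ˢ Ici τ)) :
    Continuous fun z : ℝ × ℝ => v (pj z.1) (max z.2 τ) :=
  hv.comp_continuous (f := fun z : ℝ × ℝ => (pj z.1, max z.2 τ)) (by fun_prop)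
    fun z => ⟨pj_mem _, le_max_right z.2 τ⟩

/-- Before `τ` the extension is affine with slope the one-sided derivative at `τ`, so the two
one-sided derivatives match there. -/
theorem HasC1Partials.hasDerivAt_extendTime {τ : ℝ} {u ux ut : ℝ → ℝ → ℝ}
    (h : HasC1Partials (Icc 0 1) (Ici τ) u ux ut) (x t : ℝ) :
    HasDerivAt (fun s => extendTime τ u ut x s) (ut (pj x) (max t τ)) t := by
  have hr : ∀ t, τ ≤ t →
      HasDerivWithinAt (fun s => extendTime τ u ut x s) (ut (pj x) (max t τ)) (Ici τ) t := by
    intro t ht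
    have h1 := h.deriv_t (pj x) (pj_mem x) t ht
    rw [max_eq_left ht]
    refine h1.congr (fun s hs => ?_) ?_
    · simp [extendTime, mem_Ici.1 hs]
    · simp [extendTime, ht]
  have hl : ∀ t, t ≤ τ →
      HasDerivWithinAt (fun s => extendTime τ u ut x s) (ut (pj x) (max t τ)) (Iic τ) t := by
    intro t ht
    have h1 : HasDerivWithinAt (fun s => u (pj x) τ + (s - τ) * ut (pj x) τ) (ut (pj x) τ)
        (Iic τ) t := by
      simpa using ((((hasDerivAt_id t).sub_const τ).mul_const (ut (pj x) τ)).const_add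
        (u (pj x) τ)).hasDerivWithinAt
    rw [max_eq_right ht]
    refine h1.congr (fun s hs => ?_) ?_
    · simp [extendTime, mem_Iic.1 hs]
    · simp [extendTime, ht]
  rcases lt_trichotomy t τ with ht | rfl | ht
  · exact (hl t ht.le).hasDerivAt (Iic_mem_nhds ht)
  · have := (hl t le_rfl).union (hr t le_rfl)
    rwa [Iic_union_Ici, hasDerivWithinAt_univ] at this
  · exact (hr t ht.le).hasDerivAt (Ici_mem_nhds ht)

/-- A classical solution extends to the plane. -/
theorem IsClassicalSolution.exists_isSol {S : Sys n m} {τ : ℝ} {φ : Fin n → ℝ → ℝ}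
    {u : Fin n → ℝ → ℝ → ℝ} (hu : IsClassicalSolution m S.a S.b S.p τ φ u) :
    ∃ v vX vT, S.IsSol τ (fun _ _ _ => 0) v vX vT ∧
      ∀ j, ∀ x ∈ Icc (0 : ℝ) 1, ∀ t ≥ τ, v j x t = u j x t := by
  obtain ⟨⟨ux, ut, h, hpde⟩, hbc, -⟩ := hu
  have hv : ∀ j, ∀ x ∈ Icc (0 : ℝ) 1, ∀ t ≥ τ, extendTime τ (u j) (ut j) x t = u j x t :=
    fun j x hx t ht => extendTime_of_mem _ _ hx ht
  have hc : ∀ j, Continuous fun z : ℝ × ℝ => extendTime τ (u j) (ut j) z.1 z.2 := by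
    intro j
    have h1 := continuous_proj_max (h j).cont
    have h2 : Continuous fun z : ℝ × ℝ => ut j (pj z.1) τ := by
      have := (continuous_proj_max (h j).cont_t).comp
        (by fun_prop : Continuous fun z : ℝ × ℝ => (z.1, τ))
      simpa [Function.comp_def] using this
    have h3 : Continuous fun z : ℝ × ℝ => min z.2 τ - τ := by fun_prop
    exact h1.add (h3.mul h2)
  have hcx := fun j => continuous_proj_max (h j).cont_x
  have hct := fun j => continuous_proj_max (h j).cont_t
  have hcb := fun j k => (S.hb j k).cont
  refine ⟨fun j => extendTime τ (u j) (ut j), fun j x t => ux j (pj x) (max t τ),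
    fun j x t => ut j (pj x) (max t τ),
    ⟨hc, hcx, hct, fun j x t => by simp [extendTime], ?_,
      fun j x t => (h j).hasDerivAt_extendTime x t, ?_, ?_⟩, hv⟩
  · intro j x hx t ht
    have := (h j).deriv_x x hx t ht
    rw [pj_of_mem hx, max_eq_left ht]
    exact this.congr (fun y hy => hv j y hy t ht) (hv j x hx t ht)
  · intro j x hx t ht
    -- The equation is given only for `0 < x < 1` and `t > τ`. All terms are continuous, so it
    -- persists on the closure of that region.
    have hcl : IsClosed {z : ℝ × ℝ | ut j (pj z.1) (max z.2 τ) +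
        S.a j z.1 z.2 * ux j (pj z.1) (max z.2 τ) +
        ∑ k, S.b j k z.1 z.2 * extendTime τ (u k) (ut k) z.1 z.2 = 0} := by
      refine isClosed_eq ?_ continuous_const
      exact ((hct j).add ((S.continuous_a j).mul (hcx j))).add
        (continuous_finsetSum _ fun k _ => (hcb j k).mul (hc k))
    have hsub : Ioo (0 : ℝ) 1 ×ˢ Ioi τ ⊆ {z : ℝ × ℝ | ut j (pj z.1) (max z.2 τ) +
        S.a j z.1 z.2 * ux j (pj z.1) (max z.2 τ) +
        ∑ k, S.b j k z.1 z.2 * extendTime τ (u k) (ut k) z.1 z.2 = 0} := by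
      rintro ⟨y, s⟩ ⟨hy, hs⟩
      have hy' := Ioo_subset_Icc_self hy
      have hs' : τ ≤ s := le_of_lt hs
      have := hpde j y hy s hs
      simp only [mem_ofPred_eq, pj_of_mem hy', max_eq_left hs']
      rw [← this]
      congr 1
      exact Finset.sum_congr rfl fun k _ => by rw [hv k y hy' s hs']
    have := closure_minimal hsub hcl
    rw [closure_prod_eq, closure_Ioo (zero_ne_one' ℝ), closure_Ioi] at this
    exact this (⟨hx, ht⟩ : (x, t) ∈ Icc (0 : ℝ) 1 ×ˢ Ici τ)
  · intro j t ht
    simp only [opP]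
    rw [hv j _ (Sys.xIn_mem j) t ht, hbc j t ht, opP]
    exact Finset.sum_congr rfl fun k _ => by rw [hv k _ (Sys.xOut_mem k) t ht]

/-- Linear combinations of classical solutions. -/
theorem IsClassicalSolution.comb {a : Fin n → ℝ → ℝ → ℝ} {b : Fin n → Fin n → ℝ → ℝ → ℝ}
    {p : Fin n → Fin n → ℝ} {τ : ℝ} {φ ψ : Fin n → ℝ → ℝ} {u v : Fin n → ℝ → ℝ → ℝ}
    (hu : IsClassicalSolution m a b p τ φ u) (hv : IsClassicalSolution m a b p τ ψ v) (c d : ℝ) :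
    IsClassicalSolution m a b p τ (fun j x => c * φ j x + d * ψ j x)
      (fun j x t => c * u j x t + d * v j x t) := by
  obtain ⟨⟨ux, ut, h, hpde⟩, hbc, hic⟩ := hu
  obtain ⟨⟨vx, vt, h', hpde'⟩, hbc', hic'⟩ := hv
  refine ⟨⟨fun j x t => c * ux j x t + d * vx j x t, fun j x t => c * ut j x t + d * vt j x t,
    fun j => ⟨?_, ?_, ?_, ?_, ?_⟩, ?_⟩, ?_, ?_⟩
  · exact ((h j).cont.const_mul c).add ((h' j).cont.const_mul d)
  · exact ((h j).cont_x.const_mul c).add ((h' j).cont_x.const_mul d)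
  · exact ((h j).cont_t.const_mul c).add ((h' j).cont_t.const_mul d)
  · exact fun x hx t ht => (((h j).deriv_x x hx t ht).const_mul c).add
      (((h' j).deriv_x x hx t ht).const_mul d)
  · exact fun x hx t ht => (((h j).deriv_t x hx t ht).const_mul c).add
      (((h' j).deriv_t x hx t ht).const_mul d)
  · intro j x hx t ht
    have e1 := hpde j x hx t ht
    have e2 := hpde' j x hx t ht
    have e3 : ∑ k, b j k x t * (c * u k x t + d * v k x t) =
        c * ∑ k, b j k x t * u k x t + d * ∑ k, b j k x t * v k x t := by
      rw [Finset.mul_sum, Finset.mul_sum, ← Finset.sum_add_distrib]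
      exact Finset.sum_congr rfl fun k _ => by ring
    rw [e3]
    linear_combination c * e1 + d * e2
  · intro j t ht
    simp only [hbc j t ht, hbc' j t ht, opP]
    rw [Finset.mul_sum, Finset.mul_sum, ← Finset.sum_add_distrib]
    exact Finset.sum_congr rfl fun k _ => by ring
  · intro j x hx
    simp only [hic j x hx, hic' j x hx]

/-- The restriction of a classical solution to a later time interval. -/
theorem IsClassicalSolution.restart {a : Fin n → ℝ → ℝ → ℝ} {b : Fin n → Fin n → ℝ → ℝ → ℝ}
    {p : Fin n → Fin n → ℝ} {τ s : ℝ} {φ : Fin n → ℝ → ℝ} {u : Fin n → ℝ → ℝ → ℝ}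
    (hu : IsClassicalSolution m a b p τ φ u) (hs : τ ≤ s) :
    IsClassicalSolution m a b p s (fun j x => u j x s) u := by
  obtain ⟨⟨ux, ut, h, hpde⟩, hbc, hic⟩ := hu
  have hsub : Ici s ⊆ Ici τ := Ici_subset_Ici.2 hs
  have hsub' : Icc (0 : ℝ) 1 ×ˢ Ici s ⊆ Icc (0 : ℝ) 1 ×ˢ Ici τ := prod_mono_right hsub
  exact ⟨⟨ux, ut, fun j => ⟨(h j).cont.mono hsub', (h j).cont_x.mono hsub', (h j).cont_t.mono hsub',
    fun x hx t ht => (h j).deriv_x x hx t (hsub ht),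
    fun x hx t ht => ((h j).deriv_t x hx t (hsub ht)).mono hsub⟩,
    fun j x hx t ht => hpde j x hx t (lt_of_le_of_lt hs ht)⟩,
    fun j t ht => hbc j t (hsub ht), fun _ _ _ => rfl⟩

namespace Sys

/-! ### The energy estimate -/

variable (S : Sys n m)

/-- The value at the inflow boundary of the weights in the energy. -/
def ε : ℝ := S.Λ / (S.M ^ 3 * n ^ 2 + S.Λ)

theorem ε_pos : 0 < S.ε := by
  have := S.Λ_pos; have := S.M_pos; unfold ε; positivity

theorem ε_le_one : S.ε ≤ 1 := by
  have := S.Λ_pos; have := S.M_pos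
  exact div_le_one_of_le₀ (le_add_of_nonneg_left (by positivity)) (by positivity)

/-- This inequality dictates the choice of `ε`. The inflow flux of one component is at most `ε M`
times `M² n` times the total squared outflow, and there are `n` components; the outflow flux must
absorb their sum with its factor `Λ`. -/
theorem ε_mul_le : S.ε * (S.M ^ 3 * n ^ 2) ≤ S.Λ := by
  have := S.Λ_pos; have := S.M_pos
  rw [ε, div_mul_eq_mul_div, div_le_iff₀ (by positivity)]
  nlinarith [sq_nonneg S.Λ]

/-- The slope of the weight of the `j`-th component. -/
def wSlope (m : ℕ) (j : Fin n) : ℝ := if j.val < m then 1 else -1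

/-- The weight of the `j`-th component in the energy. -/
def weight (j : Fin n) (x : ℝ) : ℝ := S.ε + wSlope m j * (x - xIn m j)

theorem hasDerivAt_weight (j : Fin n) (x : ℝ) : HasDerivAt (S.weight j) (wSlope m j) x := by
  have := (((hasDerivAt_id x).sub_const (xIn m j)).const_mul (wSlope m j)).const_add S.ε
  rw [mul_one] at this
  exact this

@[fun_prop] theorem continuous_weight (j : Fin n) : Continuous (S.weight j) := by
  unfold weight; fun_prop

theorem weight_mem (j : Fin n) {x : ℝ} (hx : x ∈ Icc (0 : ℝ) 1) :
    S.weight j x ∈ Icc S.ε 2 := by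
  have := S.ε_le_one
  unfold weight wSlope xIn
  split_ifs <;> constructor <;> linarith [hx.1, hx.2]

/-- The weighted energy. -/
def energy (u : Fin n → ℝ → ℝ → ℝ) (t : ℝ) : ℝ :=
  ∑ j, ∫ x in (0 : ℝ)..1, S.weight j x * u j x t ^ 2

/-- The square of the `L²` norm. -/
def normSq (u : Fin n → ℝ → ℝ) : ℝ := ∑ j, ∫ x in (0 : ℝ)..1, u j x ^ 2

/-- Each component gains at most `ε M u²` at its inflow end and loses at least `Λ u²` at its outflow
end, where the weight is `1 + ε`. The boundary condition expresses inflow by outflow values, and `ε`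
is small enough for the loss to win. -/
theorem boundary_flux_nonpos {S : Sys n m} {τ : ℝ} {g u uX uT : Fin n → ℝ → ℝ → ℝ}
    (h : S.IsSol τ g u uX uT) {t : ℝ} (ht : τ ≤ t) :
    -∑ j, (S.weight j 1 * S.a j 1 t * u j 1 t ^ 2 - S.weight j 0 * S.a j 0 t * u j 0 t ^ 2) ≤ 0 := by
  have hM := S.M_pos
  have hΛ := S.Λ_pos
  have hε := S.ε_pos
  have h1 : ∀ j, -(S.weight j 1 * S.a j 1 t * u j 1 t ^ 2 - S.weight j 0 * S.a j 0 t * u j 0 t ^ 2) ≤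
      S.ε * S.M * u j (xIn m j) t ^ 2 - S.Λ * u j (xOut m j) t ^ 2 := by
    intro j
    by_cases hj : j.val < m
    · have e1 := S.sign_pos j hj 1 t
      have e2 := (le_abs_self _).trans ((S.ha j).bound 0 t)
      simp only [weight, wSlope, xIn, xOut, hj, if_true]
      have e3 : S.Λ * u j 1 t ^ 2 ≤ (S.ε + 1) * S.a j 1 t * u j 1 t ^ 2 := by
        gcongr; nlinarith
      have e4 : S.ε * S.a j 0 t * u j 0 t ^ 2 ≤ S.ε * S.M * u j 0 t ^ 2 := by gcongr
      linarith
    · have e1 := S.sign_neg j hj 0 t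
      have e2 := (neg_le_abs _).trans ((S.ha j).bound 1 t)
      simp only [weight, wSlope, xIn, xOut, hj, if_false]
      have e3 : S.Λ * u j 0 t ^ 2 ≤ (S.ε + 1) * (-S.a j 0 t) * u j 0 t ^ 2 := by
        gcongr; nlinarith
      have e4 : S.ε * (-S.a j 1 t) * u j 1 t ^ 2 ≤ S.ε * S.M * u j 1 t ^ 2 := by gcongr
      linarith
  -- Cauchy–Schwarz in the reflection law: the factor `n` counts summands and `M²` bounds the
  -- squared coefficients.
  have h2 : ∀ j, u j (xIn m j) t ^ 2 ≤ S.M ^ 2 * n * ∑ k, u k (xOut m k) t ^ 2 := by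
    intro j
    rw [h.bc j t ht, opP]
    calc (∑ k, S.p j k * u k (xOut m k) t) ^ 2
        ≤ (Finset.univ : Finset (Fin n)).card * ∑ k, (S.p j k * u k (xOut m k) t) ^ 2 :=
          sq_sum_le_card_mul_sum_sq
      _ ≤ n * ∑ k, S.M ^ 2 * u k (xOut m k) t ^ 2 := by
          rw [Finset.card_univ, Fintype.card_fin]
          gcongr with k
          rw [mul_pow]
          have := sq_le_sq' (neg_le_of_abs_le (S.hp j k)) (le_of_abs_le (S.hp j k))
          gcongr
      _ = _ := by rw [← Finset.mul_sum]; ring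
  rw [← Finset.sum_neg_distrib]
  set O := ∑ k, u k (xOut m k) t ^ 2 with hO
  have hO0 : 0 ≤ O := Finset.sum_nonneg fun k _ => sq_nonneg _
  calc ∑ j, -(S.weight j 1 * S.a j 1 t * u j 1 t ^ 2 - S.weight j 0 * S.a j 0 t * u j 0 t ^ 2)
      ≤ ∑ j : Fin n, (S.ε * S.M * (S.M ^ 2 * n * O) - S.Λ * u j (xOut m j) t ^ 2) := by
        refine Finset.sum_le_sum fun j _ => (h1 j).trans ?_
        have := h2 j
        gcongr
    _ = (S.ε * (S.M ^ 3 * n ^ 2) - S.Λ) * O := by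
        rw [Finset.sum_sub_distrib, ← Finset.mul_sum Finset.univ _ S.Λ, ← hO]
        simp; ring
    _ ≤ 0 := mul_nonpos_of_nonpos_of_nonneg (sub_nonpos.2 S.ε_mul_le) hO0

/-- The growth rate in the energy estimate. -/
def rate : ℝ := (3 * S.M + 4 * S.M * n + 2) / S.ε

theorem rate_nonneg : 0 ≤ S.rate := by
  have := S.ε_pos; have := S.M_pos; unfold rate; positivity

variable {S} {τ : ℝ} {g u uX uT : Fin n → ℝ → ℝ → ℝ}

theorem IsSol.continuous_at_time (h : S.IsSol τ g u uX uT) (j : Fin n) (t : ℝ) :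
    Continuous fun x => u j x t :=
  (h.cont j).comp (by fun_prop : Continuous fun x : ℝ => (x, t))

theorem IsSol.hasDerivAt_energy (h : S.IsSol τ g u uX uT) (t : ℝ) :
    HasDerivAt (S.energy u)
      (∑ j, ∫ x in (0 : ℝ)..1, S.weight j x * (2 * u j x t * uT j x t)) t := by
  refine HasDerivAt.fun_sum fun j _ => ?_
  have h1 := h.cont j
  have h2 := h.cont_t j
  have hw : Continuous fun z : ℝ × ℝ => S.weight j z.1 := by fun_prop
  refine hasDerivAt_integral_param (k := fun x t => S.weight j x * u j x t ^ 2)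
    (kt := fun x t => S.weight j x * (2 * u j x t * uT j x t)) 0 1 t ?_ ?_ fun x s => ?_
  · exact hw.mul (h1.pow 2)
  · exact hw.mul ((h1.const_mul 2).mul h2)
  · simpa using ((h.deriv_t j x s).pow 2).const_mul (S.weight j x)

theorem normSq_mul_ε_le_energy (hu : ∀ j t, Continuous fun x => u j x t) (t : ℝ) :
    S.ε * normSq (fun j x => u j x t) ≤ S.energy u t := by
  rw [normSq, energy, Finset.mul_sum]
  refine Finset.sum_le_sum fun j _ => ?_
  rw [← intervalIntegral.integral_const_mul]
  have h1 := hu j t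
  refine intervalIntegral.integral_mono_on zero_le_one
    (by apply Continuous.intervalIntegrable; fun_prop)
    (by apply Continuous.intervalIntegrable; fun_prop) fun x hx => ?_
  have := (S.weight_mem j hx).1
  gcongr

theorem energy_le_normSq (hu : ∀ j t, Continuous fun x => u j x t) (t : ℝ) :
    S.energy u t ≤ 2 * normSq (fun j x => u j x t) := by
  rw [normSq, energy, Finset.mul_sum]
  refine Finset.sum_le_sum fun j _ => ?_
  rw [← intervalIntegral.integral_const_mul]
  have h1 := hu j t
  refine intervalIntegral.integral_mono_on zero_le_one
    (by apply Continuous.intervalIntegrable; fun_prop)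
    (by apply Continuous.intervalIntegrable; fun_prop) fun x hx => ?_
  have := (S.weight_mem j hx).2
  gcongr

/-- Adding the integral of an exact space derivative cancels all terms containing `uX`; that
integral is a boundary flux of known sign, so what remains is quadratic in `u` and linear in the
source. -/
theorem IsSol.energy_deriv_le (h : S.IsSol τ g u uX uT) {G : ℝ}
    (hg : ∀ j, ∀ x ∈ Icc (0 : ℝ) 1, ∀ t ≥ τ, |g j x t| ≤ G) {t : ℝ} (ht : τ ≤ t) :
    ∑ j, ∫ x in (0 : ℝ)..1, S.weight j x * (2 * u j x t * uT j x t) ≤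
      S.rate * S.energy u t + 2 * n * G ^ 2 := by
  have hM := S.M_pos
  have hc : ∀ j, Continuous fun x => u j x t := fun j => h.continuous_at_time j t
  have hcX : ∀ j, Continuous fun x => uX j x t := fun j =>
    (h.cont_x j).comp (by fun_prop : Continuous fun x : ℝ => (x, t))
  have hcT : ∀ j, Continuous fun x => uT j x t := fun j =>
    (h.cont_t j).comp (by fun_prop : Continuous fun x : ℝ => (x, t))
  have hca : ∀ j, Continuous fun x => S.a j x t := fun j => by fun_prop
  have hcaX : ∀ j, Continuous fun x => S.aX j x t := fun j =>
    ((S.ha j).cont_x).comp (by fun_prop : Continuous fun x : ℝ => (x, t))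
  -- The space derivative of `weight * a * u ^ 2`.
  let R : Fin n → ℝ → ℝ := fun j x => wSlope m j * S.a j x t * u j x t ^ 2 +
    S.weight j x * S.aX j x t * u j x t ^ 2 + S.weight j x * S.a j x t * (2 * u j x t * uX j x t)
  have hR : ∀ j, Continuous (R j) := fun j => by
    have h1 := hc j
    have h2 := hcX j
    have h3 := hca j
    have h4 := hcaX j
    exact (((h3.const_mul _).mul (h1.pow 2)).add (((S.continuous_weight j).mul h4).mul
      (h1.pow 2))).add (((S.continuous_weight j).mul h3).mul ((h1.const_mul 2).mul h2))
  have hRint : ∀ j, ∫ x in (0 : ℝ)..1, R j x =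
      S.weight j 1 * S.a j 1 t * u j 1 t ^ 2 - S.weight j 0 * S.a j 0 t * u j 0 t ^ 2 := by
    intro j
    refine integral_eq_sub_of_hasDerivWithinAt_Icc
      (g := fun x => S.weight j x * S.a j x t * u j x t ^ 2) (by simp) (by simp) (hR j)
      fun x hx => ?_
    refine ((((S.hasDerivAt_weight j x).hasDerivWithinAt.mul ((S.ha j).deriv_x x hx t)).mul
      ((h.deriv_x j x hx t ht).pow 2))).congr_deriv ?_
    simp [R]; ring
  have hflux := boundary_flux_nonpos h ht
  simp_rw [← hRint] at hflux
  have hQc : Continuous fun x => ∑ j, u j x t ^ 2 := continuous_finsetSum _ fun j _ => (hc j).pow 2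
  have key : ∀ x ∈ Icc (0 : ℝ) 1, ∑ j, (S.weight j x * (2 * u j x t * uT j x t) + R j x) ≤
      (3 * S.M + 4 * S.M * n + 2) * ∑ j, u j x t ^ 2 + 2 * n * G ^ 2 := by
    intro x hx
    have e1 : ∀ j, S.weight j x * (2 * u j x t * uT j x t) + R j x ≤
        (3 * S.M + 2) * u j x t ^ 2 + 2 * G ^ 2 +
          ∑ k, 2 * S.M * (u j x t ^ 2 + u k x t ^ 2) := by
      intro j
      have hpde := h.pde j x hx t ht
      have hw := S.weight_mem j hx
      have hw0 : 0 ≤ S.weight j x := S.ε_pos.le.trans hw.1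
      -- After the equation is inserted for `uT`, the two occurrences of `u * uX` cancel.
      have e2 : S.weight j x * (2 * u j x t * uT j x t) + R j x =
          wSlope m j * S.a j x t * u j x t ^ 2 + S.weight j x * S.aX j x t * u j x t ^ 2 +
          2 * S.weight j x * (u j x t * g j x t) +
          ∑ k, 2 * S.weight j x * (-(S.b j k x t) * (u j x t * u k x t)) := by
        have e3 : ∑ k, 2 * S.weight j x * (-(S.b j k x t) * (u j x t * u k x t)) =
            -(2 * S.weight j x * u j x t) * ∑ k, S.b j k x t * u k x t := by
          rw [Finset.mul_sum]; exact Finset.sum_congr rfl fun k _ => by ring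
        rw [e3, ← hpde]; simp only [R]; ring
      rw [e2]
      have f1 : wSlope m j * S.a j x t ≤ S.M := by
        refine (le_abs_self _).trans ?_
        rw [abs_mul]
        have : |wSlope m j| = 1 := by unfold wSlope; split_ifs <;> simp
        rw [this, one_mul]; exact (S.ha j).bound x t
      have f2 : S.weight j x * S.aX j x t ≤ 2 * S.M :=
        (mul_le_mul_of_nonneg_left ((le_abs_self _).trans ((S.ha j).bound_x x t)) hw0).trans
          (mul_le_mul_of_nonneg_right hw.2 hM.le)
      have f3 : 2 * S.weight j x * (u j x t * g j x t) ≤ 2 * u j x t ^ 2 + 2 * G ^ 2 := by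
        have g1 : |u j x t * g j x t| ≤ (u j x t ^ 2 + G ^ 2) / 2 := by
          rw [abs_mul]
          have := hg j x hx t ht
          nlinarith [abs_nonneg (u j x t), abs_nonneg (g j x t), sq_nonneg (|u j x t| - G),
            sq_abs (u j x t), mul_le_mul_of_nonneg_left this (abs_nonneg (u j x t))]
        have g2 := mul_le_mul hw.2 g1 (abs_nonneg _) zero_le_two
        have g3 := mul_le_mul_of_nonneg_left (le_abs_self (u j x t * g j x t)) hw0
        linarith
      have f4 : ∑ k, 2 * S.weight j x * (-(S.b j k x t) * (u j x t * u k x t)) ≤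
          ∑ k, 2 * S.M * (u j x t ^ 2 + u k x t ^ 2) := by
        refine Finset.sum_le_sum fun k _ => ?_
        have g1 : |u j x t * u k x t| ≤ (u j x t ^ 2 + u k x t ^ 2) / 2 := by
          rw [abs_mul]
          nlinarith [sq_nonneg (|u j x t| - |u k x t|), sq_abs (u j x t), sq_abs (u k x t)]
        have g2 : -(S.b j k x t) * (u j x t * u k x t) ≤
            S.M * ((u j x t ^ 2 + u k x t ^ 2) / 2) := by
          refine (le_abs_self _).trans ?_
          rw [abs_mul, abs_neg]
          exact mul_le_mul ((S.hb j k).bound x t) g1 (abs_nonneg _) hM.le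
        have g3 := mul_le_mul_of_nonneg_left g2 hw0
        have g4 := mul_le_mul_of_nonneg_right hw.2
          (by positivity : 0 ≤ S.M * ((u j x t ^ 2 + u k x t ^ 2) / 2))
        linarith
      have f5 := mul_le_mul_of_nonneg_right f1 (sq_nonneg (u j x t))
      have f6 := mul_le_mul_of_nonneg_right f2 (sq_nonneg (u j x t))
      linarith
    refine (Finset.sum_le_sum fun j _ => e1 j).trans (le_of_eq ?_)
    simp only [Finset.sum_add_distrib, ← Finset.mul_sum, mul_add, Finset.sum_const,
      Finset.card_univ, Fintype.card_fin, nsmul_eq_mul]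
    ring
  have hint : ∀ j, IntervalIntegrable (fun x => S.weight j x * (2 * u j x t * uT j x t))
      volume 0 1 := fun j =>
    ((S.continuous_weight j).mul (((hc j).const_mul 2).mul (hcT j))).intervalIntegrable _ _
  have hint' : ∀ j, IntervalIntegrable (R j) volume 0 1 := fun j => (hR j).intervalIntegrable _ _
  have hsum : (∑ j, ∫ x in (0 : ℝ)..1, S.weight j x * (2 * u j x t * uT j x t)) +
      (∑ j, ∫ x in (0 : ℝ)..1, R j x) =
      ∫ x in (0 : ℝ)..1, ∑ j, (S.weight j x * (2 * u j x t * uT j x t) + R j x) := by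
    rw [intervalIntegral.integral_finsetSum fun j _ => (hint j).add (hint' j),
      ← Finset.sum_add_distrib]
    exact Finset.sum_congr rfl fun j _ =>
      (intervalIntegral.integral_add (hint j) (hint' j)).symm
  have hmono : ∫ x in (0 : ℝ)..1, ∑ j, (S.weight j x * (2 * u j x t * uT j x t) + R j x) ≤
      ∫ x in (0 : ℝ)..1, ((3 * S.M + 4 * S.M * n + 2) * ∑ j, u j x t ^ 2 + 2 * n * G ^ 2) := by
    refine intervalIntegral.integral_mono_on zero_le_one ?_ ?_ key
    · exact Continuous.intervalIntegrable (continuous_finsetSum _ fun j _ =>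
        ((S.continuous_weight j).mul (((hc j).const_mul 2).mul (hcT j))).add (hR j)) _ _
    · exact ((hQc.const_mul _).add continuous_const).intervalIntegrable _ _
  have hQ : ∫ x in (0 : ℝ)..1, ((3 * S.M + 4 * S.M * n + 2) * ∑ j, u j x t ^ 2 + 2 * n * G ^ 2) =
      (3 * S.M + 4 * S.M * n + 2) * normSq (fun j x => u j x t) + 2 * n * G ^ 2 := by
    rw [intervalIntegral.integral_add ((hQc.const_mul _).intervalIntegrable _ _)
      intervalIntegrable_const, intervalIntegral.integral_const_mul,
      intervalIntegral.integral_finsetSum (f := fun j x => u j x t ^ 2)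
        fun j _ => ((hc j).pow 2).intervalIntegrable _ _]
    simp [normSq]
  have hE := normSq_mul_ε_le_energy (S := S) (fun j t => h.continuous_at_time j t) t
  have hE2 : (3 * S.M + 4 * S.M * n + 2) * normSq (fun j x => u j x t) ≤ S.rate * S.energy u t := by
    rw [rate, div_mul_eq_mul_div, le_div_iff₀ S.ε_pos, mul_assoc, mul_comm (normSq _)]
    gcongr
  linarith

/-- The `L²` estimate for solutions of the boundary value problem with a bounded source. -/
theorem IsSol.normSq_le (h : S.IsSol τ g u uX uT) {G : ℝ}
    (hg : ∀ j, ∀ x ∈ Icc (0 : ℝ) 1, ∀ t ≥ τ, |g j x t| ≤ G) {t : ℝ} (ht : τ ≤ t) :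
    normSq (fun j x => u j x t) ≤ 2 / S.ε * Real.exp (S.rate * (t - τ)) *
      (normSq (fun j x => u j x τ) + n * G ^ 2 * (t - τ)) := by
  have hε := S.ε_pos
  -- The Gronwall functional. It is nonincreasing for times after `τ`, and comparing its values at
  -- `τ` and `t` gives the estimate.
  let H : ℝ → ℝ := fun s => Real.exp (-(S.rate * (s - τ))) * S.energy u s - 2 * n * G ^ 2 * (s - τ)
  have hH : ∀ s, HasDerivAt H (Real.exp (-(S.rate * (s - τ))) *
      (∑ j, (∫ x in (0 : ℝ)..1, S.weight j x * (2 * u j x s * uT j x s)) - S.rate * S.energy u s) -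
      2 * n * G ^ 2) s := by
    intro s
    have e1 : HasDerivAt (fun s => s - τ) 1 s := (hasDerivAt_id s).sub_const τ
    refine (((e1.const_mul S.rate).neg.exp.mul (h.hasDerivAt_energy s)).sub
      (e1.const_mul (2 * n * G ^ 2))).congr_deriv ?_
    simp only [Pi.neg_apply]
    ring
  have hanti : AntitoneOn H (Ici τ) := by
    refine antitoneOn_of_deriv_nonpos (convex_Ici τ)
      (fun s _ => (hH s).continuousAt.continuousWithinAt)
      (fun s _ => (hH s).differentiableAt.differentiableWithinAt) fun s hs => ?_
    rw [interior_Ici, mem_Ioi] at hs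
    rw [(hH s).deriv]
    have h1 := h.energy_deriv_le hg hs.le
    have h2 : Real.exp (-(S.rate * (s - τ))) ≤ 1 :=
      Real.exp_le_one_iff.2 (neg_nonpos.2 (mul_nonneg S.rate_nonneg (sub_nonneg.2 hs.le)))
    have h3 : (0 : ℝ) ≤ 2 * n * G ^ 2 := by positivity
    have h4 := mul_le_mul_of_nonneg_left (sub_le_iff_le_add'.2 h1) (Real.exp_pos (-(S.rate * (s - τ)))).le
    have h5 := mul_le_mul_of_nonneg_right h2 h3
    linarith
  have h1 := hanti self_mem_Ici (mem_Ici.2 ht) ht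
  simp only [H, sub_self, mul_zero, neg_zero, Real.exp_zero, one_mul, sub_zero] at h1
  have h2 := energy_le_normSq (S := S) (fun j t => h.continuous_at_time j t) τ
  have h3 := normSq_mul_ε_le_energy (S := S) (fun j t => h.continuous_at_time j t) t
  have h4 : S.energy u t ≤ Real.exp (S.rate * (t - τ)) *
      (2 * normSq (fun j x => u j x τ) + 2 * n * G ^ 2 * (t - τ)) := by
    have h5 : Real.exp (-(S.rate * (t - τ))) * S.energy u t ≤
      2 * normSq (fun j x => u j x τ) + 2 * n * G ^ 2 * (t - τ) := by linarith
    rw [Real.exp_neg, inv_mul_le_iff₀ (Real.exp_pos _)] at h5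
    exact h5
  have h6 : normSq (fun j x => u j x t) ≤ S.energy u t / S.ε := by
    rw [le_div_iff₀ hε]; linarith
  refine h6.trans ((div_le_div_of_nonneg_right h4 hε.le).trans (le_of_eq ?_))
  field_simp

end Sys

/-! ### Exponentially localized integrals and the system divided by its speeds -/

/-- Composition of a function of two variables with two continuous maps. -/
theorem Continuous.comp₂' {Z : Type*} [TopologicalSpace Z] {u : ℝ → ℝ → ℝ}
    (hu : Continuous fun z : ℝ × ℝ => u z.1 z.2) {r s : Z → ℝ} (hr : Continuous r)
    (hs : Continuous s) : Continuous fun z => u (r z) (s z) :=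
  hu.comp (hr.prodMk hs)

/-- An exponentially localized integrand has a small integral. -/
theorem abs_integral_le_of_exp_decay {g : ℝ → ℝ} {N μ X x : ℝ} (hμ : 0 < μ)
    (hN : 0 ≤ N) (h : ∀ ξ ∈ uIcc X x, |g ξ| ≤ N * Real.exp (-(μ * |x - ξ|))) :
    |∫ ξ in X..x, g ξ| ≤ N / μ := by
  rcases le_total X x with hX | hX
  · have h1 : ∀ ξ ∈ Ioc X x, ‖g ξ‖ ≤ N * Real.exp (-(μ * (x - ξ))) := by
      intro ξ hξ
      have := h ξ (by rw [uIcc_of_le hX]; exact Ioc_subset_Icc_self hξ)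
      rwa [abs_of_nonneg (sub_nonneg.2 hξ.2)] at this
    have h2 := intervalIntegral.norm_integral_le_of_norm_le (μ := volume) hX
      (Eventually.of_forall h1) (by apply Continuous.intervalIntegrable; fun_prop)
    have h3 : ∫ ξ in X..x, N * Real.exp (-(μ * (x - ξ))) =
        N / μ * Real.exp (-(μ * (x - x))) - N / μ * Real.exp (-(μ * (x - X))) := by
      refine intervalIntegral.integral_eq_sub_of_hasDerivAt
        (f := fun ξ => N / μ * Real.exp (-(μ * (x - ξ)))) (fun ξ _ => ?_)
        (by apply Continuous.intervalIntegrable; fun_prop)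
      have e1 : HasDerivAt (fun ξ => -(μ * (x - ξ))) μ ξ := by
        simpa using (((hasDerivAt_id ξ).const_sub x).const_mul μ).fun_neg
      refine (e1.exp.const_mul (N / μ)).congr_deriv ?_
      field_simp
    rw [h3] at h2
    simp only [sub_self, mul_zero, neg_zero, Real.exp_zero, mul_one] at h2
    have : 0 ≤ N / μ * Real.exp (-(μ * (x - X))) := by positivity
    rw [← Real.norm_eq_abs]; linarith
  · rw [intervalIntegral.integral_symm, abs_neg]
    have h1 : ∀ ξ ∈ Ioc x X, ‖g ξ‖ ≤ N * Real.exp (-(μ * (ξ - x))) := by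
      intro ξ hξ
      have := h ξ (by rw [uIcc_of_ge hX]; exact Ioc_subset_Icc_self hξ)
      rwa [abs_sub_comm, abs_of_nonneg (sub_nonneg.2 hξ.1.le)] at this
    have h2 := intervalIntegral.norm_integral_le_of_norm_le (μ := volume) hX
      (Eventually.of_forall h1) (by apply Continuous.intervalIntegrable; fun_prop)
    have h3 : ∫ ξ in x..X, N * Real.exp (-(μ * (ξ - x))) =
        -(N / μ) * Real.exp (-(μ * (X - x))) - -(N / μ) * Real.exp (-(μ * (x - x))) := by
      refine intervalIntegral.integral_eq_sub_of_hasDerivAt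
        (f := fun ξ => -(N / μ) * Real.exp (-(μ * (ξ - x)))) (fun ξ _ => ?_)
        (by apply Continuous.intervalIntegrable; fun_prop)
      have e1 : HasDerivAt (fun ξ => -(μ * (ξ - x))) (-μ) ξ := by
        simpa using (((hasDerivAt_id ξ).sub_const x).const_mul μ).fun_neg
      refine (e1.exp.const_mul (-(N / μ))).congr_deriv ?_
      field_simp
    rw [h3] at h2
    simp only [sub_self, mul_zero, neg_zero, Real.exp_zero, mul_one] at h2
    have : 0 ≤ N / μ * Real.exp (-(μ * (X - x))) := by positivity
    rw [← Real.norm_eq_abs]; linarith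

namespace Sys

variable (S : Sys n m)

/-- The coefficients of the system after division by the speeds. -/
def q (j k : Fin n) (x t : ℝ) : ℝ := S.f j x t * S.b j k x t

/-- The time derivatives of the coefficients `q`. -/
def qT (j k : Fin n) (x t : ℝ) : ℝ := S.fT j x t * S.b j k x t + S.f j x t * S.bT j k x t

/-- A common bound for the coefficients `q` and their time derivatives. -/
def Q : ℝ := (S.L + S.δ) * S.M

theorem Q_nonneg : 0 ≤ S.Q := by
  have := S.M_pos; have := S.δ_pos; have := S.L_nonneg; unfold Q; positivity

@[fun_prop] theorem continuous_q (j k : Fin n) : Continuous fun z : ℝ × ℝ => S.q j k z.1 z.2 :=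
  (S.continuous_f j).mul (S.hb j k).cont

@[fun_prop] theorem continuous_qT (j k : Fin n) : Continuous fun z : ℝ × ℝ => S.qT j k z.1 z.2 :=
  ((S.continuous_fT j).mul (S.hb j k).cont).add ((S.continuous_f j).mul (S.hb j k).cont_t)

theorem hasDerivAt_q (j k : Fin n) (x t : ℝ) :
    HasDerivAt (fun s => S.q j k x s) (S.qT j k x t) t :=
  (S.hasDerivAt_f j x t).mul ((S.hb j k).deriv_t x t)

theorem abs_q_le (j k : Fin n) (x t : ℝ) : |S.q j k x t| ≤ S.Q := by
  have hM := S.M_pos; have hL := S.L_nonneg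
  rw [q, abs_mul]
  calc _ ≤ S.δ * S.M := mul_le_mul (S.abs_f_le j x t) ((S.hb j k).bound x t) (abs_nonneg _) S.δ_pos.le
    _ ≤ S.Q := by rw [Q]; gcongr; linarith

theorem abs_qT_le (j k : Fin n) (x t : ℝ) : |S.qT j k x t| ≤ S.Q := by
  rw [qT]
  refine (abs_add_le _ _).trans ?_
  rw [abs_mul, abs_mul, Q, add_mul]
  exact add_le_add
    (mul_le_mul (S.abs_fT_le j x t) ((S.hb j k).bound x t) (abs_nonneg _) S.L_nonneg)
    (mul_le_mul (S.abs_f_le j x t) ((S.hb j k).bound_t x t) (abs_nonneg _) S.δ_pos.le)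

/-! ### The Volterra operator of the boundary value problem -/

/-- Integration along characteristics from the inflow boundary. -/
def opL (w : Fin n → ℝ → ℝ → ℝ) (j : Fin n) (x t : ℝ) : ℝ :=
  opP m S.p w j (S.W j (xIn m j) x t) -
    ∫ ξ in (xIn m j)..(pj x), ∑ k, S.q j k ξ (S.W j ξ x t) * w k ξ (S.W j ξ x t)

/-- The time derivative of `opL w`, in terms of `w` and its time derivative `z`. -/
def opLT (w z : Fin n → ℝ → ℝ → ℝ) (j : Fin n) (x t : ℝ) : ℝ :=
  S.WT j (xIn m j) x t * opP m S.p z j (S.W j (xIn m j) x t) -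
    ∫ ξ in (xIn m j)..(pj x), ∑ k, (S.qT j k ξ (S.W j ξ x t) * w k ξ (S.W j ξ x t) +
      S.q j k ξ (S.W j ξ x t) * z k ξ (S.W j ξ x t)) * S.WT j ξ x t

/-- The decay rate in space of the weights. -/
def κ : ℝ := Real.log (4 * n * S.M * Real.exp S.L + 1)

/-- A bound for the integral kernels. -/
def K₀ : ℝ := 2 * n * S.Q * Real.exp S.L

/-- The growth rate in time of the weights. -/
def lam : ℝ := S.κ * S.M + 4 * S.K₀ * S.M * Real.exp S.κ + 1

theorem exp_κ : Real.exp S.κ = 4 * n * S.M * Real.exp S.L + 1 := by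
  have := S.M_pos
  exact Real.exp_log (by positivity)

theorem κ_nonneg : 0 ≤ S.κ := by
  have := S.M_pos
  exact Real.log_nonneg (le_add_of_nonneg_left (by positivity))

theorem K₀_nonneg : 0 ≤ S.K₀ := by
  have := S.Q_nonneg
  unfold K₀; positivity

theorem one_le_lam : 1 ≤ S.lam := by
  have := S.M_pos; have := S.K₀_nonneg; have := S.κ_nonneg
  unfold lam
  exact le_add_of_nonneg_left (by positivity)

/-- Going back a distance `d` along a characteristic lowers time by at least `d / M`, hence the
exponent in time by `lam * d / M`. This must exceed the growth `κ * d` of the spatial exponent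
towards the inflow end. -/
theorem κ_le_lam_div : S.κ ≤ S.lam / S.M := by
  have := S.M_pos; have := S.K₀_nonneg
  rw [le_div_iff₀ S.M_pos, lam, add_assoc]
  exact le_add_of_nonneg_right (by positivity)

/-- The integral term is of size `K₀ M / lam`. The second summand of `lam` makes it a quarter of
`exp (-κ)`, which is the smallest spatial factor of the weight. -/
theorem K₀_div_le : S.K₀ / (S.lam / S.M) ≤ Real.exp (-S.κ) / 4 := by
  have hM := S.M_pos; have hK := S.K₀_nonneg; have hκ := S.κ_nonneg
  have hl : 0 < S.lam := one_pos.trans_le S.one_le_lam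
  rw [div_div_eq_mul_div, div_le_iff₀ hl, Real.exp_neg]
  have : 4 * S.K₀ * S.M * Real.exp S.κ ≤ S.lam := by
    unfold lam
    have : 0 ≤ S.κ * S.M := by positivity
    linarith
  have he := Real.exp_pos S.κ
  rw [div_mul_eq_mul_div, le_div_iff₀ (by norm_num), inv_mul_eq_div, le_div_iff₀ he]
  linarith

/-- The weights in which `opL` is a contraction. -/
def ρ (τ : ℝ) (j : Fin n) (x t : ℝ) : ℝ :=
  Real.exp (S.lam * (t - τ) - S.κ * |pj x - xIn m j|)

theorem ρ_pos (τ : ℝ) (j : Fin n) (x t : ℝ) : 0 < S.ρ τ j x t := Real.exp_pos _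

theorem ρ_le (τ : ℝ) (j : Fin n) (x t : ℝ) : S.ρ τ j x t ≤ Real.exp (S.lam * (t - τ)) :=
  Real.exp_le_exp.2 (sub_le_self _ (mul_nonneg S.κ_nonneg (abs_nonneg _)))

theorem abs_pj_sub_xIn_le (x : ℝ) (j : Fin n) : |pj x - xIn m j| ≤ 1 := by
  have := abs_pj_sub_le_one x (xIn m j)
  rwa [pj_of_mem (xIn_mem j)] at this

theorem exp_le_ρ (τ : ℝ) (j : Fin n) (x t : ℝ) :
    Real.exp (S.lam * (t - τ)) * Real.exp (-S.κ) ≤ S.ρ τ j x t := by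
  rw [← Real.exp_add]
  refine Real.exp_le_exp.2 ?_
  have := mul_le_mul_of_nonneg_left (abs_pj_sub_xIn_le (m := m) x j) S.κ_nonneg
  linarith

/-- Outflow ends lie at distance 1 from the inflow ends, where the weight carries the factor `exp
(-κ)`; this is how reflections become small. -/
theorem abs_opP_le {τ D : ℝ} {y : Fin n → ℝ → ℝ → ℝ}
    (hy : ∀ k x t, |y k x t| ≤ D * S.ρ τ k x t) (j : Fin n) (s : ℝ) :
    |opP m S.p y j s| ≤ n * S.M * D * Real.exp (-S.κ) * Real.exp (S.lam * (s - τ)) := by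
  have hM := S.M_pos
  have h1 : ∀ k, |S.p j k * y k (xOut m k) s| ≤
      S.M * (D * (Real.exp (-S.κ) * Real.exp (S.lam * (s - τ)))) := by
    intro k
    rw [abs_mul]
    refine mul_le_mul (S.hp j k) ((hy k _ s).trans (le_of_eq ?_)) (abs_nonneg _) hM.le
    rw [ρ, pj_of_mem (xOut_mem k), ← Real.exp_add]
    have : |xOut m k - xIn m k| = 1 := by unfold xOut xIn; split_ifs <;> simp
    rw [this]; congr 2; ring
  rw [opP]
  refine (Finset.abs_sum_le_sum_abs _ _).trans ((Finset.sum_le_sum fun k _ => h1 k).trans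
    (le_of_eq ?_))
  simp; ring

/-- The basic weighted estimate behind the contraction property. -/
theorem abs_volterra_le {τ D : ℝ} (hD : 0 ≤ D) {y : Fin n → ℝ → ℝ → ℝ}
    (hy : ∀ k x t, |y k x t| ≤ D * S.ρ τ k x t) (j : Fin n) (x t : ℝ) {A₀ : ℝ}
    (hA : |A₀| ≤ Real.exp S.L) {g : ℝ → ℝ}
    (hg : ∀ ξ ∈ Icc (0 : ℝ) 1, |g ξ| ≤ S.K₀ * D * Real.exp (S.lam * (S.W j ξ x t - τ))) :
    |A₀ * opP m S.p y j (S.W j (xIn m j) x t) - ∫ ξ in (xIn m j)..(pj x), g ξ| ≤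
      D / 2 * S.ρ τ j x t := by
  have hM := S.M_pos
  have hK := S.K₀_nonneg
  have hl : 0 < S.lam := one_pos.trans_le S.one_le_lam
  have hW : ∀ ξ ∈ uIcc (xIn m j) (pj x), S.lam * (S.W j ξ x t - τ) ≤
      S.lam * (t - τ) - S.lam / S.M * |pj x - ξ| := by
    intro ξ hξ
    have := S.W_le_of_between j (pj_mem x) hξ t
    rw [W_pj_right] at this
    have h2 := mul_le_mul_of_nonneg_left this hl.le
    have h3 : S.lam * (|pj x - ξ| / S.M) = S.lam / S.M * |pj x - ξ| := by ring
    rw [mul_sub, h3] at h2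
    rw [mul_sub, mul_sub]; linarith
  have h1 : |A₀ * opP m S.p y j (S.W j (xIn m j) x t)| ≤ D / 4 * S.ρ τ j x t := by
    rw [abs_mul]
    -- The time spent between the inflow boundary and `x` pays for the spatial factor of the weight
    -- at `x`.
    have e1 : Real.exp (S.lam * (S.W j (xIn m j) x t - τ)) ≤ S.ρ τ j x t := by
      refine Real.exp_le_exp.2 ((hW _ left_mem_uIcc).trans ?_)
      have := mul_le_mul_of_nonneg_right S.κ_le_lam_div (abs_nonneg (pj x - xIn m j))
      linarith
    have e2 := S.abs_opP_le hy j (S.W j (xIn m j) x t)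
    -- The definition of `κ` is made for this inequality, with the `+ 1` there keeping `κ`
    -- nonnegative.
    have e3 : 4 * (Real.exp S.L * (n * S.M)) * Real.exp (-S.κ) ≤ 1 := by
      rw [Real.exp_neg, ← div_eq_mul_inv, div_le_one (Real.exp_pos _), S.exp_κ]; linarith
    calc |A₀| * |opP m S.p y j (S.W j (xIn m j) x t)|
        ≤ Real.exp S.L * (n * S.M * D * Real.exp (-S.κ) * S.ρ τ j x t) :=
          mul_le_mul hA (e2.trans (by gcongr)) (abs_nonneg _) (Real.exp_pos _).le
      _ = (4 * (Real.exp S.L * (n * S.M)) * Real.exp (-S.κ)) * (D / 4 * S.ρ τ j x t) := by ring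
      _ ≤ 1 * (D / 4 * S.ρ τ j x t) := by
          have := S.ρ_pos τ j x t
          gcongr
      _ = _ := one_mul _
  have h2 : |∫ ξ in (xIn m j)..(pj x), g ξ| ≤ D / 4 * S.ρ τ j x t := by
    have e1 : |∫ ξ in (xIn m j)..(pj x), g ξ| ≤
        S.K₀ * D * Real.exp (S.lam * (t - τ)) / (S.lam / S.M) := by
      refine abs_integral_le_of_exp_decay (by positivity) (by positivity) fun ξ hξ => ?_
      refine (hg ξ (uIcc_subset_Icc (xIn_mem j) (pj_mem x) hξ)).trans ?_
      rw [mul_assoc (S.K₀ * D), ← Real.exp_add]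
      have := hW ξ hξ
      gcongr
      linarith
    have e2 := S.K₀_div_le
    have e3 := S.exp_le_ρ τ j x t
    calc _ ≤ _ := e1
      _ = D * Real.exp (S.lam * (t - τ)) * (S.K₀ / (S.lam / S.M)) := by ring
      _ ≤ D * Real.exp (S.lam * (t - τ)) * (Real.exp (-S.κ) / 4) := by gcongr
      _ = D / 4 * (Real.exp (S.lam * (t - τ)) * Real.exp (-S.κ)) := by ring
      _ ≤ _ := by gcongr
  calc _ ≤ _ := abs_sub _ _
    _ ≤ D / 4 * S.ρ τ j x t + D / 4 * S.ρ τ j x t := add_le_add h1 h2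
    _ = _ := by ring

/-- Families of functions on the plane, with their time derivatives, that vanish up to time `τ` and
are bounded by `D` in the weighted norm. -/
structure Causal (τ D : ℝ) (w z : Fin n → ℝ → ℝ → ℝ) : Prop where
  cont : ∀ j, Continuous fun z : ℝ × ℝ => w j z.1 z.2
  cont_t : ∀ j, Continuous fun y : ℝ × ℝ => z j y.1 y.2
  proj : ∀ j x t, w j (pj x) t = w j x t
  deriv_t : ∀ j x t, HasDerivAt (fun s => w j x s) (z j x t) t
  zero : ∀ j x t, t ≤ τ → w j x t = 0
  bound : ∀ j x t, |w j x t| ≤ D * S.ρ τ j x t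
  bound_t : ∀ j x t, |z j x t| ≤ D * S.ρ τ j x t

variable {S}

theorem continuous_opP {w : Fin n → ℝ → ℝ → ℝ}
    (hw : ∀ j, Continuous fun z : ℝ × ℝ => w j z.1 z.2) (p : Fin n → Fin n → ℝ) (j : Fin n) :
    Continuous (opP m p w j) :=
  continuous_finsetSum _ fun k _ => continuous_const.mul
    (Continuous.comp₂' (hw k) continuous_const continuous_id)

theorem continuous_opL {w : Fin n → ℝ → ℝ → ℝ}
    (hw : ∀ j, Continuous fun z : ℝ × ℝ => w j z.1 z.2) (j : Fin n) :
    Continuous fun z : ℝ × ℝ => S.opL w j z.1 z.2 := by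
  refine Continuous.sub ((continuous_opP hw _ j).comp (by fun_prop))
    (continuous_integral_param ?_ continuous_const (by fun_prop))
  exact continuous_finsetSum _ fun k _ => (by fun_prop : Continuous fun q : (ℝ × ℝ) × ℝ =>
    S.q j k q.2 (S.W j q.2 q.1.1 q.1.2)).mul (Continuous.comp₂' (hw k) (by fun_prop) (by fun_prop))

theorem continuous_opLT {w z : Fin n → ℝ → ℝ → ℝ}
    (hw : ∀ j, Continuous fun y : ℝ × ℝ => w j y.1 y.2)
    (hz : ∀ j, Continuous fun y : ℝ × ℝ => z j y.1 y.2) (j : Fin n) :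
    Continuous fun y : ℝ × ℝ => S.opLT w z j y.1 y.2 := by
  refine Continuous.sub (Continuous.mul (by fun_prop)
    ((continuous_opP hz _ j).comp (by fun_prop)))
    (continuous_integral_param ?_ continuous_const (by fun_prop))
  exact continuous_finsetSum _ fun k _ => (((by fun_prop : Continuous fun q : (ℝ × ℝ) × ℝ =>
    S.qT j k q.2 (S.W j q.2 q.1.1 q.1.2)).mul (Continuous.comp₂' (hw k) (by fun_prop) (by fun_prop))).add
    ((by fun_prop : Continuous fun q : (ℝ × ℝ) × ℝ =>
    S.q j k q.2 (S.W j q.2 q.1.1 q.1.2)).mul (Continuous.comp₂' (hz k) (by fun_prop) (by fun_prop)))).mul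
    (by fun_prop)

theorem hasDerivAt_opP {w z : Fin n → ℝ → ℝ → ℝ}
    (h : ∀ j x t, HasDerivAt (fun s => w j x s) (z j x t) t) (p : Fin n → Fin n → ℝ) (j : Fin n)
    (t : ℝ) : HasDerivAt (opP m p w j) (opP m p z j t) t :=
  HasDerivAt.fun_sum fun k _ => (h k _ t).const_mul (p j k)

theorem hasDerivAt_opL {w z : Fin n → ℝ → ℝ → ℝ}
    (hw : ∀ j, Continuous fun y : ℝ × ℝ => w j y.1 y.2)
    (hz : ∀ j, Continuous fun y : ℝ × ℝ => z j y.1 y.2)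
    (h : ∀ j x t, HasDerivAt (fun s => w j x s) (z j x t) t) (j : Fin n) (x t : ℝ) :
    HasDerivAt (fun s => S.opL w j x s) (S.opLT w z j x t) t := by
  have h1 : HasDerivAt (fun s => opP m S.p w j (S.W j (xIn m j) x s))
      (S.WT j (xIn m j) x t * opP m S.p z j (S.W j (xIn m j) x t)) t := by
    have := (hasDerivAt_opP (m := m) h S.p j (S.W j (xIn m j) x t)).comp t (S.hasDerivAt_W j (xIn m j) x t)
    rw [mul_comm]; exact this
  refine h1.sub (hasDerivAt_integral_param
    (k := fun ξ t => ∑ k, S.q j k ξ (S.W j ξ x t) * w k ξ (S.W j ξ x t))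
    (kt := fun ξ t => ∑ k, (S.qT j k ξ (S.W j ξ x t) * w k ξ (S.W j ξ x t) +
      S.q j k ξ (S.W j ξ x t) * z k ξ (S.W j ξ x t)) * S.WT j ξ x t) _ _ t ?_ ?_ fun ξ s => ?_)
  · exact continuous_finsetSum _ fun k _ => Continuous.mul (by fun_prop)
      (Continuous.comp₂' (hw k) (by fun_prop) (by fun_prop))
  · exact continuous_finsetSum _ fun k _ => Continuous.mul (Continuous.add
      (Continuous.mul (by fun_prop) (Continuous.comp₂' (hw k) (by fun_prop) (by fun_prop)))
      (Continuous.mul (by fun_prop) (Continuous.comp₂' (hz k) (by fun_prop) (by fun_prop))))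
      (by fun_prop)
  · refine HasDerivAt.fun_sum fun k _ => ?_
    exact ((S.hasDerivAt_q j k ξ _).mul (h k ξ _)).comp s (S.hasDerivAt_W j ξ x s)

theorem abs_kernel_sum_le {D R : ℝ} {A B : Fin n → ℝ} {w z : Fin n → ℝ} {c : ℝ}
    (hA : ∀ k, |A k| ≤ S.Q) (hB : ∀ k, |B k| ≤ S.Q) (hw : ∀ k, |w k| ≤ D * R)
    (hz : ∀ k, |z k| ≤ D * R) (hc : |c| ≤ Real.exp S.L) (hDR : 0 ≤ D * R) :
    |∑ k, (A k * w k + B k * z k) * c| ≤ S.K₀ * D * R := by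
  have hQ := S.Q_nonneg
  calc _ ≤ ∑ k, |(A k * w k + B k * z k) * c| := Finset.abs_sum_le_sum_abs _ _
    _ ≤ ∑ _k : Fin n, (S.Q * (D * R) + S.Q * (D * R)) * Real.exp S.L := by
        refine Finset.sum_le_sum fun k _ => ?_
        rw [abs_mul]
        refine mul_le_mul ((abs_add_le _ _).trans ?_) hc (abs_nonneg _) (by positivity)
        rw [abs_mul, abs_mul]
        exact add_le_add (mul_le_mul (hA k) (hw k) (abs_nonneg _) hQ)
          (mul_le_mul (hB k) (hz k) (abs_nonneg _) hQ)
    _ = _ := by simp [K₀]; ring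

/-- Towards the inflow boundary characteristics run backwards in time, which preserves vanishing up
to `τ`. The factor one half comes from `abs_volterra_le`, used with leading factor 1 for the
function and with leading factor `WT` for its time derivative. -/
theorem Causal.step {τ D : ℝ} (hD : 0 ≤ D) {w z : Fin n → ℝ → ℝ → ℝ} (h : S.Causal τ D w z) :
    S.Causal τ (D / 2) (S.opL w) (S.opLT w z) := by
  have hb : ∀ j x t, |w j x t| ≤ D * Real.exp (S.lam * (t - τ)) := fun j x t =>
    (h.bound j x t).trans (mul_le_mul_of_nonneg_left (S.ρ_le τ j x t) hD)
  have hbz : ∀ j x t, |z j x t| ≤ D * Real.exp (S.lam * (t - τ)) := fun j x t =>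
    (h.bound_t j x t).trans (mul_le_mul_of_nonneg_left (S.ρ_le τ j x t) hD)
  refine ⟨continuous_opL h.cont, continuous_opLT h.cont h.cont_t, fun j x t => by simp [opL],
    hasDerivAt_opL h.cont h.cont_t h.deriv_t, fun j x t ht => ?_, fun j x t => ?_, fun j x t => ?_⟩
  · have hW : ∀ ξ ∈ uIcc (xIn m j) (pj x), S.W j ξ x t ≤ τ := fun ξ hξ => by
      have := S.W_le_self_of_between j (pj_mem x) hξ t
      rw [W_pj_right] at this
      exact this.trans ht
    have h1 : opP m S.p w j (S.W j (xIn m j) x t) = 0 :=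
      Finset.sum_eq_zero fun k _ => by rw [h.zero k _ _ (hW _ left_mem_uIcc), mul_zero]
    have h2 : ∫ ξ in (xIn m j)..(pj x), ∑ k, S.q j k ξ (S.W j ξ x t) * w k ξ (S.W j ξ x t) =
        ∫ ξ in (xIn m j)..(pj x), (0 : ℝ) :=
      intervalIntegral.integral_congr fun ξ hξ =>
        Finset.sum_eq_zero fun k _ => by rw [h.zero k _ _ (hW ξ hξ), mul_zero]
    rw [opL, h1, h2]; simp
  · have := S.abs_volterra_le hD h.bound j x t (A₀ := 1)
      (by rw [abs_one]; exact Real.one_le_exp S.L_nonneg)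
      (g := fun ξ => ∑ k, S.q j k ξ (S.W j ξ x t) * w k ξ (S.W j ξ x t)) fun ξ _ => ?_
    · rwa [one_mul] at this
    -- The kernel bound written for the time derivative serves here too, with zero second
    -- coefficients and outer factor 1.
    · have h0 := abs_kernel_sum_le (S := S) (D := D)
        (R := Real.exp (S.lam * (S.W j ξ x t - τ))) (c := 1)
        (A := fun k => S.q j k ξ (S.W j ξ x t)) (B := fun _ => 0)
        (w := fun k => w k ξ (S.W j ξ x t)) (z := fun k => w k ξ (S.W j ξ x t))
        (fun k => S.abs_q_le j k _ _) (fun k => by simpa using S.Q_nonneg) (fun k => hb k _ _)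
        (fun k => hb k _ _) (by rw [abs_one]; exact Real.one_le_exp S.L_nonneg) (by positivity)
      simpa using h0
  · refine S.abs_volterra_le hD h.bound_t j x t
      (by rw [abs_of_pos (S.WT_pos j _ _ _)]; exact S.WT_le j _ _ _) fun ξ _ => ?_
    exact abs_kernel_sum_le (fun k => S.abs_qT_le j k _ _) (fun k => S.abs_q_le j k _ _)
      (fun k => hb k _ _) (fun k => hbz k _ _)
      (by rw [abs_of_pos (S.WT_pos j _ _ _)]; exact S.WT_le j _ _ _) (by positivity)

end Sys

/-! ### The Neumann series for the Volterra equation -/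

namespace Sys

variable (S : Sys n m)

/-- The terms of the Neumann series for `w = G + opL w`, with their time derivatives. -/
def neumann (G GT : Fin n → ℝ → ℝ → ℝ) :
    ℕ → (Fin n → ℝ → ℝ → ℝ) × (Fin n → ℝ → ℝ → ℝ)
  | 0 => (G, GT)
  | i + 1 => (S.opL (neumann G GT i).1, S.opLT (neumann G GT i).1 (neumann G GT i).2)

variable {S} {τ D : ℝ} {G GT : Fin n → ℝ → ℝ → ℝ}

theorem causal_neumann (hD : 0 ≤ D) (h : S.Causal τ D G GT) (i : ℕ) :
    S.Causal τ (D * (1 / 2) ^ i) (S.neumann G GT i).1 (S.neumann G GT i).2 := by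
  induction i with
  | zero => simpa [neumann] using h
  | succ i ih =>
    have := ih.step (by positivity)
    rwa [pow_succ, mul_one_div, ← mul_div_assoc]

/-- The equation `w = G + opL w` has a causal solution. -/
theorem exists_causal_fixedPoint (hD : 0 ≤ D) (h : S.Causal τ D G GT) :
    ∃ w z, S.Causal τ (2 * D) w z ∧ ∀ j x t, w j x t = G j x t + S.opL w j x t := by
  have hi := causal_neumann hD h
  have hgeo : Summable fun i : ℕ => D * (1 / 2 : ℝ) ^ i :=
    (summable_geometric_of_lt_one (by norm_num) (by norm_num)).mul_left D
  have hgeo' : ∑' i : ℕ, D * (1 / 2 : ℝ) ^ i = 2 * D := by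
    rw [tsum_mul_left, tsum_geometric_of_lt_one (by norm_num) (by norm_num)]; ring
  let s : ℕ → Fin n → ℝ → ℝ → ℝ := fun i => (S.neumann G GT i).1
  let sT : ℕ → Fin n → ℝ → ℝ → ℝ := fun i => (S.neumann G GT i).2
  have hs : ∀ j x t, Summable fun i => s i j x t := fun j x t =>
    Summable.of_norm_bounded (hgeo.mul_right (S.ρ τ j x t)) fun i => (hi i).bound j x t
  -- The weight grows in time, so the series converges uniformly only on half-planes `t ≤ T`.
  -- Continuity and termwise differentiation are local, so this suffices.
  have hb : ∀ T, ∀ i j x t, t ≤ T →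
      |s i j x t| ≤ D * (1 / 2) ^ i * Real.exp (S.lam * (T - τ)) ∧
      |sT i j x t| ≤ D * (1 / 2) ^ i * Real.exp (S.lam * (T - τ)) := by
    intro T i j x t ht
    have h0 : S.ρ τ j x t ≤ Real.exp (S.lam * (T - τ)) := by
      refine (S.ρ_le τ j x t).trans (Real.exp_le_exp.2 ?_)
      exact mul_le_mul_of_nonneg_left (by linarith) (zero_le_one.trans S.one_le_lam)
    exact ⟨((hi i).bound j x t).trans (mul_le_mul_of_nonneg_left h0 (by positivity)),
      ((hi i).bound_t j x t).trans (mul_le_mul_of_nonneg_left h0 (by positivity))⟩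
  have hcont : ∀ v : ℕ → ℝ → ℝ → ℝ, (∀ i, Continuous fun y : ℝ × ℝ => v i y.1 y.2) →
      (∀ T, ∀ i x t, t ≤ T → |v i x t| ≤ D * (1 / 2) ^ i * Real.exp (S.lam * (T - τ))) →
      Continuous fun y : ℝ × ℝ => ∑' i, v i y.1 y.2 := by
    intro v hv hvb
    rw [continuous_iff_continuousAt]
    intro y
    have hon : ContinuousOn (fun y : ℝ × ℝ => ∑' i, v i y.1 y.2) {z | z.2 < y.2 + 1} :=
      continuousOn_tsum (fun i => (hv i).continuousOn)
        (hgeo.mul_right (Real.exp (S.lam * (y.2 + 1 - τ)))) fun i z hz =>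
          hvb (y.2 + 1) i z.1 z.2 (le_of_lt hz)
    exact hon.continuousAt ((isOpen_lt continuous_snd continuous_const).mem_nhds (by simp))
  have hbd : ∀ v : ℕ → ℝ, ∀ r, (∀ i, |v i| ≤ D * (1 / 2) ^ i * r) → |∑' i, v i| ≤ 2 * D * r := by
    intro v r hv
    have := tsum_of_norm_bounded (f := v) (hgeo.mul_right r).hasSum hv
    rwa [tsum_mul_right, hgeo'] at this
  have hcw : ∀ j, Continuous fun y : ℝ × ℝ => ∑' i, s i j y.1 y.2 := fun j =>
    hcont (fun i => s i j) (fun i => (hi i).cont j) fun T i x t ht => (hb T i j x t ht).1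
  refine ⟨fun j x t => ∑' i, s i j x t, fun j x t => ∑' i, sT i j x t,
    ⟨hcw, fun j => hcont (fun i => sT i j)
      (fun i => (hi i).cont_t j) fun T i x t ht => (hb T i j x t ht).2,
    fun j x t => tsum_congr fun i => (hi i).proj j x t, fun j x t => ?_, fun j x t ht => ?_,
    fun j x t => hbd _ _ fun i => (hi i).bound j x t,
    fun j x t => hbd _ _ fun i => (hi i).bound_t j x t⟩, fun j x t => ?_⟩
  · exact hasDerivAt_tsum_of_isPreconnected (t := Iio (t + 1)) (y₀ := t)
      (hgeo.mul_right (Real.exp (S.lam * (t + 1 - τ)))) isOpen_Iio isPreconnected_Iio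
      (fun i r _ => (hi i).deriv_t j x r) (fun i r hr => (hb (t + 1) i j x r (le_of_lt hr)).2)
      (by simp) (hs j x t) (by simp)
  · exact (tsum_congr fun i => (hi i).zero j x t ht).trans tsum_zero
  · have hopP : HasSum (fun i => opP m S.p (s i) j (S.W j (xIn m j) x t))
        (opP m S.p (fun j x t => ∑' i, s i j x t) j (S.W j (xIn m j) x t)) :=
      hasSum_sum fun k _ => (hs k _ _).hasSum.mul_left (S.p j k)
    have hint : HasSum (fun i => ∫ ξ in (xIn m j)..(pj x),
        ∑ k, S.q j k ξ (S.W j ξ x t) * s i k ξ (S.W j ξ x t))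
        (∫ ξ in (xIn m j)..(pj x),
          ∑ k, S.q j k ξ (S.W j ξ x t) * ∑' i, s i k ξ (S.W j ξ x t)) := by
      refine intervalIntegral.hasSum_integral_of_dominated_convergence
        (fun i _ => ∑ _k : Fin n, S.Q * (D * (1 / 2) ^ i * Real.exp (S.lam * (t + S.δ - τ))))
        (fun i => ?_) (fun i => Eventually.of_forall fun ξ _ => ?_)
        (Eventually.of_forall fun ξ _ => ?_) ?_ (Eventually.of_forall fun ξ _ => ?_)
      · exact (continuous_finsetSum _ fun k _ => Continuous.mul (by fun_prop)
          (Continuous.comp₂' ((hi i).cont k) (by fun_prop) (by fun_prop))).aestronglyMeasurable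
      · refine (norm_sum_le _ _).trans (Finset.sum_le_sum fun k _ => ?_)
        rw [norm_mul]
        refine mul_le_mul (S.abs_q_le j k _ _) (hb _ i k _ _ ?_).1 (norm_nonneg _) S.Q_nonneg
        linarith [le_of_abs_le (S.abs_W_sub_le j ξ x t)]
      · exact summable_sum fun k _ => (hgeo.mul_right _).mul_left _
      · exact intervalIntegrable_const
      · exact hasSum_sum fun k _ => (hs k _ _).hasSum.mul_left _
    have h1 : HasSum (fun i => s (i + 1) j x t) (S.opL (fun j x t => ∑' i, s i j x t) j x t) :=
      hopP.sub hint
    change ∑' i, s i j x t = _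
    -- The term of index 0 is `G`, and the shifted series sums to `opL` of the whole series.
    rw [(hs j x t).tsum_eq_zero_add, h1.tsum_eq]
    rfl

/-! ### The contribution of a source that starts at time `τ` -/

variable (S)

/-- The contribution of the source `h`, switched on at time `τ`. -/
def srcG (τ : ℝ) (h : Fin n → ℝ → ℝ → ℝ) (j : Fin n) (x t : ℝ) : ℝ :=
  ∫ ξ in (xIn m j)..(pj x), h j ξ (max (S.W j ξ x t) τ)

/-- The time derivative of `srcG`. -/
def srcGT (τ : ℝ) (hT : Fin n → ℝ → ℝ → ℝ) (j : Fin n) (x t : ℝ) : ℝ :=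
  ∫ ξ in (xIn m j)..(pj x),
    if τ < S.W j ξ x t then hT j ξ (S.W j ξ x t) * S.WT j ξ x t else 0

variable {S} {h hT : Fin n → ℝ → ℝ → ℝ}

theorem measurable_jump (hcT : ∀ j, Continuous fun y : ℝ × ℝ => hT j y.1 y.2) (j : Fin n)
    (x t : ℝ) : Measurable fun ξ =>
      if τ < S.W j ξ x t then hT j ξ (S.W j ξ x t) * S.WT j ξ x t else 0 := by
  refine Measurable.ite ?_ ?_ measurable_const
  · exact measurableSet_lt measurable_const
      (by fun_prop : Continuous fun ξ => S.W j ξ x t).measurable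
  · exact (Continuous.mul (Continuous.comp₂' (hcT j) (by fun_prop) (by fun_prop))
      (by fun_prop)).measurable

/-- A characteristic is strictly monotone in time and meets the level `τ` at most once, so the jump
of the integrand in `srcGT` sits on a null set. -/
theorem ae_W_ne (j : Fin n) (x t : ℝ) :
    ∀ᵐ ξ : ℝ, ξ ∈ Icc (0 : ℝ) 1 → S.W j ξ x t ≠ τ := by
  have hsub : {ξ | ξ ∈ Icc (0 : ℝ) 1 ∧ S.W j ξ x t = τ}.Subsingleton :=
    fun ξ hξ ξ' hξ' => S.eq_of_W_eq j hξ.1 hξ'.1 (hξ.2.trans hξ'.2.symm)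
  have := hsub.measure_zero volume
  rw [measure_eq_zero_iff_ae_notMem] at this
  filter_upwards [this] with ξ hξ h1 h2
  exact hξ ⟨h1, h2⟩

/-- The cut-off at `τ` leaves the integrand Lipschitz in `t`, and differentiable at `t` for all `ξ`
off the level `τ`. Dominated differentiation with a Lipschitz bound needs no more. -/
theorem hasDerivAt_srcG (hc : ∀ j, Continuous fun y : ℝ × ℝ => h j y.1 y.2)
    (hcT : ∀ j, Continuous fun y : ℝ × ℝ => hT j y.1 y.2)
    (hd : ∀ j x t, HasDerivAt (fun s => h j x s) (hT j x t) t) (j : Fin n) (x t : ℝ) :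
    HasDerivAt (fun s => S.srcG τ h j x s) (S.srcGT τ hT j x t) t := by
  have hδ := S.δ_pos
  -- All cut-off times met for initial times within 1 of `t` lie in `[-R, R]`, since a
  -- characteristic deviates from its initial time by at most `δ`.
  set R := |t| + |τ| + S.δ + 1 with hR
  obtain ⟨C, hC⟩ := ((isCompact_Icc (a := (0 : ℝ)) (b := 1)).prod
    (isCompact_Icc (a := -R) (b := R))).exists_bound_of_continuousOn (hcT j).continuousOn
  have hR0 : 0 ≤ R := by positivity
  have hC0 : 0 ≤ C := (norm_nonneg _).trans (hC (0, 0) ⟨by simp, by simp [hR0]⟩)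
  have hsub : uIoc (xIn m j) (pj x) ⊆ Icc 0 1 :=
    uIoc_subset_uIcc.trans (uIcc_subset_Icc (xIn_mem j) (pj_mem x))
  have hmem : ∀ ξ, ∀ s ∈ Metric.closedBall t 1, max (S.W j ξ x s) τ ∈ Icc (-R) R := by
    intro ξ s hs
    rw [Metric.mem_closedBall, Real.dist_eq, abs_le] at hs
    have h1 := abs_le.1 (S.abs_W_sub_le j ξ x s)
    have h2 := neg_abs_le t; have h3 := le_abs_self t
    have h4 := neg_abs_le τ; have h5 := le_abs_self τ
    exact ⟨le_max_of_le_right (by linarith), max_le (by linarith) (by linarith)⟩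
  refine (intervalIntegral.hasDerivAt_integral_of_dominated_loc_of_lip
    (F := fun s ξ => h j ξ (max (S.W j ξ x s) τ)) (bound := fun _ => C * Real.exp S.L)
    (Metric.closedBall_mem_nhds t one_pos) ?_ ?_ ?_ ?_ ?_ ?_).2
  · exact Eventually.of_forall fun s =>
      (Continuous.comp₂' (hc j) (by fun_prop) (by fun_prop)).aestronglyMeasurable
  · exact (Continuous.comp₂' (hc j) (by fun_prop) (by fun_prop)).intervalIntegrable _ _
  · exact (measurable_jump hcT j x t).aestronglyMeasurable
  · refine Eventually.of_forall fun ξ hξ => LipschitzOnWith.of_dist_le_mul fun s₁ h₁ s₂ h₂ => ?_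
    rw [Real.coe_nnabs, abs_of_nonneg (by positivity), Real.dist_eq, Real.dist_eq]
    have e1 := (convex_Icc (-R) R).norm_image_sub_le_of_norm_hasDerivWithin_le
      (f := fun s => h j ξ s) (fun s _ => (hd j ξ s).hasDerivWithinAt)
      (fun s hs => hC (ξ, s) ⟨hsub hξ, hs⟩) (hmem ξ s₂ h₂) (hmem ξ s₁ h₁)
    have e2 := abs_max_sub_max_le_abs (S.W j ξ x s₁) (S.W j ξ x s₂) τ
    have e3 := S.abs_W_sub_W_le_initial j ξ x x s₁ s₂
    rw [sub_self, abs_zero, mul_zero, add_zero] at e3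
    refine e1.trans ((mul_le_mul_of_nonneg_left (e2.trans e3) hC0).trans (le_of_eq ?_))
    ring
  · exact intervalIntegrable_const
  · filter_upwards [ae_W_ne (S := S) (τ := τ) j x t] with ξ hξ hξ'
    have hcW : Continuous fun s => S.W j ξ x s := by fun_prop
    rcases lt_or_gt_of_ne (hξ (hsub hξ')) with hlt | hgt
    · rw [if_neg hlt.not_gt]
      refine (hasDerivAt_const t (h j ξ τ)).congr_of_eventuallyEq ?_
      filter_upwards [hcW.continuousAt.eventually_lt continuousAt_const hlt] with s hs
      rw [max_eq_right hs.le]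
    · rw [if_pos hgt]
      refine ((hd j ξ _).comp t (S.hasDerivAt_W j ξ x t)).congr_of_eventuallyEq ?_
      filter_upwards [continuousAt_const.eventually_lt hcW.continuousAt hgt] with s hs
      simp [max_eq_left hs.le]

/-- For almost every `ξ` the integrand is continuous at the given point, and it is locally bounded.
Dominated convergence handles this together with the moving upper limit. -/
theorem continuous_srcGT (hcT : ∀ j, Continuous fun y : ℝ × ℝ => hT j y.1 y.2) (j : Fin n) :
    Continuous fun y : ℝ × ℝ => S.srcGT τ hT j y.1 y.2 := by
  rw [continuous_iff_continuousAt]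
  intro y₀
  -- Extended by zero off `[0,1]`, the integrand lives on the larger interval from -1 to 2, in whose
  -- interior both limits of integration lie.
  let F : ℝ × ℝ → ℝ → ℝ := fun y => (Icc (0 : ℝ) 1).indicator fun ξ =>
    if τ < S.W j ξ y.1 y.2 then hT j ξ (S.W j ξ y.1 y.2) * S.WT j ξ y.1 y.2 else 0
  have hkc : Continuous fun z : ℝ × (ℝ × ℝ) =>
      hT j z.1 (S.W j z.1 z.2.1 z.2.2) * S.WT j z.1 z.2.1 z.2.2 :=
    Continuous.mul (Continuous.comp₂' (hcT j) (by fun_prop) (by fun_prop)) (by fun_prop)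
  obtain ⟨C, hC⟩ := ((isCompact_Icc (a := (0 : ℝ)) (b := 1)).prod
    (isCompact_closedBall y₀ 1)).exists_bound_of_continuousOn hkc.continuousOn
  have hC0 : 0 ≤ C := (norm_nonneg _).trans (hC (0, y₀) ⟨by simp, by simp⟩)
  have hI : ∀ r ∈ Icc (0 : ℝ) 1, r ∈ Ioo (-1 : ℝ) 2 := fun r hr =>
    ⟨by linarith [hr.1], by linarith [hr.2]⟩
  have hprim := intervalIntegral.continuousAt_parametric_primitive_of_dominated (μ := volume)
    (F := F) (fun _ => C) (-1) 2 (a₀ := xIn m j) (b₀ := pj y₀.1) (x₀ := y₀) ?_ ?_ ?_ ?_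
    (hI _ (xIn_mem j)) (hI _ (pj_mem _)) (by simp)
  · have hcomp := ContinuousAt.comp (f := fun y : ℝ × ℝ => (y, pj y.1)) (x := y₀) hprim
      (by fun_prop)
    refine hcomp.congr (Eventually.of_forall fun y => ?_)
    refine intervalIntegral.integral_congr fun ξ hξ => ?_
    exact indicator_of_mem (uIcc_subset_Icc (xIn_mem j) (pj_mem _) hξ) _
  · exact fun y => ((measurable_jump hcT j y.1 y.2).indicator
      measurableSet_Icc).aestronglyMeasurable
  · filter_upwards [Metric.closedBall_mem_nhds y₀ one_pos] with y hy
    refine Eventually.of_forall fun ξ => ?_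
    simp only [F, indicator]
    split_ifs with h1 h2
    · exact hC (ξ, y) ⟨h1, hy⟩
    · simpa using hC0
    · simpa using hC0
  · exact intervalIntegrable_const
  · refine ae_restrict_of_ae ?_
    filter_upwards [ae_W_ne (S := S) (τ := τ) j y₀.1 y₀.2] with ξ hξ
    by_cases hmem : ξ ∈ Icc (0 : ℝ) 1
    · have hcW : Continuous fun y : ℝ × ℝ => S.W j ξ y.1 y.2 := by fun_prop
      simp only [F, indicator_of_mem hmem]
      rcases lt_or_gt_of_ne (hξ hmem) with hlt | hgt
      · refine (continuousAt_const (y := (0 : ℝ))).congr ?_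
        filter_upwards [hcW.continuousAt.eventually_lt continuousAt_const hlt] with y hy
        rw [if_neg hy.not_gt]
      · refine ContinuousAt.congr (f := fun y : ℝ × ℝ =>
          hT j ξ (S.W j ξ y.1 y.2) * S.WT j ξ y.1 y.2)
          (hkc.comp (Continuous.prodMk_right ξ)).continuousAt ?_
        filter_upwards [continuousAt_const.eventually_lt hcW.continuousAt hgt] with y hy
        rw [if_pos hy]
    · simp only [F, indicator_of_notMem hmem]
      exact continuousAt_const

/-- Since `h` vanishes at `τ`, freezing its time argument there switches the source off
continuously. The factor `exp L` bounds `WT`, and `exp κ` is the cost of replacing the exponential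
in time by the smaller weight `ρ`. -/
theorem causal_srcG (hc : ∀ j, Continuous fun y : ℝ × ℝ => h j y.1 y.2)
    (hcT : ∀ j, Continuous fun y : ℝ × ℝ => hT j y.1 y.2)
    (hd : ∀ j x t, HasDerivAt (fun s => h j x s) (hT j x t) t)
    (h0 : ∀ j x, h j x τ = 0) {H : ℝ} (hH : 0 ≤ H)
    (hb : ∀ j, ∀ x ∈ Icc (0 : ℝ) 1, ∀ t ≥ τ, |h j x t| ≤ H * Real.exp (S.lam * (t - τ)))
    (hbT : ∀ j, ∀ x ∈ Icc (0 : ℝ) 1, ∀ t ≥ τ, |hT j x t| ≤ H * Real.exp (S.lam * (t - τ))) :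
    S.Causal τ (H * Real.exp S.L * Real.exp S.κ) (S.srcG τ h) (S.srcGT τ hT) := by
  have hl : 0 < S.lam := one_pos.trans_le S.one_le_lam
  have hW : ∀ j x t, ∀ ξ ∈ uIcc (xIn m j) (pj x), S.W j ξ x t ≤ t := fun j x t ξ hξ => by
    have := S.W_le_self_of_between j (pj_mem x) hξ t
    rwa [W_pj_right] at this
  have hI : ∀ (j : Fin n) (x : ℝ), uIoc (xIn m j) (pj x) ⊆ Icc 0 1 := fun j x =>
    uIoc_subset_uIcc.trans (uIcc_subset_Icc (xIn_mem j) (pj_mem x))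
  have hfin : ∀ (j : Fin n) (x t : ℝ) (g : ℝ → ℝ),
      (∀ ξ ∈ uIoc (xIn m j) (pj x), ‖g ξ‖ ≤ H * Real.exp (S.lam * (t - τ)) * Real.exp S.L) →
      |∫ ξ in (xIn m j)..(pj x), g ξ| ≤ H * Real.exp S.L * Real.exp S.κ * S.ρ τ j x t := by
    intro j x t g hg
    have h1 := intervalIntegral.norm_integral_le_of_norm_le_const hg
    rw [Real.norm_eq_abs] at h1
    have h2 := S.exp_le_ρ τ j x t
    rw [Real.exp_neg, ← div_eq_mul_inv, div_le_iff₀ (Real.exp_pos _)] at h2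
    calc _ ≤ _ := h1
      _ ≤ H * Real.exp (S.lam * (t - τ)) * Real.exp S.L :=
        mul_le_of_le_one_right (by positivity) (abs_pj_sub_xIn_le x j)
      _ = H * Real.exp S.L * Real.exp (S.lam * (t - τ)) := by ring
      _ ≤ H * Real.exp S.L * (S.ρ τ j x t * Real.exp S.κ) := by gcongr
      _ = _ := by ring
  refine ⟨fun j => ?_, continuous_srcGT hcT, fun j x t => by simp [srcG],
    hasDerivAt_srcG hc hcT hd, fun j x t ht => ?_, fun j x t => hfin j x t _ fun ξ hξ => ?_,
    fun j x t => hfin j x t _ fun ξ hξ => ?_⟩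
  · exact continuous_integral_param (Continuous.comp₂' (hc j) (by fun_prop) (by fun_prop))
      (by fun_prop) (by fun_prop)
  · rw [srcG, intervalIntegral.integral_congr (g := fun _ => (0 : ℝ)) fun ξ hξ => ?_]
    · simp
    · simp only [max_eq_right ((hW j x t ξ hξ).trans ht), h0]
  · have hWt := hW j x t ξ (uIoc_subset_uIcc hξ)
    have h1 : Real.exp (S.lam * (t - τ)) ≤ Real.exp (S.lam * (t - τ)) * Real.exp S.L :=
      le_mul_of_one_le_right (Real.exp_pos _).le (Real.one_le_exp S.L_nonneg)
    rw [Real.norm_eq_abs, mul_assoc]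
    rcases le_total (S.W j ξ x t) τ with hle | hle
    · rw [max_eq_right hle, h0, abs_zero]; positivity
    · rw [max_eq_left hle]
      refine (hb j ξ (hI j x hξ) _ hle).trans (mul_le_mul_of_nonneg_left (le_trans ?_ h1) hH)
      gcongr
  · have hWt := hW j x t ξ (uIoc_subset_uIcc hξ)
    rw [Real.norm_eq_abs]
    split_ifs with hlt
    · rw [abs_mul, abs_of_pos (S.WT_pos j ξ x t)]
      refine mul_le_mul ((hbT j ξ (hI j x hξ) _ hlt.le).trans ?_) (S.WT_le j ξ x t)
        (S.WT_pos j ξ x t).le (by positivity)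
      gcongr
    · rw [abs_zero]; positivity

end Sys

/-! ### Classical solutions with test functions as initial values -/

theorem exists_bound_Icc {g : Fin n → ℝ → ℝ} (hg : ∀ j, Continuous (g j)) :
    ∃ C, 0 ≤ C ∧ ∀ j, ∀ x ∈ Icc (0 : ℝ) 1, |g j x| ≤ C := by
  obtain ⟨C, hC⟩ := (isCompact_Icc (a := (0 : ℝ)) (b := 1)).exists_bound_of_continuousOn
    (f := fun x => ∑ j, |g j x|)
    (continuous_finsetSum _ fun j _ => (hg j).abs).continuousOn
  refine ⟨C, (norm_nonneg _).trans (hC 0 (by simp)), fun j x hx => ?_⟩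
  refine le_trans ?_ ((le_abs_self _).trans (hC x hx))
  exact Finset.single_le_sum (f := fun j => |g j x|) (fun _ _ => abs_nonneg _) (Finset.mem_univ j)

theorem IsTestFunction.apply_eq_zero {φ : Fin n → ℝ → ℝ} (hφ : IsTestFunction φ) (j : Fin n)
    {x : ℝ} (hx : x ∉ Ioo (0 : ℝ) 1) : φ j x = 0 ∧ deriv (φ j) x = 0 := by
  have h : x ∉ tsupport (φ j) := fun h => hx ((hφ j).2.2 h)
  refine ⟨image_eq_zero_of_notMem_tsupport h, ?_⟩
  by_contra h2
  exact h (support_deriv_subset h2)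

theorem xIn_notMem (j : Fin n) : xIn m j ∉ Ioo (0 : ℝ) 1 := by
  unfold xIn; split_ifs <;> simp

theorem xOut_notMem (j : Fin n) : xOut m j ∉ Ioo (0 : ℝ) 1 := by
  unfold xOut; split_ifs <;> simp

namespace Sys

variable (S : Sys n m)

/-- The spatial part of the differential operator, applied to a function `φ` with derivative `φ₁`. -/
def spatial (φ φ₁ : Fin n → ℝ → ℝ) (j : Fin n) (x t : ℝ) : ℝ :=
  S.a j x t * φ₁ j x + ∑ k, S.b j k x t * φ k x

/-- The time derivative of `spatial`. -/
def spatialT (φ φ₁ : Fin n → ℝ → ℝ) (j : Fin n) (x t : ℝ) : ℝ :=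
  S.aT j x t * φ₁ j x + ∑ k, S.bT j k x t * φ k x

/-- The space derivative of `spatial`, where `φ₂` is the derivative of `φ₁`. -/
def spatialX (φ φ₁ φ₂ : Fin n → ℝ → ℝ) (j : Fin n) (x t : ℝ) : ℝ :=
  S.aX j x t * φ₁ j x + S.a j x t * φ₂ j x +
    ∑ k, (S.bX j k x t * φ k x + S.b j k x t * φ₁ k x)

variable {φ φ₁ φ₂ : Fin n → ℝ → ℝ}

theorem continuous_spatial (h : ∀ j, Continuous (φ j)) (h₁ : ∀ j, Continuous (φ₁ j)) (j : Fin n) :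
    Continuous fun z : ℝ × ℝ => S.spatial φ φ₁ j z.1 z.2 :=
  ((S.continuous_a j).mul ((h₁ j).comp continuous_fst)).add
    (continuous_finsetSum _ fun k _ => (S.hb j k).cont.mul ((h k).comp continuous_fst))

theorem continuous_spatialT (h : ∀ j, Continuous (φ j)) (h₁ : ∀ j, Continuous (φ₁ j)) (j : Fin n) :
    Continuous fun z : ℝ × ℝ => S.spatialT φ φ₁ j z.1 z.2 :=
  ((S.ha j).cont_t.mul ((h₁ j).comp continuous_fst)).add
    (continuous_finsetSum _ fun k _ => (S.hb j k).cont_t.mul ((h k).comp continuous_fst))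

theorem continuous_spatialX (h : ∀ j, Continuous (φ j)) (h₁ : ∀ j, Continuous (φ₁ j))
    (h₂ : ∀ j, Continuous (φ₂ j)) (j : Fin n) :
    Continuous fun z : ℝ × ℝ => S.spatialX φ φ₁ φ₂ j z.1 z.2 :=
  (((S.ha j).cont_x.mul ((h₁ j).comp continuous_fst)).add
    ((S.continuous_a j).mul ((h₂ j).comp continuous_fst))).add
    (continuous_finsetSum _ fun k _ => ((S.hb j k).cont_x.mul ((h k).comp continuous_fst)).add
      ((S.hb j k).cont.mul ((h₁ k).comp continuous_fst)))

theorem hasDerivAt_spatial (j : Fin n) (x t : ℝ) :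
    HasDerivAt (fun s => S.spatial φ φ₁ j x s) (S.spatialT φ φ₁ j x t) t :=
  (((S.ha j).deriv_t x t).mul_const _).add
    (HasDerivAt.fun_sum fun k _ => ((S.hb j k).deriv_t x t).mul_const _)

theorem hasDerivWithinAt_spatial (h₁ : ∀ j x, HasDerivAt (φ j) (φ₁ j x) x)
    (h₂ : ∀ j x, HasDerivAt (φ₁ j) (φ₂ j x) x) (j : Fin n) {x : ℝ} (hx : x ∈ Icc (0 : ℝ) 1) (t : ℝ) :
    HasDerivWithinAt (fun y => S.spatial φ φ₁ j y t) (S.spatialX φ φ₁ φ₂ j x t) (Icc 0 1) x :=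
  (((S.ha j).deriv_x x hx t).mul (h₂ j x).hasDerivWithinAt).add
    (HasDerivWithinAt.fun_sum fun k _ =>
      ((S.hb j k).deriv_x x hx t).mul (h₁ k x).hasDerivWithinAt)

theorem abs_spatial_le {C x : ℝ} (h : ∀ j, |φ j x| ≤ C) (h₁ : ∀ j, |φ₁ j x| ≤ C) (j : Fin n) (t : ℝ) :
    |S.spatial φ φ₁ j x t| ≤ (n + 1) * S.M * C ∧ |S.spatialT φ φ₁ j x t| ≤ (n + 1) * S.M * C := by
  have hM := S.M_pos
  have key : ∀ (α : ℝ) (γ : Fin n → ℝ), |α| ≤ S.M → (∀ k, |γ k| ≤ S.M) →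
      |α * φ₁ j x + ∑ k, γ k * φ k x| ≤ (n + 1) * S.M * C := by
    intro α γ hα hγ
    calc _ ≤ |α * φ₁ j x| + ∑ k, |γ k * φ k x| :=
          (abs_add_le _ _).trans (add_le_add_right (Finset.abs_sum_le_sum_abs _ _) _)
      _ ≤ S.M * C + ∑ _k : Fin n, S.M * C := by
          refine add_le_add ?_ (Finset.sum_le_sum fun k _ => ?_)
          · rw [abs_mul]; exact mul_le_mul hα (h₁ j) (abs_nonneg _) hM.le
          · rw [abs_mul]; exact mul_le_mul (hγ k) (h k) (abs_nonneg _) hM.le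
      _ = _ := by simp; ring
  exact ⟨key _ _ ((S.ha j).bound x t) fun k => (S.hb j k).bound x t,
    key _ _ ((S.ha j).bound_t x t) fun k => (S.hb j k).bound_t x t⟩

/-- Smooth initial data with compact support admit a classical solution. -/
theorem exists_classicalSolution (τ : ℝ) (hφ : IsTestFunction φ) :
    ∃ u, IsClassicalSolution m S.a S.b S.p τ φ u := by
  set φ₁ : Fin n → ℝ → ℝ := fun j => deriv (φ j) with hφ₁
  set φ₂ : Fin n → ℝ → ℝ := fun j => deriv (deriv (φ j)) with hφ₂
  have hs₁ : ∀ j, ContDiff ℝ ∞ (φ₁ j) := fun j => (contDiff_infty_iff_deriv.1 (hφ j).1).2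
  have hs₂ : ∀ j, ContDiff ℝ ∞ (φ₂ j) := fun j => (contDiff_infty_iff_deriv.1 (hs₁ j)).2
  have hc₀ : ∀ j, Continuous (φ j) := fun j => (hφ j).1.continuous
  have hc₁ : ∀ j, Continuous (φ₁ j) := fun j => (hs₁ j).continuous
  have hc₂ : ∀ j, Continuous (φ₂ j) := fun j => (hs₂ j).continuous
  have hd₁ : ∀ j x, HasDerivAt (φ j) (φ₁ j x) x := fun j x =>
    ((contDiff_infty_iff_deriv.1 (hφ j).1).1 x).hasDerivAt
  have hd₂ : ∀ j x, HasDerivAt (φ₁ j) (φ₂ j x) x := fun j x =>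
    ((contDiff_infty_iff_deriv.1 (hs₁ j)).1 x).hasDerivAt
  -- the initial time derivative
  set ψ : Fin n → ℝ → ℝ := fun j x => -S.spatial φ φ₁ j x τ with hψ
  set ψ₁ : Fin n → ℝ → ℝ := fun j x => -S.spatialX φ φ₁ φ₂ j x τ with hψ₁
  have hcψ : ∀ j, Continuous (ψ j) := fun j =>
    (Continuous.comp₂' (S.continuous_spatial hc₀ hc₁ j) continuous_id continuous_const).neg
  have hcψ₁ : ∀ j, Continuous (ψ₁ j) := fun j =>
    (Continuous.comp₂' (S.continuous_spatialX hc₀ hc₁ hc₂ j) continuous_id continuous_const).neg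
  have hdψ : ∀ j, ∀ x ∈ Icc (0 : ℝ) 1, HasDerivWithinAt (ψ j) (ψ₁ j x) (Icc 0 1) x :=
    fun j x hx => (S.hasDerivWithinAt_spatial hd₁ hd₂ j hx τ).neg
  -- the residual of the first order Taylor polynomial
  let F : Fin n → ℝ → ℝ → ℝ := fun j x t =>
    ψ j x + S.spatial φ φ₁ j x t + (t - τ) * S.spatial ψ ψ₁ j x t
  let FT : Fin n → ℝ → ℝ → ℝ := fun j x t =>
    S.spatialT φ φ₁ j x t + (S.spatial ψ ψ₁ j x t + (t - τ) * S.spatialT ψ ψ₁ j x t)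
  have hcF : ∀ j, Continuous fun z : ℝ × ℝ => F j z.1 z.2 := fun j =>
    (((hcψ j).comp continuous_fst).add (S.continuous_spatial hc₀ hc₁ j)).add
      ((continuous_snd.sub continuous_const).mul (S.continuous_spatial hcψ hcψ₁ j))
  have hcFT : ∀ j, Continuous fun z : ℝ × ℝ => FT j z.1 z.2 := fun j =>
    (S.continuous_spatialT hc₀ hc₁ j).add ((S.continuous_spatial hcψ hcψ₁ j).add
      ((continuous_snd.sub continuous_const).mul (S.continuous_spatialT hcψ hcψ₁ j)))
  have hdF : ∀ j x t, HasDerivAt (fun s => F j x s) (FT j x t) t := by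
    intro j x t
    have e1 : HasDerivAt (fun s : ℝ => s - τ) 1 t := (hasDerivAt_id t).sub_const τ
    refine ((((S.hasDerivAt_spatial j x t).const_add (ψ j x))).add
      (e1.mul (S.hasDerivAt_spatial (φ := ψ) (φ₁ := ψ₁) j x t))).congr_deriv ?_
    simp [FT]
  -- The choice of `ψ` makes the residual vanish at the initial time. Only then is the switched-on
  -- source continuous and its contribution `C¹` in time.
  have hF0 : ∀ j x, F j x τ = 0 := fun j x => by simp [F, hψ]
  obtain ⟨C, hC0, hC⟩ : ∃ C, 0 ≤ C ∧ ∀ j, ∀ x ∈ Icc (0 : ℝ) 1,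
      |φ j x| ≤ C ∧ |φ₁ j x| ≤ C ∧ |ψ j x| ≤ C ∧ |ψ₁ j x| ≤ C := by
    obtain ⟨C₁, h0, h1⟩ := exists_bound_Icc hc₀
    obtain ⟨C₂, h0', h2⟩ := exists_bound_Icc hc₁
    obtain ⟨C₃, h0'', h3⟩ := exists_bound_Icc hcψ
    obtain ⟨C₄, h0''', h4⟩ := exists_bound_Icc hcψ₁
    refine ⟨C₁ + C₂ + C₃ + C₄, by positivity, fun j x hx => ⟨?_, ?_, ?_, ?_⟩⟩
    · linarith [h1 j x hx]
    · linarith [h2 j x hx]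
    · linarith [h3 j x hx]
    · linarith [h4 j x hx]
  set C₁ := C + (n + 1) * S.M * C with hC₁
  have hM := S.M_pos
  have hC₁0 : 0 ≤ C₁ := by positivity
  have hexp : ∀ t ≥ τ, 1 + (t - τ) ≤ Real.exp (S.lam * (t - τ)) := fun t ht => by
    have h1 := Real.add_one_le_exp (t - τ)
    have h2 : Real.exp (t - τ) ≤ Real.exp (S.lam * (t - τ)) :=
      Real.exp_le_exp.2 (le_mul_of_one_le_left (sub_nonneg.2 ht) S.one_le_lam)
    linarith
  have hFb : ∀ j, ∀ x ∈ Icc (0 : ℝ) 1, ∀ t ≥ τ, |F j x t| ≤ C₁ * Real.exp (S.lam * (t - τ)) ∧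
      |FT j x t| ≤ 2 * C₁ * Real.exp (S.lam * (t - τ)) := by
    intro j x hx t ht
    have e1 := S.abs_spatial_le (fun j => (hC j x hx).1) (fun j => (hC j x hx).2.1) j t
    have e2 := S.abs_spatial_le (fun j => (hC j x hx).2.2.1) (fun j => (hC j x hx).2.2.2) j t
    have e3 := (hC j x hx).2.2.1
    have e4 := hexp t ht
    have e5 : 0 ≤ t - τ := sub_nonneg.2 ht
    have e6 : |(t - τ) * S.spatial ψ ψ₁ j x t| ≤ (t - τ) * C₁ := by
      rw [abs_mul, abs_of_nonneg e5]
      exact mul_le_mul_of_nonneg_left (by linarith [e2.1]) e5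
    have e7 : |(t - τ) * S.spatialT ψ ψ₁ j x t| ≤ (t - τ) * C₁ := by
      rw [abs_mul, abs_of_nonneg e5]
      exact mul_le_mul_of_nonneg_left (by linarith [e2.2]) e5
    have e8 := mul_le_mul_of_nonneg_left e4 hC₁0
    constructor
    · have := abs_add_le (ψ j x + S.spatial φ φ₁ j x t) ((t - τ) * S.spatial ψ ψ₁ j x t)
      have := abs_add_le (ψ j x) (S.spatial φ φ₁ j x t)
      simp only [F]; linarith
    · have := abs_add_le (S.spatialT φ φ₁ j x t)
        (S.spatial ψ ψ₁ j x t + (t - τ) * S.spatialT ψ ψ₁ j x t)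
      have := abs_add_le (S.spatial ψ ψ₁ j x t) ((t - τ) * S.spatialT ψ ψ₁ j x t)
      have : 0 ≤ (t - τ) * C₁ := by positivity
      simp only [FT]; linarith [e1.2, e2.1]
  -- The residual is moved to the right-hand side and divided by the speed, because the
  -- characteristics are parametrized by space.
  let h : Fin n → ℝ → ℝ → ℝ := fun j x t => -(S.f j x t * F j x t)
  let hT : Fin n → ℝ → ℝ → ℝ := fun j x t => -(S.fT j x t * F j x t + S.f j x t * FT j x t)
  have hδ := S.δ_pos
  have hL := S.L_nonneg
  have hcausal := causal_srcG (S := S) (τ := τ) (h := h) (hT := hT)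
    (H := (S.L + 2 * S.δ) * C₁)
    (fun j => ((S.continuous_f j).mul (hcF j)).neg)
    (fun j => (((S.continuous_fT j).mul (hcF j)).add ((S.continuous_f j).mul (hcFT j))).neg)
    (fun j x t => ((S.hasDerivAt_f j x t).mul (hdF j x t)).neg)
    (fun j x => by simp [h, hF0]) (by positivity)
    (fun j x hx t ht => by
      have e1 := mul_le_mul (S.abs_f_le j x t) (hFb j x hx t ht).1 (abs_nonneg _) hδ.le
      have e2 : 0 ≤ C₁ * Real.exp (S.lam * (t - τ)) := by positivity
      simp only [h, abs_neg, abs_mul]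
      nlinarith)
    (fun j x hx t ht => by
      have e1 := mul_le_mul (S.abs_fT_le j x t) (hFb j x hx t ht).1 (abs_nonneg _) hL
      have e2 := mul_le_mul (S.abs_f_le j x t) (hFb j x hx t ht).2 (abs_nonneg _) hδ.le
      simp only [hT, abs_neg]
      refine (abs_add_le _ _).trans ?_
      rw [abs_mul, abs_mul]
      linarith)
  obtain ⟨w, z, hw, hfix⟩ := exists_causal_fixedPoint (by positivity) hcausal
  -- the space derivative of `w`
  let wX : Fin n → ℝ → ℝ → ℝ := fun j x t =>
    h j x (max t τ) - ∑ k, S.q j k x t * w k x t - z j x t * S.f j x t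
  have hwX : ∀ j, ∀ x ∈ Icc (0 : ℝ) 1, ∀ t,
      HasDerivWithinAt (fun y => w j y t) (wX j x t) (Icc 0 1) x := by
    intro j x hx t
    have hr := S.hasDerivWithinAt_W j hx x t
    have hG := hasDerivWithinAt_integral_Icc (g := fun ξ => h j ξ (max (S.W j ξ x t) τ))
      (Continuous.comp₂' (((S.continuous_f j).mul (hcF j)).neg) (by fun_prop) (by fun_prop))
      (xIn m j) x (Icc 0 1)
    have hI := hasDerivWithinAt_integral_Icc
      (g := fun ξ => ∑ k, S.q j k ξ (S.W j ξ x t) * w k ξ (S.W j ξ x t))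
      (continuous_finsetSum _ fun k _ => Continuous.mul (by fun_prop)
        (Continuous.comp₂' (hw.cont k) (by fun_prop) (by fun_prop))) (xIn m j) x (Icc 0 1)
    -- By `W_comp`, all points of one characteristic share the same integrand and boundary value.
    -- Along it only the upper limits of integration vary, so the fundamental theorem of calculus
    -- applies.
    have halong : HasDerivWithinAt (fun y => w j y (S.W j y x t))
        (h j x (max (S.W j x x t) τ) - ∑ k, S.q j k x (S.W j x x t) * w k x (S.W j x x t))
        (Icc 0 1) x := by
      refine ((hG.add (hI.const_sub (opP m S.p w j (S.W j (xIn m j) x t)))).congr_deriv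
        (by ring)).congr (fun y hy => ?_) ?_
      · simp only [hfix j y, srcG, opL, W_comp, pj_of_mem hy, Pi.add_apply]
      · simp only [hfix j x, srcG, opL, W_comp, pj_of_mem hx, Pi.add_apply]
    have := hasDerivWithinAt_of_along (hw.cont_t j) (hw.deriv_t j) hr halong
    simpa only [W_self] using this
  have hcwX : ∀ j, Continuous fun y : ℝ × ℝ => wX j y.1 y.2 := by
    intro j
    have e1 : Continuous fun y : ℝ × ℝ => h j y.1 (max y.2 τ) :=
      Continuous.comp₂' (((S.continuous_f j).mul (hcF j)).neg) (by fun_prop) (by fun_prop)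
    have e2 : Continuous fun y : ℝ × ℝ => ∑ k, S.q j k y.1 y.2 * w k y.1 y.2 :=
      continuous_finsetSum _ fun k _ => (S.continuous_q j k).mul (hw.cont k)
    exact (e1.sub e2).sub ((hw.cont_t j).mul (S.continuous_f j))
  -- Compact support provides the compatibility at the corners: the Taylor polynomial vanishes at
  -- both ends and satisfies the boundary condition trivially.
  have hbd : ∀ j, ∀ x ∉ Ioo (0 : ℝ) 1, φ j x = 0 ∧ ψ j x = 0 := by
    intro j x hx
    refine ⟨(hφ.apply_eq_zero j hx).1, ?_⟩
    simp only [hψ, spatial, hφ₁, (hφ.apply_eq_zero j hx).2, mul_zero, zero_add, neg_eq_zero]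
    exact Finset.sum_eq_zero fun k _ => by rw [(hφ.apply_eq_zero k hx).1, mul_zero]
  refine ⟨fun j x t => φ j x + (t - τ) * ψ j x + w j x t,
    ⟨⟨fun j x t => φ₁ j x + (t - τ) * ψ₁ j x + wX j x t, fun j x t => ψ j x + z j x t,
      fun j => ⟨?_, ?_, ?_, ?_, ?_⟩, ?_⟩, ?_, ?_⟩⟩
  · exact ((((hc₀ j).comp continuous_fst).add ((continuous_snd.sub continuous_const).mul
      ((hcψ j).comp continuous_fst))).add (hw.cont j)).continuousOn
  · exact ((((hc₁ j).comp continuous_fst).add ((continuous_snd.sub continuous_const).mul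
      ((hcψ₁ j).comp continuous_fst))).add (hcwX j)).continuousOn
  · exact (((hcψ j).comp continuous_fst).add (hw.cont_t j)).continuousOn
  · intro x hx t _
    exact ((hd₁ j x).hasDerivWithinAt.add ((hdψ j x hx).const_mul (t - τ))).add (hwX j x hx t)
  · intro x _ t _
    have e1 : HasDerivAt (fun s : ℝ => s - τ) 1 t := (hasDerivAt_id t).sub_const τ
    refine ((((e1.mul_const (ψ j x)).const_add (φ j x)).add
      (hw.deriv_t j x t)).hasDerivWithinAt).congr_deriv (by simp)
  · intro j x _ t ht
    have ha := S.a_ne j x t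
    have hq : ∀ k, S.a j x t * S.q j k x t = S.b j k x t := fun k => by
      simp only [q, f]; field_simp
    have haf : S.a j x t * S.f j x t = 1 := by simp only [f]; field_simp
    have e1 : S.a j x t * ∑ k, S.q j k x t * w k x t = ∑ k, S.b j k x t * w k x t := by
      rw [Finset.mul_sum]
      exact Finset.sum_congr rfl fun k _ => by rw [← mul_assoc, hq k]
    have e2 : ∑ k, S.b j k x t * (φ k x + (t - τ) * ψ k x + w k x t) =
        (∑ k, S.b j k x t * φ k x) + (t - τ) * (∑ k, S.b j k x t * ψ k x) +
          ∑ k, S.b j k x t * w k x t := by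
      rw [Finset.mul_sum, ← Finset.sum_add_distrib, ← Finset.sum_add_distrib]
      exact Finset.sum_congr rfl fun k _ => by ring
    have e3 : F j x t = ψ j x + (S.a j x t * φ₁ j x + ∑ k, S.b j k x t * φ k x) +
      (t - τ) * (S.a j x t * ψ₁ j x + ∑ k, S.b j k x t * ψ k x) := rfl
    simp only [wX, h, max_eq_left (le_of_lt (mem_Ioi.1 ht))]
    rw [e2]
    linear_combination (-F j x t - z j x t) * haf - e1 - e3
  · intro j t _
    have hx := xIn_notMem (m := m) j
    have e1 : w j (xIn m j) t = opP m S.p w j t := by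
      rw [hfix j, srcG, opL, pj_of_mem (xIn_mem j)]
      simp
    simp only [(hbd j _ hx).1, (hbd j _ hx).2, mul_zero, add_zero, zero_add, e1, opP]
    refine Finset.sum_congr rfl fun k _ => ?_
    rw [(hbd k _ (xOut_notMem k)).1, (hbd k _ (xOut_notMem k)).2]; ring
  · intro j x _
    simp [hw.zero j x τ le_rfl]

end Sys

/-! ### Continuous functions in `L²(0,1)ⁿ` -/

instance : IsFiniteMeasure μ01 := ⟨by simp⟩

theorem memLp_of_continuousOn {f : ℝ → ℝ} (hf : ContinuousOn f (Icc 0 1)) : MemLp f 2 μ01 := by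
  obtain ⟨C, hC⟩ := isCompact_Icc.exists_bound_of_continuousOn hf
  refine MemLp.of_bound ((hf.mono Ioo_subset_Icc_self).aestronglyMeasurable measurableSet_Ioo) C ?_
  exact (ae_restrict_iff' measurableSet_Ioo).2
    (Eventually.of_forall fun x hx => hC x (Ioo_subset_Icc_self hx))

theorem toL2_apply {f : Fin n → ℝ → ℝ} {j : Fin n} (hf : MemLp (f j) 2 μ01) :
    toL2 f j = hf.toLp (f j) := by simp [toL2, hf]

theorem toL2_congr {f g : Fin n → ℝ → ℝ} (hf : ∀ j, ContinuousOn (f j) (Icc 0 1))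
    (h : ∀ j, ∀ x ∈ Icc (0 : ℝ) 1, f j x = g j x) : toL2 f = toL2 g := by
  have hg : ∀ j, ContinuousOn (g j) (Icc 0 1) := fun j =>
    (hf j).congr fun x hx => (h j x hx).symm
  funext j
  rw [toL2_apply (memLp_of_continuousOn (hf j)), toL2_apply (memLp_of_continuousOn (hg j)),
    MemLp.toLp_eq_toLp_iff]
  exact (ae_restrict_iff' measurableSet_Ioo).2
    (Eventually.of_forall fun x hx => h j x (Ioo_subset_Icc_self hx))

theorem toL2_comb {f g : Fin n → ℝ → ℝ} (hf : ∀ j, ContinuousOn (f j) (Icc 0 1))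
    (hg : ∀ j, ContinuousOn (g j) (Icc 0 1)) (c d : ℝ) :
    toL2 (fun j x => c * f j x + d * g j x) = c • toL2 f + d • toL2 g := by
  funext j
  have h1 := memLp_of_continuousOn (hf j)
  have h2 := memLp_of_continuousOn (hg j)
  have h3 : MemLp (fun x => c * f j x + d * g j x) 2 μ01 := (h1.const_mul c).add (h2.const_mul d)
  rw [toL2_apply h3, Pi.add_apply, Pi.smul_apply, Pi.smul_apply, toL2_apply h1, toL2_apply h2,
    ← MemLp.toLp_const_smul, ← MemLp.toLp_const_smul, ← MemLp.toLp_add]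
  rfl

theorem norm_toL2_apply_sq {f : Fin n → ℝ → ℝ} {j : Fin n} (hf : ContinuousOn (f j) (Icc 0 1)) :
    ‖toL2 f j‖ ^ 2 = ∫ x in (0 : ℝ)..1, f j x ^ 2 := by
  have h := memLp_of_continuousOn hf
  rw [toL2_apply h, ← real_inner_self_eq_norm_sq, L2.inner_def,
    intervalIntegral.integral_of_le zero_le_one, integral_Ioc_eq_integral_Ioo]
  refine integral_congr_ae ?_
  filter_upwards [h.coeFn_toLp] with x hx
  rw [hx]; simp [sq]

theorem norm_toL2_sq_le {f : Fin n → ℝ → ℝ} (hf : ∀ j, ContinuousOn (f j) (Icc 0 1)) :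
    ‖toL2 f‖ ^ 2 ≤ Sys.normSq f := by
  have h0 : ∀ j, 0 ≤ ∫ x in (0 : ℝ)..1, f j x ^ 2 := fun j =>
    intervalIntegral.integral_nonneg zero_le_one fun x _ => sq_nonneg _
  have hN : 0 ≤ Sys.normSq f := Finset.sum_nonneg fun j _ => h0 j
  rw [← Real.sqrt_le_sqrt_iff hN, Real.sqrt_sq (norm_nonneg _),
    pi_norm_le_iff_of_nonneg (Real.sqrt_nonneg _)]
  intro j
  refine Real.le_sqrt_of_sq_le ?_
  rw [norm_toL2_apply_sq (hf j)]
  exact Finset.single_le_sum (f := fun j => ∫ x in (0 : ℝ)..1, f j x ^ 2) (fun j _ => h0 j)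
    (Finset.mem_univ j)

theorem normSq_le_norm_toL2_sq {f : Fin n → ℝ → ℝ} (hf : ∀ j, ContinuousOn (f j) (Icc 0 1)) :
    Sys.normSq f ≤ n * ‖toL2 f‖ ^ 2 := by
  calc Sys.normSq f = ∑ j, ‖toL2 f j‖ ^ 2 :=
        Finset.sum_congr rfl fun j _ => (norm_toL2_apply_sq (hf j)).symm
    _ ≤ ∑ _j : Fin n, ‖toL2 f‖ ^ 2 := Finset.sum_le_sum fun j _ => by
        gcongr; exact norm_le_pi_norm (toL2 f) j
    _ = _ := by simp

/-! ### Density of test functions -/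

/-- The vector space of test functions. -/
def testSpace (n : ℕ) : Submodule ℝ (Fin n → ℝ → ℝ) where
  carrier := {φ | IsTestFunction φ}
  add_mem' := fun {φ ψ} hφ hψ j => ⟨(hφ j).1.add (hψ j).1, (hφ j).2.1.add (hψ j).2.1,
    (tsupport_add (φ j) (ψ j)).trans (union_subset (hφ j).2.2 (hψ j).2.2)⟩
  zero_mem' := fun j => ⟨contDiff_const, HasCompactSupport.zero, by
    have : tsupport (0 : ℝ → ℝ) = ∅ := by simp [tsupport]
    exact this ▸ empty_subset _⟩
  smul_mem' := fun c φ hφ j => ⟨contDiff_const.mul (hφ j).1, (hφ j).2.1.mul_left,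
    (closure_mono (Function.support_mul_subset_right _ _)).trans (hφ j).2.2⟩

theorem IsTestFunction.continuousOn {φ : Fin n → ℝ → ℝ} (h : IsTestFunction φ) (j : Fin n) :
    ContinuousOn (φ j) (Icc 0 1) := (h j).1.continuous.continuousOn

/-- The embedding of the test functions into `L²(0,1)ⁿ`. -/
def testToL2 (n : ℕ) : testSpace n →ₗ[ℝ] L2 n where
  toFun φ := toL2 φ.1
  map_add' φ ψ := by
    have := toL2_comb (fun j => φ.2.continuousOn j) (fun j => ψ.2.continuousOn j) 1 1
    simp only [one_mul, one_smul] at this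
    exact this
  map_smul' c φ := by
    have := toL2_comb (fun j => φ.2.continuousOn j) (fun j => φ.2.continuousOn j) c 0
    simp only [zero_mul, zero_smul, add_zero] at this
    exact this

/-- The orthogonal complement is zero by the fundamental lemma of the calculus of variations on the
open interval. -/
theorem dense_test_scalar :
    Dense {f : Lp ℝ 2 μ01 | ∃ g : ℝ → ℝ, ContDiff ℝ ∞ g ∧ HasCompactSupport g ∧
      tsupport g ⊆ Ioo 0 1 ∧ (f : ℝ → ℝ) =ᵐ[μ01] g} := by
  let K : Submodule ℝ (Lp ℝ 2 μ01) :=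
    { carrier := {f : Lp ℝ 2 μ01 | ∃ g : ℝ → ℝ, ContDiff ℝ ∞ g ∧ HasCompactSupport g ∧
        tsupport g ⊆ Ioo 0 1 ∧ (f : ℝ → ℝ) =ᵐ[μ01] g}
      add_mem' := by
        rintro f₁ f₂ ⟨g₁, h₁, h₁', h₁'', e₁⟩ ⟨g₂, h₂, h₂', h₂'', e₂⟩
        exact ⟨g₁ + g₂, h₁.add h₂, h₁'.add h₂', (tsupport_add g₁ g₂).trans (union_subset h₁'' h₂''),
          (Lp.coeFn_add _ _).trans (e₁.add e₂)⟩
      zero_mem' := by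
        have : tsupport (0 : ℝ → ℝ) = ∅ := by simp [tsupport]
        exact ⟨0, contDiff_const, HasCompactSupport.zero, this ▸ empty_subset _, Lp.coeFn_zero _ _ _⟩
      smul_mem' := by
        rintro c f ⟨g, h, h', h'', e⟩
        exact ⟨fun x => c * g x, contDiff_const.mul h, h'.mul_left,
          (closure_mono (Function.support_mul_subset_right _ _)).trans h'',
          (Lp.coeFn_smul c f).trans (e.const_smul c)⟩ }
  change Dense (K : Set (Lp ℝ 2 μ01))
  rw [Submodule.dense_iff_topologicalClosure_eq_top, Submodule.topologicalClosure_eq_top_iff,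
    Submodule.eq_bot_iff]
  intro f hf
  rw [Submodule.mem_orthogonal] at hf
  have hloc : LocallyIntegrableOn (f : ℝ → ℝ) (Ioo 0 1) volume := by
    have h1 : Integrable (f : ℝ → ℝ) μ01 := (Lp.memLp f).integrable one_le_two
    exact IntegrableOn.locallyIntegrableOn h1
  have h := isOpen_Ioo.ae_eq_zero_of_integral_contDiff_smul_eq_zero hloc ?_
  · refine Lp.eq_zero_iff_ae_eq_zero.2 ?_
    exact (ae_restrict_iff' measurableSet_Ioo).2 h
  · intro g hg hc hs
    have hm : MemLp g 2 μ01 := memLp_of_continuousOn hg.continuous.continuousOn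
    have h1 := hf (hm.toLp g) ⟨g, hg, hc, hs, hm.coeFn_toLp⟩
    rw [L2.inner_def] at h1
    have h2 : ∫ x in Ioo (0 : ℝ) 1, g x • f x = ∫ x, g x • f x :=
      setIntegral_eq_integral_of_forall_compl_eq_zero fun x hx => by
        rw [image_eq_zero_of_notMem_tsupport fun h => hx (hs h), zero_smul]
    rw [← h2]
    refine (integral_congr_ae ?_).trans h1
    filter_upwards [hm.coeFn_toLp] with x hx
    rw [hx]; simp [mul_comm]

theorem denseRange_testToL2 (n : ℕ) : DenseRange (testToL2 n) := by
  have h := dense_pi (univ : Set (Fin n)) fun (_ : Fin n) _ => dense_test_scalar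
  refine h.mono fun f hf => ?_
  choose g h1 h2 h3 h4 using fun j => hf j (mem_univ j)
  refine ⟨⟨g, fun j => ⟨h1 j, h2 j, h3 j⟩⟩, ?_⟩
  funext j
  have hm : MemLp (g j) 2 μ01 := memLp_of_continuousOn (h1 j).continuous.continuousOn
  change toL2 g j = f j
  rw [toL2_apply hm]
  exact Lp.ext (hm.coeFn_toLp.trans (h4 j).symm)

/-! ### The evolution family -/

theorem IsClassicalSolution.continuousOn_at_time {a : Fin n → ℝ → ℝ → ℝ}
    {b : Fin n → Fin n → ℝ → ℝ → ℝ} {p : Fin n → Fin n → ℝ} {τ t : ℝ} {φ : Fin n → ℝ → ℝ}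
    {u : Fin n → ℝ → ℝ → ℝ} (hu : IsClassicalSolution m a b p τ φ u) (ht : τ ≤ t) (j : Fin n) :
    ContinuousOn (fun x => u j x t) (Icc 0 1) := by
  obtain ⟨⟨ux, ut, h, -⟩, -, -⟩ := hu
  exact fun x hx => ((h j).deriv_x x hx t ht).continuousWithinAt

theorem IsClassicalSolution.continuousOn_initial {a : Fin n → ℝ → ℝ → ℝ}
    {b : Fin n → Fin n → ℝ → ℝ → ℝ} {p : Fin n → Fin n → ℝ} {τ : ℝ} {φ : Fin n → ℝ → ℝ}
    {u : Fin n → ℝ → ℝ → ℝ} (hu : IsClassicalSolution m a b p τ φ u) (j : Fin n) :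
    ContinuousOn (φ j) (Icc 0 1) :=
  (hu.continuousOn_at_time le_rfl j).congr fun x hx => (hu.2.2 j x hx).symm

namespace Sys

variable (S : Sys n m)

/-- A bound for the `L²` growth of solutions over a time span `s`. -/
def growth (s : ℝ) : ℝ := √(2 / S.ε * Real.exp (S.rate * s) * n)

theorem growth_nonneg (s : ℝ) : 0 ≤ S.growth s := Real.sqrt_nonneg _

theorem growth_mono : Monotone S.growth := fun s t h => by
  have := S.ε_pos; have := S.rate_nonneg
  unfold growth; gcongr

@[fun_prop] theorem continuous_growth : Continuous S.growth := by unfold growth; fun_prop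

variable {S}

/-- The energy estimate without source. The factor `n` inside `growth` comes from passing between
the sum over components and the maximum norm. -/
theorem norm_toL2_classical_le {τ t : ℝ} {φ : Fin n → ℝ → ℝ} {u : Fin n → ℝ → ℝ → ℝ}
    (hu : IsClassicalSolution m S.a S.b S.p τ φ u) (ht : τ ≤ t) :
    ‖toL2 (fun j x => u j x t)‖ ≤ S.growth (t - τ) * ‖toL2 φ‖ := by
  obtain ⟨v, vX, vT, hv, hvu⟩ := hu.exists_isSol
  have hε := S.ε_pos
  have h1 : toL2 (fun j x => u j x t) = toL2 fun j x => v j x t :=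
    toL2_congr (hu.continuousOn_at_time ht) fun j x hx => (hvu j x hx t ht).symm
  have h2 : toL2 φ = toL2 fun j x => v j x τ :=
    toL2_congr hu.continuousOn_initial fun j x hx => by rw [hvu j x hx τ le_rfl, hu.2.2 j x hx]
  rw [h1, h2]
  have h3 := norm_toL2_sq_le fun j => (hv.continuous_at_time j t).continuousOn (s := Icc 0 1)
  have h4 := normSq_le_norm_toL2_sq fun j => (hv.continuous_at_time j τ).continuousOn (s := Icc 0 1)
  have h5 := hv.normSq_le (G := 0) (fun j x _ t _ => by simp) ht
  refine abs_le_of_sq_le_sq' ?_ (mul_nonneg (S.growth_nonneg _) (norm_nonneg _)) |>.2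
  rw [mul_pow, growth, Real.sq_sqrt (by positivity)]
  refine (h3.trans h5).trans ?_
  rw [mul_assoc _ (n : ℝ)]
  gcongr
  simpa using h4

/-- For equal initial values this is uniqueness of classical solutions in `L²`, which makes the
chosen solutions depend linearly on their data. -/
theorem toL2_classical_sub_le {τ t : ℝ} {φ ψ : Fin n → ℝ → ℝ} {u v : Fin n → ℝ → ℝ → ℝ}
    (hu : IsClassicalSolution m S.a S.b S.p τ φ u) (hv : IsClassicalSolution m S.a S.b S.p τ ψ v)
    (ht : τ ≤ t) :
    ‖toL2 (fun j x => u j x t) - toL2 (fun j x => v j x t)‖ ≤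
      S.growth (t - τ) * ‖toL2 φ - toL2 ψ‖ := by
  have h := norm_toL2_classical_le (hu.comb hv 1 (-1)) ht
  rw [toL2_comb (hu.continuousOn_at_time ht) (hv.continuousOn_at_time ht),
    toL2_comb hu.continuousOn_initial hv.continuousOn_initial] at h
  simpa [sub_eq_add_neg] using h

variable (S)

/-- The classical solution with a test function as initial value. -/
def sol (τ : ℝ) (φ : testSpace n) : Fin n → ℝ → ℝ → ℝ := (S.exists_classicalSolution τ φ.2).choose

theorem isClassicalSolution_sol (τ : ℝ) (φ : testSpace n) :
    IsClassicalSolution m S.a S.b S.p τ φ.1 (S.sol τ φ) :=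
  (S.exists_classicalSolution τ φ.2).choose_spec

/-- The evolution of test functions. -/
def evolTest {τ t : ℝ} (h : τ ≤ t) : testSpace n →ₗ[ℝ] L2 n where
  toFun φ := toL2 fun j x => S.sol τ φ j x t
  map_add' φ ψ := by
    -- The sum of the chosen solutions and the solution chosen for the sum have the same initial
    -- values, so they agree in `L²`.
    have h1 := (S.isClassicalSolution_sol τ φ).comb (S.isClassicalSolution_sol τ ψ) 1 1
    have h2 := toL2_classical_sub_le (S.isClassicalSolution_sol τ (φ + ψ)) h1 h
    rw [toL2_comb ((S.isClassicalSolution_sol τ φ).continuousOn_at_time h)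
      ((S.isClassicalSolution_sol τ ψ).continuousOn_at_time h),
      show (fun j x => 1 * φ.1 j x + 1 * ψ.1 j x) = (φ + ψ).1 by funext j x; simp] at h2
    simpa [sub_eq_zero] using h2
  map_smul' c φ := by
    have h1 := (S.isClassicalSolution_sol τ φ).comb (S.isClassicalSolution_sol τ φ) c 0
    have h2 := toL2_classical_sub_le (S.isClassicalSolution_sol τ (c • φ)) h1 h
    rw [toL2_comb ((S.isClassicalSolution_sol τ φ).continuousOn_at_time h)
      ((S.isClassicalSolution_sol τ φ).continuousOn_at_time h),
      show (fun j x => c * φ.1 j x + 0 * φ.1 j x) = (c • φ).1 by funext j x; simp] at h2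
    simpa [sub_eq_zero] using h2

theorem norm_evolTest_le {τ t : ℝ} (h : τ ≤ t) (φ : testSpace n) :
    ‖S.evolTest h φ‖ ≤ S.growth (t - τ) * ‖testToL2 n φ‖ :=
  norm_toL2_classical_le (S.isClassicalSolution_sol τ φ) h

open Classical in
/-- The evolution family. -/
def evol (t τ : ℝ) : L2 n →L[ℝ] L2 n :=
  if h : τ ≤ t then (S.evolTest h).extendOfNorm (testToL2 n) else ContinuousLinearMap.id ℝ (L2 n)

theorem norm_evol_le {τ t : ℝ} (h : τ ≤ t) (x : L2 n) :
    ‖S.evol t τ x‖ ≤ S.growth (t - τ) * ‖x‖ := by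
  rw [evol, dif_pos h]
  exact LinearMap.norm_extendOfNorm_apply_le (denseRange_testToL2 n) _ (S.norm_evolTest_le h) x

theorem evol_testToL2 {τ t : ℝ} (h : τ ≤ t) (φ : testSpace n) :
    S.evol t τ (testToL2 n φ) = toL2 fun j x => S.sol τ φ j x t := by
  rw [evol, dif_pos h]
  exact LinearMap.extendOfNorm_eq (denseRange_testToL2 n) ⟨_, S.norm_evolTest_le h⟩ φ

variable {S}

/-- The evolution family extends the classical solutions. -/
theorem evol_toL2 {τ t : ℝ} (h : τ ≤ t) {φ : Fin n → ℝ → ℝ} {u : Fin n → ℝ → ℝ → ℝ}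
    (hu : IsClassicalSolution m S.a S.b S.p τ φ u) :
    S.evol t τ (toL2 φ) = toL2 fun j x => u j x t := by
  -- The stability estimate holds for test functions and is closed in `x`. It thus extends by
  -- density, and can be used at the initial value of `u`, which need not be a test function.
  have key : ∀ x : L2 n, ‖S.evol t τ x - toL2 (fun j x => u j x t)‖ ≤
      S.growth (t - τ) * ‖x - toL2 φ‖ := by
    intro x
    refine (denseRange_testToL2 n).induction_on x (isClosed_le (by fun_prop) (by fun_prop))
      fun ψ => ?_
    rw [S.evol_testToL2 h]
    exact toL2_classical_sub_le (S.isClassicalSolution_sol τ ψ) hu h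
  have := key (toL2 φ)
  simpa [sub_eq_zero] using this

variable (S)

theorem evol_self (τ : ℝ) : S.evol τ τ = ContinuousLinearMap.id ℝ (L2 n) := by
  ext1 x
  refine (denseRange_testToL2 n).induction_on x (isClosed_eq (by fun_prop) (by fun_prop))
    fun φ => ?_
  rw [S.evol_testToL2 le_rfl]
  have hs := S.isClassicalSolution_sol τ φ
  exact toL2_congr (hs.continuousOn_at_time le_rfl) hs.2.2

/-- At time `s` a solution is in general no longer a test function, but it is the initial value of
its own restriction to later times, to which `evol_toL2` applies. -/
theorem evol_comp {τ s t : ℝ} (h : τ ≤ s) (h' : s ≤ t) (x : L2 n) :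
    S.evol t s (S.evol s τ x) = S.evol t τ x := by
  refine (denseRange_testToL2 n).induction_on x (isClosed_eq (by fun_prop) (by fun_prop))
    fun φ => ?_
  rw [S.evol_testToL2 h, S.evol_testToL2 (h.trans h')]
  exact evol_toL2 h' ((S.isClassicalSolution_sol τ φ).restart h)

theorem continuous_toL2_isSol {τ : ℝ} {g u uX uT : Fin n → ℝ → ℝ → ℝ} (h : S.IsSol τ g u uX uT) :
    Continuous fun t => toL2 fun j x => u j x t := by
  rw [continuous_iff_continuousAt]
  intro t₀
  rw [ContinuousAt, tendsto_iff_norm_sub_tendsto_zero]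
  have h1 : ∀ t, ‖toL2 (fun j x => u j x t) - toL2 (fun j x => u j x t₀)‖ ≤
      √(normSq fun j x => u j x t - u j x t₀) := by
    intro t
    refine Real.le_sqrt_of_sq_le ?_
    have e := toL2_comb (fun j => (h.continuous_at_time j t).continuousOn (s := Icc 0 1))
      (fun j => (h.continuous_at_time j t₀).continuousOn (s := Icc 0 1)) 1 (-1)
    have e' := norm_toL2_sq_le (f := fun j x => u j x t - u j x t₀)
      fun j => ((h.continuous_at_time j t).sub (h.continuous_at_time j t₀)).continuousOn
    have e'' : (fun j x => 1 * u j x t + -1 * u j x t₀) = fun j x => u j x t - u j x t₀ := by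
      funext j x; ring
    rw [e''] at e
    rw [e] at e'
    simpa [sub_eq_add_neg] using e'
  refine squeeze_zero (fun _ => norm_nonneg _) h1 ?_
  have h2 : Continuous fun t => √(normSq fun j x => u j x t - u j x t₀) := by
    refine Real.continuous_sqrt.comp (continuous_finsetSum _ fun j _ => ?_)
    refine continuous_integral_param (F := fun t x => (u j x t - u j x t₀) ^ 2) ?_
      continuous_const continuous_const
    exact (((Continuous.comp₂' (h.cont j) continuous_snd continuous_fst).sub
      (Continuous.comp₂' (h.cont j) continuous_snd continuous_const)).pow 2)
  have h3 := h2.tendsto t₀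
  simpa [normSq] using h3

/-- Solutions starting from a test function stay close to it for a short time. -/
theorem exists_evol_sub_le (φ : testSpace n) : ∃ G, 0 ≤ G ∧ ∀ s t, s ≤ t →
    ‖S.evol t s (testToL2 n φ) - testToL2 n φ‖ ≤ G * √(Real.exp (S.rate * (t - s)) * (t - s)) := by
  have hc : ∀ j, Continuous (φ.1 j) := fun j => (φ.2 j).1.continuous
  have hd : ∀ j x, HasDerivAt (φ.1 j) (deriv (φ.1 j) x) x := fun j x =>
    ((φ.2 j).1.differentiable (by simp)).differentiableAt.hasDerivAt
  have hc' : ∀ j, Continuous (deriv (φ.1 j)) := fun j =>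
    (φ.2 j).1.continuous_deriv (by simp)
  obtain ⟨C₁, h0, h1⟩ := exists_bound_Icc hc
  obtain ⟨C₂, h0', h2⟩ := exists_bound_Icc hc'
  have hε := S.ε_pos
  set G₀ : ℝ := (n + 1) * S.M * max C₁ C₂
  refine ⟨√(2 / S.ε * (n * G₀ ^ 2)), Real.sqrt_nonneg _, fun s t hst => ?_⟩
  rw [S.evol_testToL2 hst]
  have hu := S.isClassicalSolution_sol s φ
  obtain ⟨v, vX, vT, hv, hvu⟩ := hu.exists_isSol
  have hz : ∀ j, ∀ x, x ∉ Ioo (0 : ℝ) 1 → φ.1 j x = 0 := fun j x hx =>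
    (φ.2.apply_eq_zero j hx).1
  -- The deviation from the initial value solves the same problem with zero initial values and a
  -- bounded source; it satisfies the boundary conditions because the test function vanishes at both
  -- ends.
  have hw : S.IsSol s (fun j x t => -S.spatial φ.1 (fun j => deriv (φ.1 j)) j x t)
      (fun j x t => v j x t - φ.1 j (pj x)) (fun j x t => vX j x t - deriv (φ.1 j) x) vT := by
    refine ⟨fun j => (hv.cont j).sub ((hc j).comp (by fun_prop)),
      fun j => (hv.cont_x j).sub ((hc' j).comp continuous_fst), hv.cont_t, fun j x t => ?_, ?_, ?_,
      ?_, ?_⟩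
    · simp only [pj_pj, hv.proj]
    · intro j x hx t ht
      refine (hv.deriv_x j x hx t ht).sub (((hd j x).hasDerivWithinAt).congr (fun y hy => ?_) ?_)
      · rw [pj_of_mem hy]
      · rw [pj_of_mem hx]
    · intro j x t
      exact (hv.deriv_t j x t).sub_const _
    · intro j x hx t ht
      have := hv.pde j x hx t ht
      simp only [spatial, pj_of_mem hx, mul_sub, Finset.sum_sub_distrib]
      linarith
    · intro j t ht
      have := hv.bc j t ht
      simp only [opP] at this ⊢
      rw [this, pj_of_mem (xIn_mem j), hz j _ (xIn_notMem j), sub_zero]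
      refine Finset.sum_congr rfl fun k _ => ?_
      rw [pj_of_mem (xOut_mem k), hz k _ (xOut_notMem k), sub_zero]
  have h3 := hw.normSq_le (G := G₀) (fun j x hx t _ => by
    rw [abs_neg]
    exact (S.abs_spatial_le (fun j => (h1 j x hx).trans (le_max_left _ _))
      (fun j => (h2 j x hx).trans (le_max_right _ _)) j t).1) hst
  have h4 : normSq (fun j x => v j x s - φ.1 j (pj x)) = 0 := by
    refine Finset.sum_eq_zero fun j _ => ?_
    rw [intervalIntegral.integral_congr (g := fun _ => 0)]
    · simp
    · intro x hx
      rw [uIcc_of_le zero_le_one] at hx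
      simp [hvu j x hx s le_rfl, hu.2.2 j x hx, pj_of_mem hx]
  have h5 := norm_toL2_sq_le (f := fun j x => v j x t - φ.1 j (pj x))
    fun j => (hw.continuous_at_time j t).continuousOn
  have h6 : toL2 (fun j x => v j x t - φ.1 j (pj x)) =
      toL2 (fun j x => S.sol s φ j x t) - testToL2 n φ := by
    have := toL2_comb (hu.continuousOn_at_time hst) (fun j => (hc j).continuousOn) 1 (-1)
    rw [one_smul, neg_one_smul, ← sub_eq_add_neg] at this
    rw [show testToL2 n φ = toL2 φ.1 from rfl, ← this]
    refine toL2_congr (fun j => (hw.continuous_at_time j t).continuousOn) fun j x hx => ?_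
    rw [hvu j x hx t hst, pj_of_mem hx]; ring
  rw [h4, zero_add] at h3
  rw [h6] at h5
  have h7 := Real.sqrt_le_sqrt (h5.trans h3)
  rw [Real.sqrt_sq (norm_nonneg _)] at h7
  refine h7.trans (le_of_eq ?_)
  rw [← Real.sqrt_mul (by positivity)]
  congr 1; ring

/-- If `t ≥ τ₂`, the later evolution acts on `x` and on the state at `τ₂` started from `x` at `τ₁`,
which differ by at most `h (τ₂ - τ₁)`. If `t < τ₂`, the maximum freezes the first term at `x`, and
the monotonicity of `h` is enough. -/
theorem evol_max_sub_le (x : L2 n) {h : ℝ → ℝ} (hm : MonotoneOn h (Ici 0))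
    (hx : ∀ s t, s ≤ t → ‖S.evol t s x - x‖ ≤ h (t - s)) {τ₁ τ₂ t : ℝ} (h₁₂ : τ₁ ≤ τ₂)
    (ht : τ₁ ≤ t) :
    ‖S.evol (max t τ₂) τ₂ x - S.evol t τ₁ x‖ ≤ (S.growth |t - τ₂| + 1) * h (τ₂ - τ₁) := by
  have h0 : 0 ≤ h (τ₂ - τ₁) := (norm_nonneg _).trans (hx τ₁ τ₂ h₁₂)
  have hg := S.growth_nonneg |t - τ₂|
  rcases le_total τ₂ t with h' | h'
  · rw [max_eq_left h', ← S.evol_comp h₁₂ h', ← map_sub, abs_of_nonneg (sub_nonneg.2 h')]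
    refine (S.norm_evol_le h' _).trans ?_
    rw [norm_sub_rev]
    have := mul_le_mul_of_nonneg_left (hx τ₁ τ₂ h₁₂) (S.growth_nonneg (t - τ₂))
    linarith
  · rw [max_eq_right h', evol_self, ContinuousLinearMap.id_apply, norm_sub_rev]
    have h1 : h (t - τ₁) ≤ h (τ₂ - τ₁) :=
      hm (sub_nonneg.2 ht) (sub_nonneg.2 h₁₂) (by linarith)
    have := mul_nonneg hg h0
    linarith [hx τ₁ t ht]

/-- With the initial time frozen at `τ₀`, continuity in the final time is that of a classical
solution. Moving the initial time costs a locally bounded factor times `h |τ - τ₀|`, which tends to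
zero. -/
theorem continuousOn_evol_test (φ : testSpace n) :
    ContinuousOn (fun q : ℝ × ℝ => S.evol q.1 q.2 (testToL2 n φ)) {q | q.2 ≤ q.1} := by
  obtain ⟨G, hG, hx⟩ := S.exists_evol_sub_le φ
  have hr := S.rate_nonneg
  set x := testToL2 n φ
  set h : ℝ → ℝ := fun s => G * √(Real.exp (S.rate * s) * s) with hh
  have hm : MonotoneOn h (Ici 0) := by
    intro s hs t ht hst
    have : (0 : ℝ) ≤ s := hs
    simp only [hh]
    gcongr
  rintro ⟨t₀, τ₀⟩ h₀
  have h₀' : τ₀ ≤ t₀ := h₀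
  have hmain : ∀ q : ℝ × ℝ, q.2 ≤ q.1 →
      ‖S.evol q.1 q.2 x - S.evol (max q.1 τ₀) τ₀ x‖ ≤
      (S.growth |q.1 - q.2| + S.growth |q.1 - τ₀| + 1) * h |q.2 - τ₀| := by
    rintro ⟨t, τ⟩ (hq : τ ≤ t)
    have hn : 0 ≤ h |τ - τ₀| := by simp only [hh]; positivity
    have g1 := mul_nonneg (S.growth_nonneg |t - τ|) hn
    have g2 := mul_nonneg (S.growth_nonneg |t - τ₀|) hn
    rcases le_total τ τ₀ with hc | hc
    · have := S.evol_max_sub_le x hm hx hc hq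
      rw [norm_sub_rev]
      rw [← abs_of_nonneg (sub_nonneg.2 hc), abs_sub_comm τ₀ τ] at this
      simp only at g1 g2 ⊢
      nlinarith
    · have := S.evol_max_sub_le x hm hx hc (hc.trans hq)
      rw [max_eq_left hq] at this
      rw [← abs_of_nonneg (sub_nonneg.2 hc)] at this
      simp only at g1 g2 ⊢
      rw [max_eq_left (hc.trans hq)]
      nlinarith
  have hlim : Tendsto (fun q : ℝ × ℝ => S.evol (max q.1 τ₀) τ₀ x) (𝓝 (t₀, τ₀))
      (𝓝 (S.evol t₀ τ₀ x)) := by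
    obtain ⟨v, vX, vT, hv, hvu⟩ := (S.isClassicalSolution_sol τ₀ φ).exists_isSol
    have e : ∀ s, τ₀ ≤ s → S.evol s τ₀ x = toL2 fun j y => v j y s := fun s hs => by
      rw [S.evol_testToL2 hs]
      exact toL2_congr ((S.isClassicalSolution_sol τ₀ φ).continuousOn_at_time hs)
        fun j y hy => (hvu j y hy s hs).symm
    have hc : Continuous fun q : ℝ × ℝ => S.evol (max q.1 τ₀) τ₀ x := by
      refine ((S.continuous_toL2_isSol hv).comp
        (by fun_prop : Continuous fun q : ℝ × ℝ => max q.1 τ₀)).congr fun q => ?_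
      exact (e _ (le_max_right _ _)).symm
    have := hc.tendsto (t₀, τ₀)
    simpa [h₀'] using this
  have hzero : Tendsto (fun q : ℝ × ℝ => S.evol q.1 q.2 x - S.evol (max q.1 τ₀) τ₀ x)
      (𝓝[{q | q.2 ≤ q.1}] (t₀, τ₀)) (𝓝 0) := by
    refine squeeze_zero_norm' (a := fun q : ℝ × ℝ =>
      (S.growth |q.1 - q.2| + S.growth |q.1 - τ₀| + 1) * h |q.2 - τ₀|) ?_ ?_
    · exact eventually_nhdsWithin_of_forall hmain
    · have hc : Continuous fun q : ℝ × ℝ =>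
          (S.growth |q.1 - q.2| + S.growth |q.1 - τ₀| + 1) * h |q.2 - τ₀| := by
        simp only [hh]; fun_prop
      have := hc.tendsto (t₀, τ₀)
      simp only [hh, sub_self, abs_zero, mul_zero, Real.sqrt_zero] at this
      exact this.mono_left nhdsWithin_le_nhds
  have := hzero.add (hlim.mono_left nhdsWithin_le_nhds)
  simpa [ContinuousWithinAt] using this

theorem isEvolutionFamily_evol : IsEvolutionFamily S.evol where
  refl := S.evol_self
  comp τ s t h h' := by ext1 x; exact S.evol_comp h h' x
  strongly_continuous := by
    intro x q₀ hq₀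
    refine continuousWithinAt_of_locally_uniform_approx_of_continuousWithinAt hq₀ fun V hV => ?_
    obtain ⟨e, he, heV⟩ := Metric.mem_uniformity_dist.1 hV
    have hpos : 0 < S.growth (q₀.1 - q₀.2 + 1) + 1 := by
      linarith [S.growth_nonneg (q₀.1 - q₀.2 + 1)]
    obtain ⟨φ, hφ⟩ := (denseRange_testToL2 n).exists_dist_lt x (div_pos he hpos)
    -- On this neighbourhood the time span, and hence the operator norm, is bounded, so
    -- approximation by a test function is uniform there.
    refine ⟨{q | q.1 - q.2 < q₀.1 - q₀.2 + 1} ∩ {q | q.2 ≤ q.1}, ?_, _,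
      S.continuousOn_evol_test φ q₀ hq₀, fun q hq => heV ?_⟩
    · refine inter_mem (mem_nhdsWithin_of_mem_nhds ?_) self_mem_nhdsWithin
      exact (isOpen_lt (by fun_prop) (by fun_prop)).mem_nhds
        (by simp)
    · rw [dist_eq_norm, ← map_sub]
      refine (S.norm_evol_le hq.2 _).trans_lt ?_
      rw [← dist_eq_norm]
      have h1 := S.growth_mono (le_of_lt hq.1)
      have h2 := (lt_div_iff₀ hpos).1 hφ
      have h3 := mul_le_mul_of_nonneg_right h1 (dist_nonneg (x := x) (y := testToL2 n φ))
      nlinarith [dist_nonneg (x := x) (y := testToL2 n φ)]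

/-- The boundary value problem generates an evolution family. -/
theorem isGeneratedBy_evol : IsGeneratedBy m S.a S.b S.p S.evol := by
  refine ⟨S.isEvolutionFamily_evol, fun τ φ => ⟨?_, fun φl hφl hlim => ?_⟩⟩
  · exact (S.isEvolutionFamily_evol.strongly_continuous φ).comp
      (f := fun t => (t, τ)) (by fun_prop) fun t ht => ht
  · refine ⟨fun l => S.sol τ ⟨φl l, hφl l⟩, fun l => S.isClassicalSolution_sol τ _, fun t ht => ?_⟩
    rw [Metric.tendstoUniformlyOn_iff]
    intro e he
    have hpos : 0 < S.growth (t - τ) + 1 := by linarith [S.growth_nonneg (t - τ)]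
    filter_upwards [Metric.tendsto_nhds.1 hlim _ (div_pos he hpos)] with l hl θ hθ
    have h1 := S.evol_testToL2 hθ.1 ⟨φl l, hφl l⟩
    rw [← h1, dist_eq_norm, ← map_sub]
    refine (S.norm_evol_le hθ.1 _).trans_lt ?_
    rw [← dist_eq_norm, dist_comm]
    have h2 := S.growth_mono (by linarith [hθ.2] : θ - τ ≤ t - τ)
    have h3 := (lt_div_iff₀ hpos).1 hl
    have h4 : dist (testToL2 n ⟨φl l, hφl l⟩) φ = dist (toL2 (φl l)) φ := rfl
    rw [h4]
    have h5 := mul_le_mul_of_nonneg_right h2 (dist_nonneg (x := toL2 (φl l)) (y := φ))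
    nlinarith [dist_nonneg (x := toL2 (φl l)) (y := φ)]

end Sys

/-! ### Bounded continuous functions of three variables -/

/-- Bounded continuous functions of three real variables. -/
structure BddCont3 (F : ℝ → ℝ → ℝ → ℝ) : Prop where
  cont : Continuous fun z : ℝ × ℝ × ℝ => F z.1 z.2.1 z.2.2
  bdd : ∃ K, ∀ ξ x t, |F ξ x t| ≤ K

namespace BddCont3

variable {F G : ℝ → ℝ → ℝ → ℝ}

theorem add (hF : BddCont3 F) (hG : BddCont3 G) : BddCont3 fun ξ x t => F ξ x t + G ξ x t := by
  obtain ⟨K, hK⟩ := hF.bdd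
  obtain ⟨K', hK'⟩ := hG.bdd
  exact ⟨hF.cont.add hG.cont, K + K', fun ξ x t =>
    (abs_add_le _ _).trans (add_le_add (hK ξ x t) (hK' ξ x t))⟩

theorem sub (hF : BddCont3 F) (hG : BddCont3 G) : BddCont3 fun ξ x t => F ξ x t - G ξ x t := by
  obtain ⟨K, hK⟩ := hF.bdd
  obtain ⟨K', hK'⟩ := hG.bdd
  exact ⟨hF.cont.sub hG.cont, K + K', fun ξ x t =>
    (abs_sub _ _).trans (add_le_add (hK ξ x t) (hK' ξ x t))⟩

theorem mul (hF : BddCont3 F) (hG : BddCont3 G) : BddCont3 fun ξ x t => F ξ x t * G ξ x t := by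
  obtain ⟨K, hK⟩ := hF.bdd
  obtain ⟨K', hK'⟩ := hG.bdd
  exact ⟨hF.cont.mul hG.cont, K * K', fun ξ x t => by
    rw [abs_mul]
    exact mul_le_mul (hK ξ x t) (hK' ξ x t) (abs_nonneg _) ((abs_nonneg _).trans (hK ξ x t))⟩

theorem continuous_comp (hF : BddCont3 F) {Z : Type*} [TopologicalSpace Z] {u v w : Z → ℝ}
    (hu : Continuous u) (hv : Continuous v) (hw : Continuous w) :
    Continuous fun z => F (u z) (v z) (w z) :=
  hF.cont.comp (hu.prodMk (hv.prodMk hw))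

theorem exists_common_bound {ι : Type*} [Fintype ι] {F : ι → ℝ → ℝ → ℝ → ℝ}
    (hF : ∀ i, BddCont3 (F i)) : ∃ K, 0 ≤ K ∧ ∀ i ξ x t, |F i ξ x t| ≤ K := by
  choose K hK using fun i => (hF i).bdd
  have h0 : ∀ i, 0 ≤ K i := fun i => (abs_nonneg _).trans (hK i 0 0 0)
  exact ⟨∑ i, K i, Finset.sum_nonneg fun i _ => h0 i, fun i ξ x t =>
    (hK i ξ x t).trans (Finset.single_le_sum (fun i _ => h0 i) (Finset.mem_univ i))⟩

end BddCont3

theorem abs_integral_le_integral_unit {g G : ℝ → ℝ} (hG : Continuous G)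
    (h : ∀ ξ, |g ξ| ≤ G ξ) {X Y : ℝ} (hX : X ∈ Icc (0 : ℝ) 1) (hY : Y ∈ Icc (0 : ℝ) 1) :
    |∫ ξ in X..Y, g ξ| ≤ ∫ ξ in (0 : ℝ)..1, G ξ := by
  have h0 : ∀ ξ, 0 ≤ G ξ := fun ξ => (abs_nonneg _).trans (h ξ)
  have hint : IntegrableOn G (Ioc 0 1) := by
    have := hG.intervalIntegrable (μ := volume) 0 1
    rwa [intervalIntegrable_iff_integrableOn_Ioc_of_le zero_le_one] at this
  have hsub : uIoc X Y ⊆ Ioc 0 1 := by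
    rw [uIoc]; exact Ioc_subset_Ioc (le_min hX.1 hY.1) (max_le hX.2 hY.2)
  rw [intervalIntegral.integral_of_le zero_le_one, ← Real.norm_eq_abs,
    intervalIntegral.norm_intervalIntegral_eq]
  refine (norm_integral_le_of_norm_le (hint.mono_set hsub) (Eventually.of_forall h)).trans ?_
  exact setIntegral_mono_set hint (Eventually.of_forall h0) (Eventually.of_forall hsub)

namespace Sys

variable (S : Sys n m)

theorem bddCont3_comp_W (j : Fin n) {G : ℝ → ℝ → ℝ} {K : ℝ}
    (hG : Continuous fun z : ℝ × ℝ => G z.1 z.2) (hK : ∀ x t, |G x t| ≤ K) :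
    BddCont3 fun ξ x t => G ξ (S.W j ξ x t) :=
  ⟨Continuous.comp₂' hG continuous_fst (by fun_prop), K, fun _ _ _ => hK _ _⟩

theorem bddCont3_WT (j : Fin n) : BddCont3 (S.WT j) :=
  ⟨by fun_prop, Real.exp S.L, fun ξ x t => by
    rw [abs_of_pos (S.WT_pos j ξ x t)]; exact S.WT_le j ξ x t⟩

theorem bddCont3_integral {G : ℝ → ℝ → ℝ → ℝ} (hG : BddCont3 G) :
    BddCont3 fun ξ x t => ∫ η in (pj x)..(pj ξ), G η x t := by
  obtain ⟨K, hK⟩ := hG.bdd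
  have hK0 : 0 ≤ K := (abs_nonneg _).trans (hK 0 0 0)
  refine ⟨continuous_integral_param (hG.continuous_comp (by fun_prop) (by fun_prop) (by fun_prop))
    (by fun_prop) (by fun_prop), K, fun ξ x t => ?_⟩
  exact (abs_integral_le_mul (fun η => hK η x t) _ _).trans
    (mul_le_of_le_one_right hK0 (abs_pj_sub_le_one _ _))

/-! ### The integrating factor along the characteristics -/

/-- The integrating factor along the characteristics. -/
def c (j : Fin n) (ξ x t : ℝ) : ℝ :=
  Real.exp (∫ η in (pj x)..(pj ξ), S.q j j η (S.W j η x t))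

/-- The time derivative of the integrating factor. -/
def cT (j : Fin n) (ξ x t : ℝ) : ℝ :=
  S.c j ξ x t * ∫ η in (pj x)..(pj ξ), S.qT j j η (S.W j η x t) * S.WT j η x t

theorem bddCont3_c (j : Fin n) : BddCont3 (S.c j) := by
  have h := bddCont3_integral (S.bddCont3_comp_W j (S.continuous_q j j) (S.abs_q_le j j))
  obtain ⟨K, hK⟩ := h.bdd
  exact ⟨Real.continuous_exp.comp h.cont, Real.exp K, fun ξ x t => by
    rw [c, abs_of_pos (Real.exp_pos _)]
    exact Real.exp_le_exp.2 ((le_abs_self _).trans (hK ξ x t))⟩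

theorem bddCont3_cT (j : Fin n) : BddCont3 (S.cT j) :=
  (S.bddCont3_c j).mul (bddCont3_integral
    ((S.bddCont3_comp_W j (S.continuous_qT j j) (S.abs_qT_le j j)).mul (S.bddCont3_WT j)))

@[simp] theorem c_self (j : Fin n) (x t : ℝ) : S.c j x x t = 1 := by simp [c]

theorem hasDerivWithinAt_c (j : Fin n) {ξ : ℝ} (hξ : ξ ∈ Icc (0 : ℝ) 1) (x t : ℝ) :
    HasDerivWithinAt (fun y => S.c j y x t) (S.q j j ξ (S.W j ξ x t) * S.c j ξ x t) (Icc 0 1) ξ := by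
  have h := (hasDerivWithinAt_integral_Icc (g := fun η => S.q j j η (S.W j η x t))
    (by fun_prop) (pj x) ξ (Icc 0 1)).exp
  refine (h.congr (fun y hy => by simp only [c, pj_of_mem hy])
    (by simp only [c, pj_of_mem hξ])).congr_deriv ?_
  simp only [c, pj_of_mem hξ]; ring

theorem hasDerivAt_c (j : Fin n) (ξ x t : ℝ) :
    HasDerivAt (fun s => S.c j ξ x s) (S.cT j ξ x t) t := by
  refine (hasDerivAt_integral_param (k := fun η s => S.q j j η (S.W j η x s))
    (kt := fun η s => S.qT j j η (S.W j η x s) * S.WT j η x s) (pj x) (pj ξ) t (by fun_prop)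
    (by fun_prop) fun η s => ?_).exp
  exact (S.hasDerivAt_q j j η _).comp s (S.hasDerivAt_W j η x s)

theorem c_eq_cCoef (j : Fin n) {ξ x : ℝ} (hξ : ξ ∈ Icc (0 : ℝ) 1) (hx : x ∈ Icc (0 : ℝ) 1) (t : ℝ) :
    S.c j ξ x t = cCoef S.a S.b j ξ x t := by
  rw [c, cCoef, pj_of_mem hξ, pj_of_mem hx]
  congr 1
  refine intervalIntegral.integral_congr fun η hη => ?_
  have hη' : η ∈ Icc (0 : ℝ) 1 := uIcc_subset_Icc hx hξ hη
  simp only [q, f, S.W_eq_omega j hη' hx]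
  ring

/-! ### The off-diagonal coefficients -/

/-- The quotient of the coefficient `q j i` by the difference of the reciprocal speeds. -/
def γ (j i : Fin n) (x t : ℝ) : ℝ := S.β j i x t * S.a i x t

/-- The space derivative of `γ`. -/
def γX (j i : Fin n) (x t : ℝ) : ℝ := S.βX j i x t * S.a i x t + S.β j i x t * S.aX i x t

/-- The time derivative of `γ`. -/
def γT (j i : Fin n) (x t : ℝ) : ℝ := S.βT j i x t * S.a i x t + S.β j i x t * S.aT i x t

/-- The off-diagonal part of the coefficients `q`. -/
def qo (j i : Fin n) (x t : ℝ) : ℝ := S.γ j i x t * (S.f j x t - S.f i x t)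

/-- The time derivative of `qo`. -/
def qoT (j i : Fin n) (x t : ℝ) : ℝ :=
  S.γT j i x t * (S.f j x t - S.f i x t) + S.γ j i x t * (S.fT j x t - S.fT i x t)

/-- Dividing `β (a_i - a_j)` by `a_j` gives `β a_i (1/a_j - 1/a_i)`. This is the only point at which
the condition on the off-diagonal coefficients enters the estimates. -/
theorem qo_eq_q {j i : Fin n} (h : j ≠ i) (x t : ℝ) : S.qo j i x t = S.q j i x t := by
  rw [qo, q, γ, f, f, S.levy j i h]
  have := S.a_ne i x t
  have := S.a_ne j x t
  field_simp

@[simp] theorem qo_self (j : Fin n) (x t : ℝ) : S.qo j j x t = 0 := by simp [qo]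

/-- The diagonal term is absorbed by the integrating factor `c`; only the terms with the factor
`1/a_j - 1/a_i` stay under the integral. -/
theorem sum_q_eq (j : Fin n) (x t : ℝ) (w : Fin n → ℝ) :
    ∑ i, S.q j i x t * w i = S.q j j x t * w j + ∑ i, S.qo j i x t * w i := by
  rw [← sub_eq_iff_eq_add, ← Finset.sum_sub_distrib, Finset.sum_eq_single j]
  · simp
  · intro i _ hi
    rw [S.qo_eq_q (Ne.symm hi)]; ring
  · simp

theorem hasDerivAt_γ (j i : Fin n) (x t : ℝ) :
    HasDerivAt (fun s => S.γ j i x s) (S.γT j i x t) t :=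
  ((S.hβ j i).deriv_t x t).mul ((S.ha i).deriv_t x t)

theorem hasDerivWithinAt_γ (j i : Fin n) {x : ℝ} (hx : x ∈ Icc (0 : ℝ) 1) (t : ℝ) :
    HasDerivWithinAt (fun y => S.γ j i y t) (S.γX j i x t) (Icc 0 1) x :=
  ((S.hβ j i).deriv_x x hx t).mul ((S.ha i).deriv_x x hx t)

theorem hasDerivAt_qo (j i : Fin n) (x t : ℝ) :
    HasDerivAt (fun s => S.qo j i x s) (S.qoT j i x t) t :=
  (S.hasDerivAt_γ j i x t).mul ((S.hasDerivAt_f j x t).sub (S.hasDerivAt_f i x t))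

section comp_W

variable (l j i : Fin n)

theorem bddCont3_a : BddCont3 fun ξ x t => S.a i ξ (S.W l ξ x t) :=
  S.bddCont3_comp_W l (S.ha i).cont (S.ha i).bound

theorem bddCont3_β : BddCont3 fun ξ x t => S.β j i ξ (S.W l ξ x t) :=
  S.bddCont3_comp_W l (S.hβ j i).cont (S.hβ j i).bound

theorem bddCont3_f : BddCont3 fun ξ x t => S.f i ξ (S.W l ξ x t) :=
  S.bddCont3_comp_W l (S.continuous_f i) (S.abs_f_le i)

theorem bddCont3_fT : BddCont3 fun ξ x t => S.fT i ξ (S.W l ξ x t) :=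
  S.bddCont3_comp_W l (S.continuous_fT i) (S.abs_fT_le i)

theorem bddCont3_q : BddCont3 fun ξ x t => S.q j i ξ (S.W l ξ x t) :=
  S.bddCont3_comp_W l (S.continuous_q j i) (S.abs_q_le j i)

theorem bddCont3_γ : BddCont3 fun ξ x t => S.γ j i ξ (S.W l ξ x t) :=
  (S.bddCont3_β l j i).mul (S.bddCont3_a l i)

theorem bddCont3_γX : BddCont3 fun ξ x t => S.γX j i ξ (S.W l ξ x t) :=
  ((S.bddCont3_comp_W l (S.hβ j i).cont_x (S.hβ j i).bound_x).mul (S.bddCont3_a l i)).add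
    ((S.bddCont3_β l j i).mul (S.bddCont3_comp_W l (S.ha i).cont_x (S.ha i).bound_x))

theorem bddCont3_γT : BddCont3 fun ξ x t => S.γT j i ξ (S.W l ξ x t) :=
  ((S.bddCont3_comp_W l (S.hβ j i).cont_t (S.hβ j i).bound_t).mul (S.bddCont3_a l i)).add
    ((S.bddCont3_β l j i).mul (S.bddCont3_comp_W l (S.ha i).cont_t (S.ha i).bound_t))

theorem bddCont3_qo : BddCont3 fun ξ x t => S.qo j i ξ (S.W l ξ x t) :=
  (S.bddCont3_γ l j i).mul ((S.bddCont3_f l j).sub (S.bddCont3_f l i))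

theorem bddCont3_qoT : BddCont3 fun ξ x t => S.qoT j i ξ (S.W l ξ x t) :=
  ((S.bddCont3_γT l j i).mul ((S.bddCont3_f l j).sub (S.bddCont3_f l i))).add
    ((S.bddCont3_γ l j i).mul ((S.bddCont3_fT l j).sub (S.bddCont3_fT l i)))

end comp_W

/-- The kernel of the integral operator in the representation of solutions. -/
def kerA (j i : Fin n) (ξ x t : ℝ) : ℝ := S.c j ξ x t * S.qo j i ξ (S.W j ξ x t)

/-- The time derivative of `kerA`. -/
def kerAT (j i : Fin n) (ξ x t : ℝ) : ℝ :=
  S.cT j ξ x t * S.qo j i ξ (S.W j ξ x t) +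
    S.c j ξ x t * (S.qoT j i ξ (S.W j ξ x t) * S.WT j ξ x t)

/-- The weight with which solutions are integrated by parts along characteristics. -/
def kerG (j i : Fin n) (ξ x t : ℝ) : ℝ :=
  S.c j ξ x t * S.WT j ξ x t * S.γ j i ξ (S.W j ξ x t)

/-- The space derivative of `kerG`. -/
def kerGX (j i : Fin n) (ξ x t : ℝ) : ℝ :=
  (S.q j j ξ (S.W j ξ x t) * S.c j ξ x t * S.WT j ξ x t +
    S.c j ξ x t * (S.fT j ξ (S.W j ξ x t) * S.WT j ξ x t)) * S.γ j i ξ (S.W j ξ x t) +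
  S.c j ξ x t * S.WT j ξ x t *
    (S.γX j i ξ (S.W j ξ x t) + S.γT j i ξ (S.W j ξ x t) * S.f j ξ (S.W j ξ x t))

theorem bddCont3_kerA (j i : Fin n) : BddCont3 (S.kerA j i) :=
  (S.bddCont3_c j).mul (S.bddCont3_qo j j i)

theorem bddCont3_kerAT (j i : Fin n) : BddCont3 (S.kerAT j i) :=
  ((S.bddCont3_cT j).mul (S.bddCont3_qo j j i)).add
    ((S.bddCont3_c j).mul ((S.bddCont3_qoT j j i).mul (S.bddCont3_WT j)))

theorem bddCont3_kerG (j i : Fin n) : BddCont3 (S.kerG j i) :=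
  ((S.bddCont3_c j).mul (S.bddCont3_WT j)).mul (S.bddCont3_γ j j i)

theorem bddCont3_kerGX (j i : Fin n) : BddCont3 (S.kerGX j i) :=
  (((((S.bddCont3_q j j j).mul (S.bddCont3_c j)).mul (S.bddCont3_WT j)).add
    ((S.bddCont3_c j).mul ((S.bddCont3_fT j j).mul (S.bddCont3_WT j)))).mul
      (S.bddCont3_γ j j i)).add
  (((S.bddCont3_c j).mul (S.bddCont3_WT j)).mul
    ((S.bddCont3_γX j j i).add ((S.bddCont3_γT j j i).mul (S.bddCont3_f j j))))

theorem hasDerivWithinAt_kerG (j i : Fin n) {ξ : ℝ} (hξ : ξ ∈ Icc (0 : ℝ) 1) (x t : ℝ) :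
    HasDerivWithinAt (fun y => S.kerG j i y x t) (S.kerGX j i ξ x t) (Icc 0 1) ξ := by
  have hγT : Continuous fun z : ℝ × ℝ => S.γT j i z.1 z.2 :=
    ((S.hβ j i).cont_t.mul (S.ha i).cont).add ((S.hβ j i).cont.mul (S.ha i).cont_t)
  exact ((S.hasDerivWithinAt_c j hξ x t).mul (S.hasDerivWithinAt_WT j hξ x t)).mul
    (hasDerivWithinAt_along hγT (S.hasDerivAt_γ j i) (S.hasDerivWithinAt_W j hξ x t)
      (S.hasDerivWithinAt_γ j i hξ _))

theorem hasDerivAt_kerA (j i : Fin n) (ξ x t : ℝ) :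
    HasDerivAt (fun s => S.kerA j i ξ x s) (S.kerAT j i ξ x t) t :=
  (S.hasDerivAt_c j ξ x t).mul ((S.hasDerivAt_qo j i ξ _).comp t (S.hasDerivAt_W j ξ x t))

/-! ### Solutions along the characteristics -/

/-- The boundary-to-interior operator applied to the boundary values of `w`. -/
def opCP (w : Fin n → ℝ → ℝ → ℝ) (j : Fin n) (x t : ℝ) : ℝ :=
  S.c j (xIn m j) x t * opP m S.p w j (S.W j (xIn m j) x t)

/-- The time derivative of `opCP w`, where `z` is the time derivative of `w`. -/
def opCPT (w z : Fin n → ℝ → ℝ → ℝ) (j : Fin n) (x t : ℝ) : ℝ :=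
  S.cT j (xIn m j) x t * opP m S.p w j (S.W j (xIn m j) x t) +
    S.c j (xIn m j) x t * (opP m S.p z j (S.W j (xIn m j) x t) * S.WT j (xIn m j) x t)

variable {S} {τ : ℝ} {u uX uT : Fin n → ℝ → ℝ → ℝ}

/-- The chain rule along the `j`-th characteristic gives `uX + f_j uT`, and the equation of the
`i`-th component replaces `uX` by `-f_i uT` plus terms without derivatives. The factor `f_j - f_i`
obtained here is the one contained in `qo`. -/
theorem hasDerivWithinAt_along_W (h : S.IsSol τ (fun _ _ _ => 0) u uX uT) (j i : Fin n) {ξ : ℝ}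
    (hξ : ξ ∈ Icc (0 : ℝ) 1) {x t : ℝ} (hW : τ ≤ S.W j ξ x t) :
    HasDerivWithinAt (fun y => u i y (S.W j y x t))
      ((S.f j ξ (S.W j ξ x t) - S.f i ξ (S.W j ξ x t)) * uT i ξ (S.W j ξ x t) -
        ∑ k, S.q i k ξ (S.W j ξ x t) * u k ξ (S.W j ξ x t)) (Icc 0 1) ξ := by
  refine (hasDerivWithinAt_along (h.cont_t i) (h.deriv_t i) (S.hasDerivWithinAt_W j hξ x t)
    (h.deriv_x i ξ hξ _ hW)).congr_deriv ?_
  have hp := h.pde i ξ hξ _ hW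
  have ha := S.a_ne i ξ (S.W j ξ x t)
  simp only [q, mul_assoc, ← Finset.mul_sum]
  have hf : S.f i ξ (S.W j ξ x t) * S.a i ξ (S.W j ξ x t) = 1 := by
    rw [f, one_div, inv_mul_cancel₀ ha]
  linear_combination S.f i ξ (S.W j ξ x t) * hp - uX i ξ (S.W j ξ x t) * hf

theorem le_W_of_add_δ_le {x t : ℝ} (ht : τ + S.δ ≤ t) (j : Fin n) (ξ : ℝ) : τ ≤ S.W j ξ x t := by
  linarith [(abs_le.1 (S.abs_W_sub_le j ξ x t)).1]

theorem IsSol.continuous_along (h : S.IsSol τ (fun _ _ _ => 0) u uX uT) (j i : Fin n) (x t : ℝ) :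
    Continuous fun ξ => u i ξ (S.W j ξ x t) :=
  Continuous.comp₂' (h.cont i) continuous_id (by fun_prop)

theorem IsSol.continuous_along_t (h : S.IsSol τ (fun _ _ _ => 0) u uX uT) (j i : Fin n) (x t : ℝ) :
    Continuous fun ξ => uT i ξ (S.W j ξ x t) :=
  Continuous.comp₂' (h.cont_t i) continuous_id (by fun_prop)

/-- The representation of solutions by integration along the characteristics. -/
theorem sub_opCP_eq (h : S.IsSol τ (fun _ _ _ => 0) u uX uT) (j : Fin n) {x t : ℝ}
    (hx : x ∈ Icc (0 : ℝ) 1) (ht : τ + S.δ ≤ t) :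
    u j x t - S.opCP u j x t =
      -∫ ξ in (xIn m j)..x, ∑ i, S.kerA j i ξ x t * u i ξ (S.W j ξ x t) := by
  have h1 : ∀ ξ ∈ Icc (0 : ℝ) 1, HasDerivWithinAt (fun y => S.c j y x t * u j y (S.W j y x t))
      (-∑ i, S.kerA j i ξ x t * u i ξ (S.W j ξ x t)) (Icc 0 1) ξ := by
    intro ξ hξ
    refine ((S.hasDerivWithinAt_c j hξ x t).mul
      (hasDerivWithinAt_along_W h j j hξ (le_W_of_add_δ_le ht j ξ))).congr_deriv ?_
    rw [sum_q_eq]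
    simp only [kerA, mul_assoc, ← Finset.mul_sum]
    ring
  have hc : Continuous fun ξ => -∑ i, S.kerA j i ξ x t * u i ξ (S.W j ξ x t) :=
    (continuous_finsetSum _ fun i _ => ((S.bddCont3_kerA j i).continuous_comp continuous_id
      continuous_const continuous_const).mul (h.continuous_along j i x t)).neg
  have h2 := integral_eq_sub_of_hasDerivWithinAt_Icc (xIn_mem (m := m) j) hx hc h1
  rw [intervalIntegral.integral_neg] at h2
  simp only [c_self, W_self, one_mul] at h2
  rw [h2, opCP, h.bc j _ (le_W_of_add_δ_le ht j _)]

/-- The product `kerA * WT` equals `kerG * (f_j - f_i)`, so the term with `uT` is `kerG` times the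
derivative of `u_i` along the characteristic, up to terms without derivatives. Integrating by parts
moves the derivative onto `kerG`, which is differentiable along the characteristic because `β` and
the speeds are `C¹`. -/
theorem integral_by_parts_along (h : S.IsSol τ (fun _ _ _ => 0) u uX uT) (j i : Fin n) {x t : ℝ}
    (hx : x ∈ Icc (0 : ℝ) 1) (ht : τ + S.δ ≤ t) :
    ∫ ξ in (xIn m j)..x, (S.kerAT j i ξ x t * u i ξ (S.W j ξ x t) +
        S.kerA j i ξ x t * (uT i ξ (S.W j ξ x t) * S.WT j ξ x t)) =
      (S.kerG j i x x t * u i x t - S.kerG j i (xIn m j) x t * u i (xIn m j) (S.W j (xIn m j) x t)) +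
      ∫ ξ in (xIn m j)..x, ((S.kerAT j i ξ x t - S.kerGX j i ξ x t) * u i ξ (S.W j ξ x t) +
        ∑ k, S.kerG j i ξ x t * S.q i k ξ (S.W j ξ x t) * u k ξ (S.W j ξ x t)) := by
  have hcu := fun i => h.continuous_along j i x t
  have hcut := h.continuous_along_t j i x t
  have hG : Continuous fun ξ => S.kerG j i ξ x t :=
    (S.bddCont3_kerG j i).continuous_comp continuous_id continuous_const continuous_const
  have hGX : Continuous fun ξ => S.kerGX j i ξ x t :=
    (S.bddCont3_kerGX j i).continuous_comp continuous_id continuous_const continuous_const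
  have hAT : Continuous fun ξ => S.kerAT j i ξ x t :=
    (S.bddCont3_kerAT j i).continuous_comp continuous_id continuous_const continuous_const
  have hq : ∀ k, Continuous fun ξ => S.q i k ξ (S.W j ξ x t) := fun k => by fun_prop
  have hf : ∀ k, Continuous fun ξ => S.f k ξ (S.W j ξ x t) := fun k => by fun_prop
  have hc1 : Continuous fun ξ => S.kerGX j i ξ x t * u i ξ (S.W j ξ x t) +
      S.kerG j i ξ x t * ((S.f j ξ (S.W j ξ x t) - S.f i ξ (S.W j ξ x t)) * uT i ξ (S.W j ξ x t) -
        ∑ k, S.q i k ξ (S.W j ξ x t) * u k ξ (S.W j ξ x t)) :=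
    (hGX.mul (hcu i)).add (hG.mul ((((hf j).sub (hf i)).mul hcut).sub
      (continuous_finsetSum _ fun k _ => (hq k).mul (hcu k))))
  have hc2 : Continuous fun ξ => (S.kerAT j i ξ x t - S.kerGX j i ξ x t) * u i ξ (S.W j ξ x t) +
        ∑ k, S.kerG j i ξ x t * S.q i k ξ (S.W j ξ x t) * u k ξ (S.W j ξ x t) :=
    ((hAT.sub hGX).mul (hcu i)).add (continuous_finsetSum _ fun k _ => (hG.mul (hq k)).mul (hcu k))
  have h1 := integral_eq_sub_of_hasDerivWithinAt_Icc (xIn_mem (m := m) j) hx hc1 fun ξ hξ =>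
    (S.hasDerivWithinAt_kerG j i hξ x t).mul
      (hasDerivWithinAt_along_W h j i hξ (le_W_of_add_δ_le ht j ξ))
  simp only [Pi.mul_apply, W_self] at h1
  rw [← h1, ← intervalIntegral.integral_add (hc1.intervalIntegrable _ _)
    (hc2.intervalIntegrable _ _)]
  refine intervalIntegral.integral_congr fun ξ _ => ?_
  simp only [kerA, kerG, qo, mul_assoc, ← Finset.mul_sum]
  ring

theorem hasDerivAt_opCP {w z : Fin n → ℝ → ℝ → ℝ}
    (h : ∀ j x t, HasDerivAt (fun s => w j x s) (z j x t) t) (j : Fin n) (x t : ℝ) :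
    HasDerivAt (fun s => S.opCP w j x s) (S.opCPT w z j x t) t :=
  (S.hasDerivAt_c j _ x t).mul
    ((hasDerivAt_opP (m := m) h S.p j _).comp t (S.hasDerivAt_W j (xIn m j) x t))

theorem hasDerivAt_integral_kerA (h : S.IsSol τ (fun _ _ _ => 0) u uX uT) (j i : Fin n) (x t : ℝ) :
    HasDerivAt (fun s => ∫ ξ in (xIn m j)..x, S.kerA j i ξ x s * u i ξ (S.W j ξ x s))
      (∫ ξ in (xIn m j)..x, (S.kerAT j i ξ x t * u i ξ (S.W j ξ x t) +
        S.kerA j i ξ x t * (uT i ξ (S.W j ξ x t) * S.WT j ξ x t))) t := by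
  have hcu : Continuous fun z : ℝ × ℝ => u i z.1 (S.W j z.1 x z.2) :=
    Continuous.comp₂' (h.cont i) continuous_fst (by fun_prop)
  have hcut : Continuous fun z : ℝ × ℝ => uT i z.1 (S.W j z.1 x z.2) :=
    Continuous.comp₂' (h.cont_t i) continuous_fst (by fun_prop)
  have hA : Continuous fun z : ℝ × ℝ => S.kerA j i z.1 x z.2 :=
    (S.bddCont3_kerA j i).continuous_comp continuous_fst continuous_const continuous_snd
  have hAT : Continuous fun z : ℝ × ℝ => S.kerAT j i z.1 x z.2 :=
    (S.bddCont3_kerAT j i).continuous_comp continuous_fst continuous_const continuous_snd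
  have hWT : Continuous fun z : ℝ × ℝ => S.WT j z.1 x z.2 := by fun_prop
  refine hasDerivAt_integral_param
    (k := fun ξ s => S.kerA j i ξ x s * u i ξ (S.W j ξ x s))
    (kt := fun ξ s => S.kerAT j i ξ x s * u i ξ (S.W j ξ x s) +
      S.kerA j i ξ x s * (uT i ξ (S.W j ξ x s) * S.WT j ξ x s)) _ _ t
    (hA.mul hcu) ((hAT.mul hcu).add (hA.mul (hcut.mul hWT))) fun ξ s => ?_
  exact (S.hasDerivAt_kerA j i ξ x s).mul ((h.deriv_t i ξ _).comp s (S.hasDerivAt_W j ξ x s))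

/-- The time derivative of the representation of solutions; it does not involve derivatives of the
solution. -/
theorem sub_opCPT_eq (h : S.IsSol τ (fun _ _ _ => 0) u uX uT) (j : Fin n) {x t : ℝ}
    (hx : x ∈ Icc (0 : ℝ) 1) (ht : τ + S.δ < t) :
    uT j x t - S.opCPT u uT j x t = -∑ i,
      ((S.kerG j i x x t * u i x t - S.kerG j i (xIn m j) x t * u i (xIn m j) (S.W j (xIn m j) x t)) +
      ∫ ξ in (xIn m j)..x, ((S.kerAT j i ξ x t - S.kerGX j i ξ x t) * u i ξ (S.W j ξ x t) +
        ∑ k, S.kerG j i ξ x t * S.q i k ξ (S.W j ξ x t) * u k ξ (S.W j ξ x t))) := by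
  have h1 : HasDerivAt (fun s => u j x s - S.opCP u j x s) (uT j x t - S.opCPT u uT j x t) t :=
    (h.deriv_t j x t).fun_sub (hasDerivAt_opCP (S := S) h.deriv_t j x t)
  have h2 := (HasDerivAt.fun_sum (u := Finset.univ) fun i _ =>
    hasDerivAt_integral_kerA h j i x t).fun_neg
  have hc : ∀ s i, Continuous fun ξ => S.kerA j i ξ x s * u i ξ (S.W j ξ x s) := fun s i =>
    ((S.bddCont3_kerA j i).continuous_comp continuous_id
      continuous_const continuous_const).mul (h.continuous_along j i x s)
  -- The representation holds once characteristics stay above `τ`. The strict inequality on `t`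
  -- supplies a whole neighbourhood of times, so it can be differentiated.
  have h3 := h2.congr_of_eventuallyEq (f₁ := fun s => u j x s - S.opCP u j x s) (by
    filter_upwards [Ioi_mem_nhds ht] with s hs
    rw [sub_opCP_eq h j hx (le_of_lt hs), intervalIntegral.integral_finsetSum fun i _ =>
      (hc s i).intervalIntegrable _ _])
  rw [h1.unique h3]
  congr 1
  exact Finset.sum_congr rfl fun i _ => integral_by_parts_along h j i hx ht.le

end Sys

theorem apply_xIn_le {e : ℝ → ℝ → ℝ} (he : ∀ x t, 0 ≤ e x t) (j : Fin n) (s : ℝ) :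
    e (xIn m j) s ≤ e 0 s + e 1 s := by
  have := he 0 s; have := he 1 s
  unfold xIn; split_ifs <;> linarith

theorem apply_xOut_le {e : ℝ → ℝ → ℝ} (he : ∀ x t, 0 ≤ e x t) (j : Fin n) (s : ℝ) :
    e (xOut m j) s ≤ e 0 s + e 1 s := by
  have := he 0 s; have := he 1 s
  unfold xOut; split_ifs <;> linarith

/-- The sum of the moduli of the components. -/
def absSum (u : Fin n → ℝ → ℝ → ℝ) (x t : ℝ) : ℝ := ∑ k, |u k x t|

theorem absSum_nonneg (u : Fin n → ℝ → ℝ → ℝ) (x t : ℝ) : 0 ≤ absSum u x t :=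
  Finset.sum_nonneg fun _ _ => abs_nonneg _

theorem abs_le_absSum (u : Fin n → ℝ → ℝ → ℝ) (k : Fin n) (x t : ℝ) : |u k x t| ≤ absSum u x t :=
  Finset.single_le_sum (f := fun k => |u k x t|) (fun _ _ => abs_nonneg _) (Finset.mem_univ k)

theorem continuous_absSum {u : Fin n → ℝ → ℝ → ℝ} (hu : ∀ j, Continuous fun z : ℝ × ℝ => u j z.1 z.2) :
    Continuous fun z : ℝ × ℝ => absSum u z.1 z.2 :=
  continuous_finsetSum _ fun k _ => (hu k).abs

theorem abs_sum_mul_le {c : Fin n → ℝ} {K : ℝ} (hc : ∀ i, |c i| ≤ K) (u : Fin n → ℝ → ℝ → ℝ)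
    (x t : ℝ) : |∑ i, c i * u i x t| ≤ K * absSum u x t := by
  rw [absSum, Finset.mul_sum]
  refine (Finset.abs_sum_le_sum_abs _ _).trans (Finset.sum_le_sum fun i _ => ?_)
  rw [abs_mul]
  exact mul_le_mul_of_nonneg_right (hc i) (abs_nonneg _)

namespace Sys

variable (S : Sys n m)

/-! ### The majorant operator -/

/-- The sum of the values of `e` at the points, and of its integrals over the lines, on which the
time derivative of the representation of a solution at `(x, t)` depends. -/
def maj (e : ℝ → ℝ → ℝ) (x t : ℝ) : ℝ :=
  e x t + ∑ j, (e 0 (S.W j (xIn m j) x t) + e 1 (S.W j (xIn m j) x t)) +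
    ∑ j, ∫ ξ in (0 : ℝ)..1, e ξ (S.W j ξ x t)

variable {e : ℝ → ℝ → ℝ}

theorem integral_along_nonneg (he : ∀ x t, 0 ≤ e x t) (j : Fin n) (x t : ℝ) :
    0 ≤ ∫ ξ in (0 : ℝ)..1, e ξ (S.W j ξ x t) :=
  intervalIntegral.integral_nonneg zero_le_one fun _ _ => he _ _

theorem terms_le_maj (he : ∀ x t, 0 ≤ e x t) (j : Fin n) (x t : ℝ) :
    e x t + (e 0 (S.W j (xIn m j) x t) + e 1 (S.W j (xIn m j) x t)) +
      ∫ ξ in (0 : ℝ)..1, e ξ (S.W j ξ x t) ≤ S.maj e x t := by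
  have h1 := Finset.single_le_sum (f := fun j =>
    e 0 (S.W j (xIn m j) x t) + e 1 (S.W j (xIn m j) x t))
    (fun j _ => add_nonneg (he _ _) (he _ _)) (Finset.mem_univ j)
  have h2 := Finset.single_le_sum (f := fun j => ∫ ξ in (0 : ℝ)..1, e ξ (S.W j ξ x t))
    (fun j _ => S.integral_along_nonneg he j x t) (Finset.mem_univ j)
  unfold maj; linarith

theorem le_maj (he : ∀ x t, 0 ≤ e x t) (x t : ℝ) : e x t ≤ S.maj e x t := by
  have h1 : 0 ≤ ∑ j, (e 0 (S.W j (xIn m j) x t) + e 1 (S.W j (xIn m j) x t)) :=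
    Finset.sum_nonneg fun j _ => add_nonneg (he _ _) (he _ _)
  have h2 : 0 ≤ ∑ j, ∫ ξ in (0 : ℝ)..1, e ξ (S.W j ξ x t) :=
    Finset.sum_nonneg fun j _ => S.integral_along_nonneg he j x t
  unfold maj; linarith

theorem continuous_along_total (hc : Continuous fun z : ℝ × ℝ => e z.1 z.2) (j : Fin n) :
    Continuous fun z : ℝ × ℝ => ∫ ξ in (0 : ℝ)..1, e ξ (S.W j ξ z.1 z.2) :=
  continuous_integral_param (F := fun (z : ℝ × ℝ) ξ => e ξ (S.W j ξ z.1 z.2))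
    (Continuous.comp₂' hc (by fun_prop) (by fun_prop)) continuous_const continuous_const

theorem continuous_maj (hc : Continuous fun z : ℝ × ℝ => e z.1 z.2) :
    Continuous fun z : ℝ × ℝ => S.maj e z.1 z.2 := by
  refine (hc.add (continuous_finsetSum _ fun j _ => ?_)).add
    (continuous_finsetSum _ fun j _ => S.continuous_along_total hc j)
  exact (Continuous.comp₂' hc continuous_const (by fun_prop)).add
    (Continuous.comp₂' hc continuous_const (by fun_prop))

theorem maj_iterate_nonneg (he : ∀ x t, 0 ≤ e x t) (i : ℕ) : ∀ x t, 0 ≤ S.maj^[i] e x t := by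
  induction i with
  | zero => exact he
  | succ i ih =>
    intro x t
    rw [Function.iterate_succ_apply']
    exact (ih x t).trans (S.le_maj ih x t)

theorem continuous_maj_iterate (hc : Continuous fun z : ℝ × ℝ => e z.1 z.2) (i : ℕ) :
    Continuous fun z : ℝ × ℝ => S.maj^[i] e z.1 z.2 := by
  induction i with
  | zero => exact hc
  | succ i ih => simp only [Function.iterate_succ_apply']; exact S.continuous_maj ih

theorem maj_iterate_mono (he : ∀ x t, 0 ≤ e x t) (x t : ℝ) :
    Monotone fun i => S.maj^[i] e x t := by
  refine monotone_nat_of_le_succ fun i => ?_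
  simp only [Function.iterate_succ_apply']
  exact S.le_maj (S.maj_iterate_nonneg he i) x t

/-! ### Pointwise bounds for the time derivative -/

/-- The right-hand sides of `sub_opCP_eq` and `sub_opCPT_eq` contain no derivatives of `u`, and
their kernels are bounded on the whole plane. So `K` depends on neither the initial time nor the
solution. -/
theorem exists_sub_opCP_bound : ∃ K, 0 ≤ K ∧ ∀ (τ : ℝ) (u uX uT : Fin n → ℝ → ℝ → ℝ),
    S.IsSol τ (fun _ _ _ => 0) u uX uT → ∀ j, ∀ x ∈ Icc (0 : ℝ) 1, ∀ t, τ + S.δ < t →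
      |u j x t - S.opCP u j x t| + |uT j x t - S.opCPT u uT j x t| ≤ K * S.maj (absSum u) x t := by
  obtain ⟨K₁, h₁, hA⟩ := BddCont3.exists_common_bound (ι := Fin n × Fin n)
    (F := fun i => S.kerA i.1 i.2) fun i => S.bddCont3_kerA i.1 i.2
  obtain ⟨K₂, h₂, hG⟩ := BddCont3.exists_common_bound (ι := Fin n × Fin n)
    (F := fun i => S.kerG i.1 i.2) fun i => S.bddCont3_kerG i.1 i.2
  obtain ⟨K₃, h₃, hH⟩ := BddCont3.exists_common_bound (ι := Fin n × Fin n)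
    (F := fun i ξ x t => S.kerAT i.1 i.2 ξ x t - S.kerGX i.1 i.2 ξ x t)
    fun i => (S.bddCont3_kerAT i.1 i.2).sub (S.bddCont3_kerGX i.1 i.2)
  obtain ⟨K₄, h₄, hq⟩ := BddCont3.exists_common_bound (ι := Fin n × Fin n × Fin n)
    (F := fun i ξ x t => S.kerG i.1 i.2.1 ξ x t * S.q i.2.1 i.2.2 ξ (S.W i.1 ξ x t))
    fun i => (S.bddCont3_kerG i.1 i.2.1).mul (S.bddCont3_q i.1 i.2.1 i.2.2)
  refine ⟨K₁ + K₂ + n * (K₃ + K₄), by positivity, fun τ u uX uT h j x hx t ht => ?_⟩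
  set e := absSum u with he
  have he0 : ∀ x t, 0 ≤ e x t := absSum_nonneg u
  have hce : Continuous fun ξ => e ξ (S.W j ξ x t) :=
    Continuous.comp₂' (continuous_absSum h.cont) continuous_id (by fun_prop)
  set I := ∫ ξ in (0 : ℝ)..1, e ξ (S.W j ξ x t) with hI
  have hI0 : 0 ≤ I := S.integral_along_nonneg he0 j x t
  have e1 : |u j x t - S.opCP u j x t| ≤ K₁ * I := by
    rw [sub_opCP_eq h j hx ht.le, abs_neg, hI, ← intervalIntegral.integral_const_mul]
    exact abs_integral_le_integral_unit (continuous_const.mul hce)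
      (fun ξ => abs_sum_mul_le (fun i => hA (j, i) ξ x t) u _ _) (xIn_mem j) hx
  have e2 : ∀ i, |∫ ξ in (xIn m j)..x,
      ((S.kerAT j i ξ x t - S.kerGX j i ξ x t) * u i ξ (S.W j ξ x t) +
        ∑ k, S.kerG j i ξ x t * S.q i k ξ (S.W j ξ x t) * u k ξ (S.W j ξ x t))| ≤
      (K₃ + K₄) * I := by
    intro i
    rw [hI, ← intervalIntegral.integral_const_mul]
    refine abs_integral_le_integral_unit (G := fun ξ => (K₃ + K₄) * e ξ (S.W j ξ x t))
      (continuous_const.mul hce) (fun ξ => ?_) (xIn_mem j) hx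
    refine (abs_add_le _ _).trans ?_
    rw [add_mul, abs_mul]
    exact add_le_add (mul_le_mul (hH (j, i) ξ x t) (abs_le_absSum u i _ _) (abs_nonneg _) h₃)
      (abs_sum_mul_le (fun k => hq (j, i, k) ξ x t) u _ _)
  have e3 : |uT j x t - S.opCPT u uT j x t| ≤
      K₂ * e x t + K₂ * e (xIn m j) (S.W j (xIn m j) x t) + n * ((K₃ + K₄) * I) := by
    rw [sub_opCPT_eq h j hx ht, abs_neg, Finset.sum_add_distrib, Finset.sum_sub_distrib]
    refine (abs_add_le _ _).trans (add_le_add ((abs_sub _ _).trans (add_le_add ?_ ?_)) ?_)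
    · exact abs_sum_mul_le (fun i => hG (j, i) x x t) u _ _
    · exact abs_sum_mul_le (fun i => hG (j, i) _ x t) u _ _
    · refine (Finset.abs_sum_le_sum_abs _ _).trans ((Finset.sum_le_sum fun i _ => e2 i).trans ?_)
      simp
  have e4 := apply_xIn_le (m := m) he0 j (S.W j (xIn m j) x t)
  have e5 := S.terms_le_maj he0 j x t
  have e6 : I ≤ S.maj e x t := by
    linarith [he0 x t, he0 0 (S.W j (xIn m j) x t), he0 1 (S.W j (xIn m j) x t)]
  have e7 : e x t + e (xIn m j) (S.W j (xIn m j) x t) ≤ S.maj e x t := by linarith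
  have e8 := mul_le_mul_of_nonneg_left e6 h₁
  have e9 := mul_le_mul_of_nonneg_left e7 h₂
  have e10 : n * ((K₃ + K₄) * I) ≤ n * ((K₃ + K₄) * S.maj e x t) := by gcongr
  linarith

theorem exists_opCP_bound : ∃ K, 0 ≤ K ∧ ∀ (w z : Fin n → ℝ → ℝ → ℝ) (j : Fin n) (x t F : ℝ),
    (∀ k, |w k (xOut m k) (S.W j (xIn m j) x t)| + |z k (xOut m k) (S.W j (xIn m j) x t)| ≤ F) →
    |S.opCP w j x t| + |S.opCPT w z j x t| ≤ K * F := by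
  obtain ⟨K₁, h₁, hc⟩ := BddCont3.exists_common_bound S.bddCont3_c
  obtain ⟨K₂, h₂, hcT⟩ := BddCont3.exists_common_bound S.bddCont3_cT
  obtain ⟨K₃, h₃, hW⟩ := BddCont3.exists_common_bound S.bddCont3_WT
  have hM := S.M_pos
  refine ⟨K₁ * (n * S.M) + (K₂ * (n * S.M) + K₁ * (n * S.M * K₃)), by positivity,
    fun w z j x t F hF => ?_⟩
  have hP : ∀ y : Fin n → ℝ → ℝ → ℝ, (∀ k, |y k (xOut m k) (S.W j (xIn m j) x t)| ≤ F) →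
      |opP m S.p y j (S.W j (xIn m j) x t)| ≤ n * S.M * F := by
    intro y hy
    refine (Finset.abs_sum_le_sum_abs _ _).trans ?_
    refine (Finset.sum_le_sum fun k _ => ?_ : _ ≤ ∑ _k : Fin n, S.M * F).trans (by simp [mul_assoc])
    rw [abs_mul]
    exact mul_le_mul (S.hp j k) (hy k) (abs_nonneg _) hM.le
  have hw := hP w fun k => by linarith [hF k, abs_nonneg (z k (xOut m k) (S.W j (xIn m j) x t))]
  have hz := hP z fun k => by linarith [hF k, abs_nonneg (w k (xOut m k) (S.W j (xIn m j) x t))]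
  have e1 : |S.opCP w j x t| ≤ K₁ * (n * S.M * F) := by
    rw [opCP, abs_mul]
    exact mul_le_mul (hc j _ x t) hw (abs_nonneg _) h₁
  have e2 : |S.opCPT w z j x t| ≤ K₂ * (n * S.M * F) + K₁ * (n * S.M * F * K₃) := by
    rw [opCPT]
    refine (abs_add_le _ _).trans (add_le_add ?_ ?_)
    · rw [abs_mul]; exact mul_le_mul (hcT j _ x t) hw (abs_nonneg _) h₂
    · rw [abs_mul, abs_mul]
      exact mul_le_mul (hc j _ x t) (mul_le_mul hz (hW j _ x t) (abs_nonneg _)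
        ((abs_nonneg _).trans hz)) (by positivity) h₁
  linarith

theorem opCP_sub (w w' : Fin n → ℝ → ℝ → ℝ) (j : Fin n) (x t : ℝ) :
    S.opCP w j x t - S.opCP w' j x t = S.opCP (fun k y s => w k y s - w' k y s) j x t := by
  simp only [opCP, opP, mul_sub, Finset.sum_sub_distrib]

theorem opCPT_sub (w z w' z' : Fin n → ℝ → ℝ → ℝ) (j : Fin n) (x t : ℝ) :
    S.opCPT w z j x t - S.opCPT w' z' j x t =
      S.opCPT (fun k y s => w k y s - w' k y s) (fun k y s => z k y s - z' k y s) j x t := by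
  simp only [opCPT, opP, mul_sub, Finset.sum_sub_distrib, sub_mul]
  ring

/-- The time derivatives of the iterates of `opCP` on `u`, where `uT` is the time derivative
of `u`. -/
def iterT (u uT : Fin n → ℝ → ℝ → ℝ) : ℕ → Fin n → ℝ → ℝ → ℝ
  | 0 => uT
  | i + 1 => S.opCPT (S.opCP^[i] u) (iterT u uT i)

theorem hasDerivAt_iterate {u uT : Fin n → ℝ → ℝ → ℝ}
    (h : ∀ j x t, HasDerivAt (fun s => u j x s) (uT j x t) t) (i : ℕ) :
    ∀ j x t, HasDerivAt (fun s => S.opCP^[i] u j x s) (S.iterT u uT i j x t) t := by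
  induction i with
  | zero => exact h
  | succ i ih =>
    simp only [Function.iterate_succ_apply']
    exact hasDerivAt_opCP ih

/-- By linearity each difference of successive iterates is `opCP` of the previous one. It reads
outflow values at the time when the characteristic meets the inflow boundary, which can be `δ`
earlier; this raises the threshold by `δ` and costs one more application of `maj`. -/
theorem exists_iterate_sub_bound (i : ℕ) : ∃ K, 0 ≤ K ∧ ∀ (τ : ℝ) (u uX uT : Fin n → ℝ → ℝ → ℝ),
    S.IsSol τ (fun _ _ _ => 0) u uX uT → ∀ j, ∀ x ∈ Icc (0 : ℝ) 1, ∀ t, τ + (i + 1) * S.δ < t →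
      |S.opCP^[i] u j x t - S.opCP^[i + 1] u j x t| +
        |S.iterT u uT i j x t - S.iterT u uT (i + 1) j x t| ≤ K * S.maj^[i + 1] (absSum u) x t := by
  induction i with
  | zero =>
    obtain ⟨K, hK, h⟩ := S.exists_sub_opCP_bound
    refine ⟨K, hK, fun τ u uX uT hu j x hx t ht => ?_⟩
    exact h τ u uX uT hu j x hx t (by simpa using ht)
  | succ i ih =>
    obtain ⟨K, hK, h⟩ := ih
    obtain ⟨K', hK', h'⟩ := S.exists_opCP_bound
    refine ⟨K' * K, by positivity, fun τ u uX uT hu j x hx t ht => ?_⟩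
    set e := S.maj^[i + 1] (absSum u) with he
    have he0 : ∀ x t, 0 ≤ e x t := S.maj_iterate_nonneg (absSum_nonneg u) _
    have hs : τ + (i + 1) * S.δ < S.W j (xIn m j) x t := by
      have := (abs_le.1 (S.abs_W_sub_le j (xIn m j) x t)).1
      push_cast at ht
      linarith
    have h1 := h' (fun k y s => S.opCP^[i] u k y s - S.opCP^[i + 1] u k y s)
      (fun k y s => S.iterT u uT i k y s - S.iterT u uT (i + 1) k y s) j x t
      (K * S.maj e x t) fun k => by
        refine (h τ u uX uT hu k _ (xOut_mem k) _ hs).trans (mul_le_mul_of_nonneg_left ?_ hK)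
        have e1 := apply_xOut_le (m := m) he0 k (S.W j (xIn m j) x t)
        have e2 := S.terms_le_maj he0 j x t
        linarith [he0 x t, S.integral_along_nonneg he0 j x t]
    rw [Function.iterate_succ_apply' (f := S.maj), mul_assoc]
    refine le_trans (le_of_eq ?_) h1
    rw [← opCP_sub, ← opCPT_sub]
    simp only [Function.iterate_succ_apply', iterT]

/-- Both sides read their arguments only at outflow points, which lie in the strip, so agreement
there is enough. -/
theorem opC_opP_eq_opCP {w z : Fin n → ℝ → ℝ → ℝ}
    (h : ∀ j, ∀ x ∈ Icc (0 : ℝ) 1, ∀ t, w j x t = z j x t) (j : Fin n) {x : ℝ}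
    (hx : x ∈ Icc (0 : ℝ) 1) (t : ℝ) : opC m S.a S.b (opP m S.p w) j x t = S.opCP z j x t := by
  have h1 : opP m S.p w = opP m S.p z := by
    funext k s
    exact Finset.sum_congr rfl fun i _ => by rw [h i _ (xOut_mem i)]
  rw [opC, opCP, S.c_eq_cCoef j (xIn_mem j) hx, S.W_eq_omega j (xIn_mem j) hx, h1]

theorem opC_opP_iterate_eq (u : Fin n → ℝ → ℝ → ℝ) (i : ℕ) : ∀ j, ∀ x ∈ Icc (0 : ℝ) 1, ∀ t,
    ((fun w => opC m S.a S.b (opP m S.p w))^[i] u) j x t = S.opCP^[i] u j x t := by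
  induction i with
  | zero => intro j x _ t; rw [Function.iterate_zero_apply, Function.iterate_zero_apply]
  | succ i ih =>
    intro j x hx t
    rw [Function.iterate_succ_apply', Function.iterate_succ_apply']
    exact S.opC_opP_eq_opCP ih j hx t

/-- Extinction after `k` steps bounds the time derivative of solutions by the solution itself. -/
theorem exists_deriv_bound {k : ℕ} (hk : ∀ u : Fin n → ℝ → ℝ → ℝ,
    (∀ j, ContinuousOn (fun z : ℝ × ℝ => u j z.1 z.2) (Icc 0 1 ×ˢ univ)) →
    ∀ j, ∀ x ∈ Icc (0 : ℝ) 1, ∀ t : ℝ,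
      ((fun w => opC m S.a S.b (opP m S.p w))^[k] u) j x t = 0) :
    ∃ K, 0 ≤ K ∧ ∀ (τ : ℝ) (u uX uT : Fin n → ℝ → ℝ → ℝ),
    S.IsSol τ (fun _ _ _ => 0) u uX uT → ∀ j, ∀ x ∈ Icc (0 : ℝ) 1, ∀ t, τ + k * S.δ < t →
      |uT j x t| ≤ K * S.maj^[k] (absSum u) x t := by
  choose K hK h using S.exists_iterate_sub_bound
  refine ⟨∑ i ∈ Finset.range k, K i, Finset.sum_nonneg fun i _ => hK i,
    fun τ u uX uT hu j x hx t ht => ?_⟩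
  have hz : ∀ s, S.opCP^[k] u j x s = 0 := fun s => by
    rw [← S.opC_opP_iterate_eq u k j x hx s]
    exact hk u (fun j => (hu.cont j).continuousOn) j x hx s
  -- The extinguished iterate vanishes for all times, so its time derivative vanishes too.
  have hzT : S.iterT u uT k j x t = 0 := by
    have h1 := S.hasDerivAt_iterate hu.deriv_t k j x t
    simp only [hz] at h1
    exact h1.unique (hasDerivAt_const t 0)
  -- Telescoping from `uT` down to the vanishing `k`-th iterate.
  have hsum : uT j x t = ∑ i ∈ Finset.range k,
      (S.iterT u uT i j x t - S.iterT u uT (i + 1) j x t) := by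
    rw [Finset.sum_range_sub' (fun i => S.iterT u uT i j x t), hzT, sub_zero]
    rfl
  rw [hsum, Finset.sum_mul]
  refine (Finset.abs_sum_le_sum_abs _ _).trans (Finset.sum_le_sum fun i hi => ?_)
  have hik : i + 1 ≤ k := Finset.mem_range.1 hi
  have hik' : ((i : ℝ) + 1) * S.δ ≤ k * S.δ :=
    mul_le_mul_of_nonneg_right (by exact_mod_cast hik) S.δ_pos.le
  have h1 := h i τ u uX uT hu j x hx t (by linarith)
  have h2 := S.maj_iterate_mono (absSum_nonneg u) x t hik
  have h3 := mul_le_mul_of_nonneg_left h2 (hK i)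
  have := abs_nonneg (S.opCP^[i] u j x t - S.opCP^[i + 1] u j x t)
  simp only at h3
  linarith

end Sys

/-! ### Integral inequalities in one and two variables -/

theorem integral_integral_swap_of_continuous {F : ℝ → ℝ → ℝ}
    (hF : Continuous fun z : ℝ × ℝ => F z.1 z.2) (a b c d : ℝ) :
    ∫ x in a..b, ∫ y in c..d, F x y = ∫ y in c..d, ∫ x in a..b, F x y := by
  refine intervalIntegral_intervalIntegral_swap ?_
  refine IntegrableOn.mono_set (t := uIcc a b ×ˢ uIcc c d) ?_
    (prod_mono uIoc_subset_uIcc uIoc_subset_uIcc)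
  exact hF.continuousOn.integrableOn_compact (isCompact_uIcc.prod isCompact_uIcc)

theorem integral_le_const_of_le {g : ℝ → ℝ} (hg : Continuous g) {a b B : ℝ} (hab : a ≤ b)
    (h : ∀ x ∈ Icc a b, g x ≤ B) : ∫ x in a..b, g x ≤ (b - a) * B := by
  have := intervalIntegral.integral_mono_on (μ := volume) hab (hg.intervalIntegrable a b)
    (continuous_const.intervalIntegrable a b) h
  simpa using this

theorem integral_mono_continuous {g g' : ℝ → ℝ} (hg : Continuous g) (hg' : Continuous g')
    {a b : ℝ} (hab : a ≤ b) (h : ∀ x ∈ Icc a b, g x ≤ g' x) :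
    ∫ x in a..b, g x ≤ ∫ x in a..b, g' x :=
  intervalIntegral.integral_mono_on hab (hg.intervalIntegrable a b) (hg'.intervalIntegrable a b) h

theorem integral_le_integral_of_subset {g : ℝ → ℝ} (hg : Continuous g) (h0 : ∀ x, 0 ≤ g x)
    {a b c d : ℝ} (hca : c ≤ a) (hab : a ≤ b) (hbd : b ≤ d) :
    ∫ x in a..b, g x ≤ ∫ x in c..d, g x :=
  intervalIntegral.integral_mono_interval hca hab hbd (Eventually.of_forall h0)
    (hg.intervalIntegrable _ _)

/-- A one-dimensional Sobolev inequality. -/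
theorem abs_le_integral_add_integral {w w' : ℝ → ℝ} (hd : ∀ s, HasDerivAt w (w' s) s)
    (hc : Continuous w') {a b t : ℝ} (hab : a + 1 ≤ b) (ht : t ∈ Icc a b) :
    |w t| ≤ (∫ s in a..b, |w s|) + ∫ s in a..b, |w' s| := by
  have hab' : a ≤ b := by linarith
  have hw : Continuous w := continuous_iff_continuousAt.2 fun s => (hd s).continuousAt
  set I := ∫ s in a..b, |w s|
  set I' := ∫ s in a..b, |w' s|
  have hI : 0 ≤ I := intervalIntegral.integral_nonneg hab' fun _ _ => abs_nonneg _
  have h1 : ∀ s ∈ Icc a b, |w t| - I' ≤ |w s| := by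
    intro s hs
    have e1 : ∫ r in s..t, w' r = w t - w s :=
      intervalIntegral.integral_eq_sub_of_hasDerivAt (fun r _ => hd r) (hc.intervalIntegrable _ _)
    have e2 : |∫ r in s..t, w' r| ≤ I' := by
      rw [← Real.norm_eq_abs]
      refine intervalIntegral.norm_integral_le_abs_integral_norm.trans ?_
      simp only [Real.norm_eq_abs]
      rcases le_total s t with hst | hst
      · rw [abs_of_nonneg (intervalIntegral.integral_nonneg hst fun _ _ => abs_nonneg _)]
        exact integral_le_integral_of_subset hc.abs (fun _ => abs_nonneg _) hs.1 hst ht.2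
      · rw [intervalIntegral.integral_symm, abs_neg,
          abs_of_nonneg (intervalIntegral.integral_nonneg hst fun _ _ => abs_nonneg _)]
        exact integral_le_integral_of_subset hc.abs (fun _ => abs_nonneg _) ht.1 hst hs.2
    have e3 : w t = w s + ∫ r in s..t, w' r := by rw [e1]; ring
    have e4 := abs_add_le (w s) (∫ r in s..t, w' r)
    rw [← e3] at e4
    linarith
  have h2 := intervalIntegral.integral_mono_on (μ := volume) hab'
    (continuous_const.intervalIntegrable a b) (hw.abs.intervalIntegrable a b) h1
  rw [intervalIntegral.integral_const, smul_eq_mul] at h2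
  -- Enlarging `|w t| - I'` by the factor `b - a ≥ 1` requires it to be nonnegative, and this is
  -- known only under the negation of the claim.
  by_contra hcon
  push Not at hcon
  have h3 : |w t| - I' ≤ (b - a) * (|w t| - I') :=
    le_mul_of_one_le_left (by linarith) (by linarith)
  linarith

/-- The variance of `|g|` on the unit interval is nonnegative. -/
theorem integral_abs_le_sqrt {g : ℝ → ℝ} (hg : Continuous g) :
    ∫ x in (0 : ℝ)..1, |g x| ≤ √(∫ x in (0 : ℝ)..1, g x ^ 2) := by
  refine Real.le_sqrt_of_sq_le ?_
  set M := ∫ x in (0 : ℝ)..1, |g x| with hM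
  have h1 : 0 ≤ ∫ x in (0 : ℝ)..1, (|g x| - M) ^ 2 :=
    intervalIntegral.integral_nonneg zero_le_one fun _ _ => sq_nonneg _
  have h2 : ∫ x in (0 : ℝ)..1, (|g x| - M) ^ 2 =
      (∫ x in (0 : ℝ)..1, g x ^ 2) - 2 * M * M + M ^ 2 := by
    have e : ∀ x, (|g x| - M) ^ 2 = g x ^ 2 - 2 * M * |g x| + M ^ 2 := fun x => by
      rw [← sq_abs (g x)]; ring
    simp only [e]
    rw [intervalIntegral.integral_add, intervalIntegral.integral_sub,
      intervalIntegral.integral_const_mul]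
    · simp [hM]
    all_goals exact Continuous.intervalIntegrable (by fun_prop) _ _
  nlinarith

namespace Sys

variable (S : Sys n m)

/-! ### Estimates on strips -/

/-- Substitute `s = W`: the Jacobian `WT` is at least `exp (-L)`, and the new limits differ from the
old ones by at most `δ`. -/
theorem integral_comp_W_le {F : ℝ → ℝ} (hF : Continuous F) (h0 : ∀ s, 0 ≤ F s) (j : Fin n)
    (ξ x : ℝ) {s₁ s₂ : ℝ} (hs : s₁ ≤ s₂) :
    ∫ t in s₁..s₂, F (S.W j ξ x t) ≤ Real.exp S.L * ∫ s in (s₁ - S.δ)..(s₂ + S.δ), F s := by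
  have hmono : Monotone fun t => S.W j ξ x t :=
    monotone_of_hasDerivAt_nonneg (S.hasDerivAt_W j ξ x) fun t => (S.WT_pos j ξ x t).le
  have h1 := intervalIntegral.integral_comp_mul_deriv (a := s₁) (b := s₂) (f := fun t => S.W j ξ x t)
    (f' := fun t => S.WT j ξ x t) (g := F) (fun t _ => S.hasDerivAt_W j ξ x t) (by fun_prop) hF
  have h2 : ∫ t in s₁..s₂, F (S.W j ξ x t) ≤
      ∫ t in s₁..s₂, Real.exp S.L * ((F ∘ fun t => S.W j ξ x t) t * S.WT j ξ x t) := by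
    refine integral_mono_continuous (by fun_prop) (by fun_prop) hs fun t _ => ?_
    have e1 := S.le_WT j ξ x t
    rw [Real.exp_neg] at e1
    have e2 : 1 ≤ Real.exp S.L * S.WT j ξ x t := by
      have := mul_le_mul_of_nonneg_left e1 (Real.exp_pos S.L).le
      rwa [mul_inv_cancel₀ (Real.exp_pos S.L).ne'] at this
    have e3 := mul_le_mul_of_nonneg_left e2 (h0 (S.W j ξ x t))
    simp only [Function.comp_apply]
    linarith
  rw [intervalIntegral.integral_const_mul, h1] at h2
  refine h2.trans (mul_le_mul_of_nonneg_left ?_ (Real.exp_pos _).le)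
  exact integral_le_integral_of_subset hF h0
    (by linarith [(abs_le.1 (S.abs_W_sub_le j ξ x s₁)).1]) (hmono hs)
    (by linarith [(abs_le.1 (S.abs_W_sub_le j ξ x s₂)).2])

variable {e : ℝ → ℝ → ℝ}

/-- There is one value at the point itself, `2 n` boundary values and `n` averages over lines, all
at times within `δ` of `t`. This explains the constant and the shorter interval. -/
theorem maj_le (hc : Continuous fun z : ℝ × ℝ => e z.1 z.2) {s₁ s₂ B : ℝ}
    (h : ∀ x ∈ Icc (0 : ℝ) 1, ∀ t ∈ Icc s₁ s₂, e x t ≤ B) :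
    ∀ x ∈ Icc (0 : ℝ) 1, ∀ t ∈ Icc (s₁ + S.δ) (s₂ - S.δ), S.maj e x t ≤ (1 + 3 * n) * B := by
  intro x hx t ht
  have hW : ∀ j ξ, S.W j ξ x t ∈ Icc s₁ s₂ := fun j ξ => by
    have := abs_le.1 (S.abs_W_sub_le j ξ x t)
    exact ⟨by linarith [ht.1], by linarith [ht.2]⟩
  have hδ := S.δ_pos
  have h1 : e x t ≤ B := h x hx t ⟨by linarith [ht.1], by linarith [ht.2]⟩
  have h2 : ∑ j, (e 0 (S.W j (xIn m j) x t) + e 1 (S.W j (xIn m j) x t)) ≤ ∑ _j : Fin n, (B + B) :=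
    Finset.sum_le_sum fun j _ => add_le_add (h 0 (by simp) _ (hW _ _)) (h 1 (by simp) _ (hW _ _))
  have h3 : ∑ j, ∫ ξ in (0 : ℝ)..1, e ξ (S.W j ξ x t) ≤ ∑ _j : Fin n, B :=
    Finset.sum_le_sum fun j _ => by
      have := integral_le_const_of_le (g := fun ξ => e ξ (S.W j ξ x t))
        (Continuous.comp₂' hc continuous_id (by fun_prop)) zero_le_one
        fun ξ hξ => h ξ hξ _ (hW j ξ)
      simpa using this
  simp only [Finset.sum_const, Finset.card_univ, Fintype.card_fin, nsmul_eq_mul] at h2 h3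
  unfold maj; linarith

/-- The same count for time integrals: Fubini exchanges time with the position on the line, and each
change of the time variable costs `exp L`. -/
theorem integral_maj_le (he : ∀ x t, 0 ≤ e x t) (hc : Continuous fun z : ℝ × ℝ => e z.1 z.2)
    {s₁ s₂ B : ℝ} (hs : s₁ + S.δ ≤ s₂ - S.δ)
    (h : ∀ x ∈ Icc (0 : ℝ) 1, ∫ t in s₁..s₂, e x t ≤ B) :
    ∀ x ∈ Icc (0 : ℝ) 1, ∫ t in (s₁ + S.δ)..(s₂ - S.δ), S.maj e x t ≤
      (1 + 3 * n * Real.exp S.L) * B := by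
  intro x hx
  have hδ := S.δ_pos
  have hct : ∀ x, Continuous fun t => e x t := fun x =>
    Continuous.comp₂' hc continuous_const continuous_id
  have hW : ∀ j, ∀ ξ, ∀ X ∈ Icc (0 : ℝ) 1, ∫ t in (s₁ + S.δ)..(s₂ - S.δ), e X (S.W j ξ x t) ≤
      Real.exp S.L * B := fun j ξ X hX => by
    refine (S.integral_comp_W_le (hct X) (he X) j ξ x hs).trans ?_
    rw [add_sub_cancel_right, sub_add_cancel]
    exact mul_le_mul_of_nonneg_left (h X hX) (Real.exp_pos _).le
  have h1 : ∫ t in (s₁ + S.δ)..(s₂ - S.δ), e x t ≤ B :=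
    (integral_le_integral_of_subset (hct x) (he x) (by linarith) hs (by linarith)).trans (h x hx)
  have hcW : ∀ j X, Continuous fun t => e X (S.W j (xIn m j) x t) := fun j X =>
    (hct X).comp (by fun_prop)
  have hcI : ∀ j, Continuous fun t => ∫ ξ in (0 : ℝ)..1, e ξ (S.W j ξ x t) := fun j =>
    (S.continuous_along_total hc j).comp (continuous_const.prodMk continuous_id)
  have h3 : ∀ j, ∫ t in (s₁ + S.δ)..(s₂ - S.δ), ∫ ξ in (0 : ℝ)..1, e ξ (S.W j ξ x t) ≤
      Real.exp S.L * B := fun j => by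
    have hF : Continuous fun z : ℝ × ℝ => e z.2 (S.W j z.2 x z.1) :=
      Continuous.comp₂' hc continuous_snd (by fun_prop)
    rw [integral_integral_swap_of_continuous (F := fun t ξ => e ξ (S.W j ξ x t)) hF]
    have hg : Continuous fun ξ => ∫ t in (s₁ + S.δ)..(s₂ - S.δ), e ξ (S.W j ξ x t) :=
      continuous_integral_param (F := fun ξ t => e ξ (S.W j ξ x t))
        (Continuous.comp₂' hc continuous_fst (by fun_prop)) continuous_const continuous_const
    have := integral_le_const_of_le hg zero_le_one fun ξ hξ => hW j ξ ξ hξ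
    simpa using this
  simp only [maj]
  rw [intervalIntegral.integral_add, intervalIntegral.integral_add,
    intervalIntegral.integral_finsetSum, intervalIntegral.integral_finsetSum]
  · have h2 : ∑ j, ∫ t in (s₁ + S.δ)..(s₂ - S.δ),
        (e 0 (S.W j (xIn m j) x t) + e 1 (S.W j (xIn m j) x t)) ≤
        ∑ _j : Fin n, (Real.exp S.L * B + Real.exp S.L * B) := Finset.sum_le_sum fun j _ => by
      rw [intervalIntegral.integral_add ((hcW j 0).intervalIntegrable _ _)
        ((hcW j 1).intervalIntegrable _ _)]
      exact add_le_add (hW j _ 0 (by simp)) (hW j _ 1 (by simp))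
    have h4 := Finset.sum_le_sum fun j (_ : j ∈ Finset.univ) => h3 j
    simp only [Finset.sum_const, Finset.card_univ, Fintype.card_fin, nsmul_eq_mul] at h2 h4
    linarith
  · exact fun j _ => (hcI j).intervalIntegrable _ _
  · exact fun j _ => ((hcW j 0).add (hcW j 1)).intervalIntegrable _ _
  · exact (hct x).intervalIntegrable _ _
  · exact (continuous_finsetSum _ fun j _ => (hcW j 0).add (hcW j 1)).intervalIntegrable _ _
  · exact ((hct x).add (continuous_finsetSum _ fun j _ =>
      (hcW j 0).add (hcW j 1))).intervalIntegrable _ _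
  · exact (continuous_finsetSum _ fun j _ => hcI j).intervalIntegrable _ _

theorem maj_iterate_le (hc : Continuous fun z : ℝ × ℝ => e z.1 z.2)
    {s₁ s₂ B : ℝ} (h : ∀ x ∈ Icc (0 : ℝ) 1, ∀ t ∈ Icc s₁ s₂, e x t ≤ B) (k : ℕ) :
    ∀ x ∈ Icc (0 : ℝ) 1, ∀ t ∈ Icc (s₁ + k * S.δ) (s₂ - k * S.δ),
      S.maj^[k] e x t ≤ (1 + 3 * n) ^ k * B := by
  induction k with
  | zero => simpa using h
  | succ k ih =>
    have := S.maj_le (S.continuous_maj_iterate hc k) ih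
    intro x hx t ht
    rw [Function.iterate_succ_apply', pow_succ', mul_assoc]
    refine this x hx t ⟨?_, ?_⟩
    · have := ht.1; push_cast at this; linarith
    · have := ht.2; push_cast at this; linarith

theorem integral_maj_iterate_le (he : ∀ x t, 0 ≤ e x t)
    (hc : Continuous fun z : ℝ × ℝ => e z.1 z.2) {s₁ s₂ B : ℝ}
    (h : ∀ x ∈ Icc (0 : ℝ) 1, ∫ t in s₁..s₂, e x t ≤ B) (k : ℕ)
    (hs : s₁ + k * S.δ ≤ s₂ - k * S.δ) :
    ∀ x ∈ Icc (0 : ℝ) 1, ∫ t in (s₁ + k * S.δ)..(s₂ - k * S.δ), S.maj^[k] e x t ≤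
      (1 + 3 * n * Real.exp S.L) ^ k * B := by
  have hδ := S.δ_pos
  induction k with
  | zero => simpa using h
  | succ k ih =>
    push_cast at hs ⊢
    have := S.integral_maj_le (S.maj_iterate_nonneg he k) (S.continuous_maj_iterate hc k)
      (by linarith) (ih (by linarith))
    simp only [Function.iterate_succ_apply']
    rw [pow_succ', mul_assoc, show s₁ + (k + 1) * S.δ = s₁ + k * S.δ + S.δ by ring,
      show s₂ - (k + 1) * S.δ = s₂ - k * S.δ - S.δ by ring]
    exact this

/-! ### A priori estimates -/

variable {S} {τ : ℝ} {u uX uT : Fin n → ℝ → ℝ → ℝ}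

/-- Integrate the equation along the characteristic from `η` to `x` and average over `η` in the unit
interval. A point value is thus controlled by an integral, without the boundary condition. -/
theorem abs_le_integral_along (h : S.IsSol τ (fun _ _ _ => 0) u uX uT) (k : Fin n) {x t : ℝ}
    (hx : x ∈ Icc (0 : ℝ) 1) (ht : τ + S.δ ≤ t) :
    |u k x t| ≤ (1 + S.Q) * ∫ η in (0 : ℝ)..1, absSum u η (S.W k η x t) := by
  have hce : Continuous fun ξ => absSum u ξ (S.W k ξ x t) :=
    Continuous.comp₂' (continuous_absSum h.cont) continuous_id (by fun_prop)
  set I := ∫ η in (0 : ℝ)..1, absSum u η (S.W k η x t) with hI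
  have hcq : Continuous fun ξ => ∑ i, -S.q k i ξ (S.W k ξ x t) * u i ξ (S.W k ξ x t) :=
    continuous_finsetSum _ fun i _ =>
      (by fun_prop : Continuous fun ξ => -S.q k i ξ (S.W k ξ x t)).mul (h.continuous_along k i x t)
  have h1 : ∀ η ∈ Icc (0 : ℝ) 1, |u k x t| - S.Q * I ≤ absSum u η (S.W k η x t) := by
    intro η hη
    have e1 := integral_eq_sub_of_hasDerivWithinAt_Icc hη hx hcq fun ξ hξ =>
      (hasDerivWithinAt_along_W (x := x) h k k hξ (le_W_of_add_δ_le ht k ξ)).congr_deriv (by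
        simp [Finset.sum_neg_distrib])
    rw [W_self] at e1
    have e2 : |∫ ξ in η..x, ∑ i, -S.q k i ξ (S.W k ξ x t) * u i ξ (S.W k ξ x t)| ≤ S.Q * I := by
      rw [hI, ← intervalIntegral.integral_const_mul]
      exact abs_integral_le_integral_unit (continuous_const.mul hce)
        (fun ξ => abs_sum_mul_le (fun i => by rw [abs_neg]; exact S.abs_q_le k i _ _) u _ _) hη hx
    rw [e1] at e2
    have e3 := abs_le_absSum u k η (S.W k η x t)
    have e4 := abs_sub_abs_le_abs_sub (u k x t) (u k η (S.W k η x t))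
    linarith
  have h2 := intervalIntegral.integral_mono_on (μ := volume) zero_le_one
    (continuous_const.intervalIntegrable 0 1) (hce.intervalIntegrable 0 1) h1
  simp only [intervalIntegral.integral_const, sub_zero, one_smul] at h2
  linarith

/-- Integrating `abs_le_integral_along` over time turns the right-hand side into a double integral
over a piece of the strip, which Fubini and `integral_comp_W_le` reduce to space integrals at fixed
times. This exchanges control in space for each time against control in time for each position. -/
theorem integral_absSum_le (h : S.IsSol τ (fun _ _ _ => 0) u uX uT) {s₁ s₂ B : ℝ}
    (hs₁ : τ + S.δ ≤ s₁) (hs : s₁ ≤ s₂)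
    (hB : ∀ s ∈ Icc (s₁ - S.δ) (s₂ + S.δ), ∫ η in (0 : ℝ)..1, absSum u η s ≤ B) :
    ∀ x ∈ Icc (0 : ℝ) 1, ∫ t in s₁..s₂, absSum u x t ≤
      n * ((1 + S.Q) * (Real.exp S.L * ((s₂ - s₁ + 2 * S.δ) * B))) := by
  intro x hx
  have hc := continuous_absSum h.cont
  have he := absSum_nonneg u
  have hδ := S.δ_pos
  have hQ := S.Q_nonneg
  have hI : ∀ k, ∫ t in s₁..s₂, ∫ η in (0 : ℝ)..1, absSum u η (S.W k η x t) ≤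
      Real.exp S.L * ((s₂ - s₁ + 2 * S.δ) * B) := by
    intro k
    have hF : Continuous fun z : ℝ × ℝ => absSum u z.2 (S.W k z.2 x z.1) :=
      Continuous.comp₂' hc continuous_snd (by fun_prop)
    rw [integral_integral_swap_of_continuous (F := fun t η => absSum u η (S.W k η x t)) hF]
    have hg : Continuous fun η => ∫ t in s₁..s₂, absSum u η (S.W k η x t) :=
      continuous_integral_param (F := fun η t => absSum u η (S.W k η x t))
        (Continuous.comp₂' hc continuous_fst (by fun_prop)) continuous_const continuous_const
    have hg' : Continuous fun η => Real.exp S.L * ∫ s in (s₁ - S.δ)..(s₂ + S.δ), absSum u η s :=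
      continuous_const.mul (continuous_integral_param (F := fun η t => absSum u η t)
        (Continuous.comp₂' hc continuous_fst continuous_snd) continuous_const continuous_const)
    refine (integral_mono_continuous hg hg' zero_le_one fun η _ => S.integral_comp_W_le
      (Continuous.comp₂' hc continuous_const continuous_id) (he η) k η x hs).trans ?_
    rw [intervalIntegral.integral_const_mul]
    refine mul_le_mul_of_nonneg_left ?_ (Real.exp_pos _).le
    rw [integral_integral_swap_of_continuous (F := fun η s => absSum u η s) hc]
    have hg'' : Continuous fun s => ∫ η in (0 : ℝ)..1, absSum u η s :=
      continuous_integral_param (F := fun s η => absSum u η s)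
        (Continuous.comp₂' hc continuous_snd continuous_fst) continuous_const continuous_const
    refine (integral_le_const_of_le hg'' (by linarith) hB).trans (le_of_eq ?_)
    ring
  have hcI : ∀ k, Continuous fun t => ∫ η in (0 : ℝ)..1, absSum u η (S.W k η x t) := fun k =>
    (S.continuous_along_total hc k).comp (continuous_const.prodMk continuous_id)
  have hcu : ∀ k, Continuous fun t => |u k x t| := fun k =>
    (Continuous.comp₂' (h.cont k) continuous_const continuous_id).abs
  calc ∫ t in s₁..s₂, absSum u x t = ∑ k, ∫ t in s₁..s₂, |u k x t| := by
        simp only [absSum]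
        exact intervalIntegral.integral_finsetSum fun k _ => (hcu k).intervalIntegrable _ _
    _ ≤ ∑ _k : Fin n, (1 + S.Q) * (Real.exp S.L * ((s₂ - s₁ + 2 * S.δ) * B)) := by
        refine Finset.sum_le_sum fun k _ => ?_
        refine (integral_mono_continuous (hcu k) (g' := fun t => (1 + S.Q) *
          ∫ η in (0 : ℝ)..1, absSum u η (S.W k η x t)) (continuous_const.mul (hcI k)) hs fun t ht =>
          abs_le_integral_along h k hx (hs₁.trans ht.1)).trans ?_
        rw [intervalIntegral.integral_const_mul]
        exact mul_le_mul_of_nonneg_left (hI k) (by linarith)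
    _ = _ := by simp

theorem integral_absSum_space_le (h : S.IsSol τ (fun _ _ _ => 0) u uX uT) {s s' : ℝ} (hs : τ ≤ s)
    (hs' : s ≤ s') : ∫ η in (0 : ℝ)..1, absSum u η s ≤
      n * (√(2 / S.ε * Real.exp (S.rate * (s' - τ))) * √(normSq fun j x => u j x τ)) := by
  have hε := S.ε_pos
  have hr := S.rate_nonneg
  have h0 : ∀ s j, 0 ≤ ∫ x in (0 : ℝ)..1, u j x s ^ 2 := fun s j =>
    intervalIntegral.integral_nonneg zero_le_one fun x _ => sq_nonneg _
  have h1 := h.normSq_le (G := 0) (fun j x _ t _ => by simp) hs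
  have hN : 0 ≤ normSq fun j x => u j x τ := Finset.sum_nonneg fun j _ => h0 τ j
  have h2 : normSq (fun j x => u j x s) ≤
      2 / S.ε * Real.exp (S.rate * (s' - τ)) * normSq fun j x => u j x τ := by
    refine h1.trans ?_
    simp only [ne_eq, OfNat.ofNat_ne_zero, not_false_eq_true, zero_pow, mul_zero, zero_mul, add_zero]
    gcongr
  have hcu := h.continuous_at_time
  simp only [absSum]
  rw [intervalIntegral.integral_finsetSum fun k _ => ((hcu k s).abs.intervalIntegrable _ _)]
  refine (Finset.sum_le_sum fun k _ => ?_ : _ ≤ ∑ _k : Fin n,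
    (√(2 / S.ε * Real.exp (S.rate * (s' - τ))) * √(normSq fun j x => u j x τ))).trans (by simp)
  refine (integral_abs_le_sqrt (hcu k s)).trans ?_
  rw [← Real.sqrt_mul (by positivity)]
  refine Real.sqrt_le_sqrt (le_trans ?_ h2)
  exact Finset.single_le_sum (f := fun j => ∫ x in (0 : ℝ)..1, u j x s ^ 2) (fun j _ => h0 s j)
    (Finset.mem_univ k)

variable (S)

/-- Solutions are bounded in `C¹`, after a fixed time, by the `L²` norm of the initial values. -/
theorem exists_apriori_bound {k : ℕ} (hk : ∀ u : Fin n → ℝ → ℝ → ℝ,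
    (∀ j, ContinuousOn (fun z : ℝ × ℝ => u j z.1 z.2) (Icc 0 1 ×ˢ univ)) →
    ∀ j, ∀ x ∈ Icc (0 : ℝ) 1, ∀ t : ℝ,
      ((fun w => opC m S.a S.b (opP m S.p w))^[k] u) j x t = 0)
    {τ t : ℝ} (ht : τ + ((2 * k + 2) * S.δ + 1) ≤ t) :
    ∃ K, 0 ≤ K ∧ ∀ u uX uT : Fin n → ℝ → ℝ → ℝ, S.IsSol τ (fun _ _ _ => 0) u uX uT →
      ∀ j, ∀ x ∈ Icc (0 : ℝ) 1,
        |u j x t| ≤ K * √(normSq fun j x => u j x τ) ∧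
        |uX j x t| ≤ K * √(normSq fun j x => u j x τ) := by
  obtain ⟨K₀, hK₀, hT⟩ := S.exists_deriv_bound hk
  have hδ := S.δ_pos
  have hM := S.M_pos
  have hQ := S.Q_nonneg
  have hε := S.ε_pos
  have hkδ : 0 ≤ (k : ℝ) * S.δ := by positivity
  -- The derivative bound is used twice, and each use shortens the window by `k δ` at both ends; the
  -- extra unit provides the length needed in the Sobolev inequality. Times after `t` are harmless,
  -- as solutions exist for all later times.
  set s₁ := t - 2 * k * S.δ - 1 with hs₁
  set s₂ := t + 2 * k * S.δ with hs₂
  set C₀ := n * √(2 / S.ε * Real.exp (S.rate * (s₂ + S.δ - τ)))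
  have hC₀ : 0 ≤ C₀ := by positivity
  have hlen : 0 ≤ s₂ - s₁ + 2 * S.δ := by rw [hs₁, hs₂]; linarith
  set C₁ := n * ((1 + S.Q) * (Real.exp S.L * ((s₂ - s₁ + 2 * S.δ) * C₀)))
  have hC₁ : 0 ≤ C₁ := by positivity
  set C₂ := K₀ * ((1 + 3 * n * Real.exp S.L) ^ k * C₁)
  have hC₂ : 0 ≤ C₂ := by positivity
  set C₃ := K₀ * ((1 + 3 * n) ^ k * (n * (C₁ + C₂)))
  have hC₃ : 0 ≤ C₃ := by positivity
  refine ⟨C₁ + C₂ + S.δ * (C₃ + n * S.M * (C₁ + C₂)), by positivity, fun u uX uT h j x hx => ?_⟩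
  set N := √(normSq fun j x => u j x τ)
  have hN : 0 ≤ N := Real.sqrt_nonneg _
  have hce := continuous_absSum h.cont
  have he := absSum_nonneg u
  have hτ : τ + S.δ < s₁ := by rw [hs₁]; linarith
  have hs : s₁ ≤ s₂ := by linarith
  have hL1 : ∀ x ∈ Icc (0 : ℝ) 1, ∫ t in s₁..s₂, absSum u x t ≤ C₁ * N := fun x hx =>
    (integral_absSum_le h hτ.le hs (B := C₀ * N) (fun s hs' => by
      refine (integral_absSum_space_le h (by linarith [hs'.1]) hs'.2).trans (le_of_eq ?_)
      ring) x hx).trans (le_of_eq (by ring))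
  have hcT : ∀ j x, Continuous fun s => uT j x s := fun j x =>
    Continuous.comp₂' (h.cont_t j) continuous_const continuous_id
  have hcu : ∀ j x, Continuous fun s => u j x s := fun j x =>
    Continuous.comp₂' (h.cont j) continuous_const continuous_id
  have hmid : s₁ + k * S.δ + 1 ≤ s₂ - k * S.δ := by rw [hs₁, hs₂]; linarith
  -- First use of the derivative bound, integrated in time.
  have hL1T : ∀ j, ∀ x ∈ Icc (0 : ℝ) 1,
      ∫ s in (s₁ + k * S.δ)..(s₂ - k * S.δ), |uT j x s| ≤ C₂ * N := by
    intro j x hx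
    have hcm : Continuous fun s => S.maj^[k] (absSum u) x s :=
      Continuous.comp₂' (S.continuous_maj_iterate hce k) continuous_const continuous_id
    refine (integral_mono_continuous (g' := fun s => K₀ * S.maj^[k] (absSum u) x s) (hcT j x).abs
      (continuous_const.mul hcm) (by linarith)
      fun s hs' => hT τ u uX uT h j x hx s (by linarith [hs'.1])).trans ?_
    rw [intervalIntegral.integral_const_mul]
    refine (mul_le_mul_of_nonneg_left (S.integral_maj_iterate_le he hce hL1 k (by linarith) x hx)
      hK₀).trans (le_of_eq ?_)
    ring
  have hsup : ∀ j, ∀ x ∈ Icc (0 : ℝ) 1, ∀ s ∈ Icc (s₁ + k * S.δ) (s₂ - k * S.δ),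
      |u j x s| ≤ (C₁ + C₂) * N := by
    intro j x hx s hs'
    refine (abs_le_integral_add_integral (h.deriv_t j x) (hcT j x) hmid hs').trans ?_
    rw [add_mul]
    refine add_le_add ?_ (hL1T j x hx)
    refine le_trans ?_ (hL1 x hx)
    have hcx : Continuous fun s => absSum u x s :=
      Continuous.comp₂' hce continuous_const continuous_id
    refine (integral_mono_continuous (hcu j x).abs hcx (by linarith)
      fun s _ => abs_le_absSum u j x s).trans ?_
    exact integral_le_integral_of_subset hcx (he x) (by linarith) (by linarith) (by linarith)
  have hsum : ∀ x ∈ Icc (0 : ℝ) 1, ∀ s ∈ Icc (s₁ + k * S.δ) (s₂ - k * S.δ),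
      absSum u x s ≤ n * ((C₁ + C₂) * N) := by
    intro x hx s hs'
    refine (Finset.sum_le_sum fun i _ => hsup i x hx s hs').trans (by simp)
  have htm : t ∈ Icc (s₁ + k * S.δ + k * S.δ) (s₂ - k * S.δ - k * S.δ) :=
    ⟨by rw [hs₁]; linarith, by rw [hs₂]; linarith⟩
  have htm' : t ∈ Icc (s₁ + k * S.δ) (s₂ - k * S.δ) :=
    ⟨by linarith [htm.1], by linarith [htm.2]⟩
  -- Second use of the derivative bound, now pointwise with the supremum bound for `u`.
  have hTt : |uT j x t| ≤ C₃ * N := by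
    refine (hT τ u uX uT h j x hx t (by linarith [htm.1])).trans ?_
    refine (mul_le_mul_of_nonneg_left (S.maj_iterate_le hce hsum k x hx t htm) hK₀).trans
      (le_of_eq ?_)
    ring
  have hu := hsup j x hx t htm'
  have hb : |∑ i, S.b j i x t * u i x t| ≤ S.M * (n * ((C₁ + C₂) * N)) :=
    (abs_sum_mul_le (fun i => (S.hb j i).bound x t) u x t).trans
      (mul_le_mul_of_nonneg_left (hsum x hx t htm') hM.le)
  have hX : |uX j x t| ≤ S.δ * (C₃ * N + S.M * (n * ((C₁ + C₂) * N))) := by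
    have e1 := h.pde j x hx t (by linarith [htm.1])
    have e2 : uX j x t = S.f j x t * -(uT j x t + ∑ i, S.b j i x t * u i x t) := by
      have ha := S.a_ne j x t
      rw [f]; field_simp; linarith
    rw [e2, abs_mul, abs_neg]
    exact mul_le_mul (S.abs_f_le j x t) ((abs_add_le _ _).trans (add_le_add hTt hb))
      (abs_nonneg _) hδ.le
  have p1 : 0 ≤ (C₁ + C₂) * N := by positivity
  have p2 : 0 ≤ S.δ * (C₃ * N + S.M * (n * ((C₁ + C₂) * N))) := by positivity
  have p3 : (C₁ + C₂ + S.δ * (C₃ + n * S.M * (C₁ + C₂))) * N =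
      (C₁ + C₂) * N + S.δ * (C₃ * N + S.M * (n * ((C₁ + C₂) * N))) := by ring
  rw [p3]
  exact ⟨by linarith, by linarith⟩

end Sys

/-! ### Smoothing -/

theorem norm_toL2_le_of_bound {f : Fin n → ℝ → ℝ} {C : ℝ} (hf : ∀ j, ContinuousOn (f j) (Icc 0 1))
    (hC : 0 ≤ C) (h : ∀ j, ∀ x ∈ Icc (0 : ℝ) 1, |f j x| ≤ C) : ‖toL2 f‖ ≤ C := by
  rw [pi_norm_le_iff_of_nonneg hC]
  intro j
  refine abs_le_of_sq_le_sq' ?_ hC |>.2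
  rw [norm_toL2_apply_sq (hf j)]
  have h1 := intervalIntegral.integral_mono_on (μ := volume) (g := fun _ => C ^ 2) zero_le_one
    (((hf j).pow 2).intervalIntegrable_of_Icc zero_le_one)
    (continuous_const.intervalIntegrable 0 1) fun x hx => sq_le_sq' (abs_le.1 (h j x hx)).1
      (abs_le.1 (h j x hx)).2
  simpa using h1

namespace Sys

variable {S : Sys n m}

/-- Classical solutions are bounded in `C¹`, after a fixed time, by the `L²` norm of the initial
values. -/
theorem exists_classical_bound {k : ℕ} (hk : ∀ u : Fin n → ℝ → ℝ → ℝ,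
    (∀ j, ContinuousOn (fun z : ℝ × ℝ => u j z.1 z.2) (Icc 0 1 ×ˢ univ)) →
    ∀ j, ∀ x ∈ Icc (0 : ℝ) 1, ∀ t : ℝ,
      ((fun w => opC m S.a S.b (opP m S.p w))^[k] u) j x t = 0)
    {τ t : ℝ} (ht : τ + ((2 * k + 2) * S.δ + 1) ≤ t) :
    ∃ K, 0 ≤ K ∧ ∀ (φ : Fin n → ℝ → ℝ) (u : Fin n → ℝ → ℝ → ℝ),
      IsClassicalSolution m S.a S.b S.p τ φ u → ∃ d : Fin n → ℝ → ℝ, (∀ j, Continuous (d j)) ∧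
        ∀ j, ∀ x ∈ Icc (0 : ℝ) 1, HasDerivWithinAt (fun y => u j y t) (d j x) (Icc 0 1) x ∧
          |u j x t| ≤ K * ‖toL2 φ‖ ∧ |d j x| ≤ K * ‖toL2 φ‖ := by
  obtain ⟨K, hK, h⟩ := S.exists_apriori_bound hk ht
  have hτt : τ ≤ t := by
    have : 0 ≤ (2 * (k : ℝ) + 2) * S.δ := by have := S.δ_pos; positivity
    linarith
  refine ⟨K * √n, by positivity, fun φ u hu => ?_⟩
  obtain ⟨v, vX, vT, hv, hvu⟩ := hu.exists_isSol
  refine ⟨fun j x => vX j x t, fun j =>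
    Continuous.comp₂' (hv.cont_x j) continuous_id continuous_const, fun j x hx => ⟨?_, ?_⟩⟩
  · exact (hv.deriv_x j x hx t hτt).congr (fun y hy => (hvu j y hy t hτt).symm)
      (hvu j x hx t hτt).symm
  · have h1 := normSq_le_norm_toL2_sq fun j => (hv.continuous_at_time j τ).continuousOn (s := Icc 0 1)
    have h2 : toL2 φ = toL2 fun j x => v j x τ :=
      toL2_congr hu.continuousOn_initial fun j x hx => by rw [hvu j x hx τ le_rfl, hu.2.2 j x hx]
    rw [← h2] at h1
    have h3 := Real.sqrt_le_sqrt h1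
    rw [Real.sqrt_mul (Nat.cast_nonneg n), Real.sqrt_sq (norm_nonneg _)] at h3
    have h4 := mul_le_mul_of_nonneg_left h3 hK
    rw [← mul_assoc] at h4
    have h5 := h v vX vT hv j x hx
    rw [hvu j x hx t hτt] at h5
    exact ⟨h5.1.trans h4, h5.2.trans h4⟩

/-- Nothing about the family is used beyond its definition: it supplies classical solutions
approximating the given one in `L²`, and the `C¹` bound applied to their differences makes them
Cauchy in `C¹` at time `t`. -/
theorem isSmoothing_of_isGeneratedBy (hext : ExtinctionCondition m S.a S.b S.p)
    {U : ℝ → ℝ → L2 n →L[ℝ] L2 n} (hU : IsGeneratedBy m S.a S.b S.p U) : IsSmoothingL2C1 U := by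
  obtain ⟨k, hk⟩ := hext
  have hT : 0 < (2 * (k : ℝ) + 2) * S.δ + 1 := by have := S.δ_pos; positivity
  refine ⟨_, hT, fun τ t ht => ?_⟩
  have hτt : τ < t := by linarith
  obtain ⟨K, hK, hb⟩ := exists_classical_bound hk ht
  refine ⟨2 * K, fun φ => ?_⟩
  obtain ⟨ψ, hψ, hψlim⟩ := mem_closure_iff_seq_limit.1 (denseRange_testToL2 n φ)
  choose χ hχ using hψ
  have hlim : Tendsto (fun l => toL2 (χ l).1) atTop (𝓝 φ) :=
    hψlim.congr fun l => (hχ l).symm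
  obtain ⟨u, hu, hunif⟩ := (hU.2 τ φ).2 (fun l => (χ l).1) (fun l => (χ l).2) hlim
  have hUlim : Tendsto (fun l => toL2 fun j x => u l j x t) atTop (𝓝 (U t τ φ)) :=
    (hunif t hτt).tendsto_at (right_mem_Icc.2 hτt.le)
  choose d hdc hd using fun l => hb _ (u l) (hu l)
  have hcu : ∀ l j, ContinuousOn (fun x => u l j x t) (Icc 0 1) := fun l j =>
    (hu l).continuousOn_at_time hτt.le j
  -- differences of two approximations
  have hdiff : ∀ l l' j, ∀ x ∈ Icc (0 : ℝ) 1,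
      |u l j x t - u l' j x t| ≤ K * ‖toL2 (χ l).1 - toL2 (χ l').1‖ ∧
      |d l j x - d l' j x| ≤ K * ‖toL2 (χ l).1 - toL2 (χ l').1‖ := by
    intro l l' j x hx
    obtain ⟨d', -, h'⟩ := hb _ _ ((hu l).comb (hu l') 1 (-1))
    obtain ⟨h1, h2, h3⟩ := h' j x hx
    -- The bound for the difference comes with its own derivative, which must coincide with the
    -- difference of the derivatives.
    have e1 : d' j x = 1 * d l j x + -1 * d l' j x :=
      (uniqueDiffOn_Icc zero_lt_one x hx).eq_deriv _ h1
        (((hd l j x hx).1.const_mul 1).fun_add ((hd l' j x hx).1.const_mul (-1)))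
    rw [e1] at h3
    rw [toL2_comb (hu l).continuousOn_initial (hu l').continuousOn_initial] at h2 h3
    simp only [one_mul, neg_mul, one_smul, neg_smul, ← sub_eq_add_neg] at h2 h3
    exact ⟨h2, h3⟩
  have hcauchy : ∀ F : ℕ → ℝ, (∀ l l', |F l - F l'| ≤ K * ‖toL2 (χ l).1 - toL2 (χ l').1‖) →
      ∃ A, Tendsto F atTop (𝓝 A) ∧ ∀ l, |F l - A| ≤ K * ‖toL2 (χ l).1 - φ‖ := by
    intro F hF
    have hc : CauchySeq F := by
      rw [Metric.cauchySeq_iff]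
      intro e he
      obtain ⟨N, hN⟩ := Metric.cauchySeq_iff.1 hlim.cauchySeq (e / (K + 1)) (by positivity)
      refine ⟨N, fun l hl l' hl' => ?_⟩
      have h1 := hN l hl l' hl'
      rw [dist_eq_norm, lt_div_iff₀ (by positivity)] at h1
      rw [Real.dist_eq]
      nlinarith [hF l l', norm_nonneg (toL2 (χ l).1 - toL2 (χ l').1)]
    obtain ⟨A, hA⟩ := cauchySeq_tendsto_of_complete hc
    refine ⟨A, hA, fun l => ?_⟩
    exact le_of_tendsto_of_tendsto' ((tendsto_const_nhds.sub hA).abs)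
      ((tendsto_const_nhds.sub hlim).norm.const_mul K) fun l' => hF l l'
  choose A hA hA' using fun j => hcauchy (fun l => u l j 0 t) fun l l' =>
    (hdiff l l' j 0 (by simp)).1
  choose w hw hw' using fun j x => hcauchy (fun l => d l j (pj x)) fun l l' =>
    (hdiff l l' j (pj x) (pj_mem x)).2
  have hε : Tendsto (fun l => K * ‖toL2 (χ l).1 - φ‖) atTop (𝓝 0) := by
    have := (tendsto_iff_norm_sub_tendsto_zero.1 hlim).const_mul K
    rwa [mul_zero] at this
  have hwc : ∀ j, Continuous (w j) := by
    intro j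
    have hTU : TendstoUniformly (fun l x => d l j (pj x)) (w j) atTop := by
      rw [Metric.tendstoUniformly_iff]
      intro e he
      filter_upwards [hε.eventually_lt_const he] with l hl x
      rw [dist_comm, Real.dist_eq]
      exact (hw' j x l).trans_lt hl
    exact hTU.continuous (Eventually.of_forall fun l => (hdc l j).comp continuous_pj).frequently
  -- Integrating the uniform limit of the derivatives from the limit of the values at 0 makes the
  -- representative `C¹` by construction.
  let v : Fin n → ℝ → ℝ := fun j x => A j + ∫ η in (0 : ℝ)..x, w j η
  have hvd : ∀ j x, HasDerivAt (v j) (w j x) x := fun j x =>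
    ((hwc j).integral_hasStrictDerivAt 0 x).hasDerivAt.const_add (A j)
  have hvc : ∀ j, Continuous (v j) := fun j =>
    continuous_iff_continuousAt.2 fun x => (hvd j x).continuousAt
  have hclose : ∀ l j, ∀ x ∈ Icc (0 : ℝ) 1, |u l j x t - v j x| ≤ 2 * (K * ‖toL2 (χ l).1 - φ‖) := by
    intro l j x hx
    have hc : Continuous fun η => d l j (pj η) := (hdc l j).comp continuous_pj
    have e1 := integral_eq_sub_of_hasDerivWithinAt_Icc (left_mem_Icc.2 zero_le_one) hx hc
      fun ξ hξ => by rw [pj_of_mem hξ]; exact (hd l j ξ hξ).1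
    have e2 : u l j x t - v j x = (u l j 0 t - A j) + ∫ η in (0 : ℝ)..x, (d l j (pj η) - w j η) := by
      rw [intervalIntegral.integral_sub (hc.intervalIntegrable _ _)
        ((hwc j).intervalIntegrable _ _), e1]
      simp only [v]; ring
    have e3 := abs_integral_le_mul (fun η => hw' j η l) 0 x
    have e4 : |x - 0| ≤ 1 := abs_le.2 ⟨by linarith [hx.1], by linarith [hx.2]⟩
    have e5 : 0 ≤ K * ‖toL2 (χ l).1 - φ‖ := by positivity
    rw [e2]
    refine (abs_add_le _ _).trans ?_
    nlinarith [hA' j l, mul_le_of_le_one_right e5 e4]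
  have hUv : U t τ φ = toL2 v := by
    refine tendsto_nhds_unique hUlim (tendsto_iff_norm_sub_tendsto_zero.2 ?_)
    refine squeeze_zero (fun _ => norm_nonneg _) (fun l => ?_)
      (by simpa using hε.const_mul 2)
    have e1 := toL2_comb (hcu l) (fun j => (hvc j).continuousOn) 1 (-1)
    simp only [one_mul, neg_mul, one_smul, neg_smul, ← sub_eq_add_neg] at e1
    rw [← e1]
    exact norm_toL2_le_of_bound (fun j => (hcu l j).sub (hvc j).continuousOn) (by positivity)
      fun j x hx => hclose l j x hx
  have hKlim : Tendsto (fun l => K * ‖toL2 (χ l).1‖) atTop (𝓝 (K * ‖φ‖)) := hlim.norm.const_mul K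
  refine ⟨v, fun j => ⟨?_, ?_, fun x hx y hy => ?_⟩⟩
  · have hde : deriv (v j) = w j := funext fun x => (hvd j x).deriv
    exact (contDiff_one_iff_deriv.2 ⟨fun x => (hvd j x).differentiableAt,
      hde ▸ hwc j⟩).contDiffOn
  · rw [hUv, toL2_apply (memLp_of_continuousOn (hvc j).continuousOn)]
    exact MemLp.coeFn_toLp _
  · rw [(hvd j y).hasDerivWithinAt.derivWithin (uniqueDiffOn_Icc zero_lt_one y hy)]
    have e1 : |v j x| ≤ K * ‖φ‖ := by
      have hlimu : Tendsto (fun l => u l j x t) atTop (𝓝 (v j x)) := by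
        rw [tendsto_iff_norm_sub_tendsto_zero]
        exact squeeze_zero (fun _ => norm_nonneg _) (fun l => hclose l j x hx)
          (by simpa using hε.const_mul 2)
      exact le_of_tendsto_of_tendsto' hlimu.abs hKlim fun l => (hd l j x hx).2.1
    have e2 : |w j y| ≤ K * ‖φ‖ :=
      le_of_tendsto_of_tendsto' (hw j y).abs hKlim fun l => (hd l j _ (pj_mem y)).2.2
    linarith

end Sys

/-! ### Reduction to coefficients defined on the plane -/

theorem IsBC1.exists_stripC1 {g : ℝ → ℝ → ℝ} (hg : IsBC1 g) :
    ∃ M gx gt, StripC1 M (fun x t => g (pj x) t) gx gt := by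
  obtain ⟨gx, gt, h, ⟨M, hM⟩, ⟨Mx, hMx⟩, ⟨Mt, hMt⟩⟩ := hg
  have hc : ∀ {v : ℝ → ℝ → ℝ}, ContinuousOn (fun z : ℝ × ℝ => v z.1 z.2) (Icc 0 1 ×ˢ univ) →
      Continuous fun z : ℝ × ℝ => v (pj z.1) z.2 := fun hv =>
    hv.comp_continuous (f := fun z : ℝ × ℝ => (pj z.1, z.2)) (by fun_prop)
      fun z => ⟨pj_mem _, mem_univ _⟩
  refine ⟨max M (max Mx Mt), fun x t => gx (pj x) t, fun x t => gt (pj x) t, hc h.cont, hc h.cont_x,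
    hc h.cont_t, fun x t => by simp, fun x hx t => ?_, fun x t => ?_, fun x t => ?_, fun x t => ?_,
    fun x t => ?_⟩
  · have := h.deriv_x x hx t (mem_univ t)
    rw [pj_of_mem hx]
    exact this.congr (fun y hy => by rw [pj_of_mem hy]) (by rw [pj_of_mem hx])
  · exact hasDerivWithinAt_univ.1 (h.deriv_t (pj x) (pj_mem x) t (mem_univ t))
  · exact (hM _ (pj_mem x) t).trans (le_max_left _ _)
  · exact (hMx _ (pj_mem x) t).trans ((le_max_left _ _).trans (le_max_right _ _))
  · exact (hMt _ (pj_mem x) t).trans ((le_max_right _ _).trans (le_max_right _ _))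

theorem StripC1.mono {M M' : ℝ} {g gx gt : ℝ → ℝ → ℝ} (h : StripC1 M g gx gt) (hM : M ≤ M') :
    StripC1 M' g gx gt :=
  { h with
    bound := fun x t => (h.bound x t).trans hM
    bound_x := fun x t => (h.bound_x x t).trans hM
    bound_t := fun x t => (h.bound_t x t).trans hM }

theorem StripC1.nonneg {M : ℝ} {g gx gt : ℝ → ℝ → ℝ} (h : StripC1 M g gx gt) : 0 ≤ M :=
  (abs_nonneg _).trans (h.bound 0 0)

/-- The coefficients are continued constantly in `x` beyond `[0,1]`, which preserves all bounds,
signs and identities; one `M` dominates the finitely many separate bounds. -/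
theorem exists_sys {a : Fin n → ℝ → ℝ → ℝ} {b : Fin n → Fin n → ℝ → ℝ → ℝ}
    (p : Fin n → Fin n → ℝ) (ha : ∀ j, IsBC1 (a j))
    (hsign : ∃ Λ₀ : ℝ, 0 < Λ₀ ∧ ∀ j : Fin n, ∀ x ∈ Set.Icc (0 : ℝ) 1, ∀ t : ℝ,
      (j.val < m → Λ₀ ≤ a j x t) ∧ (m ≤ j.val → a j x t ≤ -Λ₀))
    (hb : ∀ j k, IsBC1 (b j k))
    (hlevy : ∀ j k : Fin n, j ≠ k → ∃ β : ℝ → ℝ → ℝ, IsBC1 β ∧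
      ∀ x ∈ Set.Icc (0 : ℝ) 1, ∀ t : ℝ, b j k x t = β x t * (a k x t - a j x t)) :
    ∃ S : Sys n m, S.p = p ∧ (∀ j, ∀ x ∈ Icc (0 : ℝ) 1, ∀ t, a j x t = S.a j x t) ∧
      ∀ j k, ∀ x ∈ Icc (0 : ℝ) 1, ∀ t, b j k x t = S.b j k x t := by
  obtain ⟨Λ, hΛ, hs⟩ := hsign
  have hlevy' : ∀ j k : Fin n, ∃ M β βX βT, StripC1 M β βX βT ∧
      (j ≠ k → ∀ x t, b j k (pj x) t = β x t * (a k (pj x) t - a j (pj x) t)) := by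
    intro j k
    -- On the diagonal no factorization is given or needed, so zero serves.
    by_cases hjk : j = k
    · exact ⟨0, 0, 0, 0, ⟨continuous_const, continuous_const, continuous_const, fun _ _ => rfl,
        fun x _ t => hasDerivWithinAt_const x _ 0, fun x t => hasDerivAt_const t 0,
        by simp, by simp, by simp⟩, fun h => absurd hjk h⟩
    · obtain ⟨β, hβ, h⟩ := hlevy j k hjk
      obtain ⟨M, βX, βT, h'⟩ := hβ.exists_stripC1
      exact ⟨M, _, βX, βT, h', fun _ x t => h _ (pj_mem x) t⟩
  choose Ma aX aT hsa using fun j => (ha j).exists_stripC1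
  choose Mb bX bT hsb using fun j k => (hb j k).exists_stripC1
  choose Mβ β βX βT hsβ hβ using hlevy'
  have h1 : 0 ≤ ∑ j, Ma j := Finset.sum_nonneg fun j _ => (hsa j).nonneg
  have h2 : ∀ j, 0 ≤ ∑ k, (Mb j k + Mβ j k + |p j k|) := fun j => Finset.sum_nonneg fun k _ =>
    add_nonneg (add_nonneg (hsb j k).nonneg (hsβ j k).nonneg) (abs_nonneg _)
  have h3 : 0 ≤ ∑ j, ∑ k, (Mb j k + Mβ j k + |p j k|) := Finset.sum_nonneg fun j _ => h2 j
  have h4 : ∀ j, Ma j ≤ ∑ j, Ma j := fun j =>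
    Finset.single_le_sum (f := Ma) (fun j _ => (hsa j).nonneg) (Finset.mem_univ j)
  have h5 : ∀ j k, Mb j k + Mβ j k + |p j k| ≤ ∑ j, ∑ k, (Mb j k + Mβ j k + |p j k|) := fun j k =>
    (Finset.single_le_sum (f := fun k => Mb j k + Mβ j k + |p j k|) (fun k _ =>
      add_nonneg (add_nonneg (hsb j k).nonneg (hsβ j k).nonneg) (abs_nonneg _))
      (Finset.mem_univ k)).trans
    (Finset.single_le_sum (f := fun j => ∑ k, (Mb j k + Mβ j k + |p j k|)) (fun j _ => h2 j)
      (Finset.mem_univ j))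
  refine ⟨{ a := fun j x t => a j (pj x) t, aX := aX, aT := aT,
            b := fun j k x t => b j k (pj x) t, bX := bX, bT := bT, β := β, βX := βX, βT := βT,
            p := p, Λ := Λ, M := 1 + ∑ j, Ma j + ∑ j, ∑ k, (Mb j k + Mβ j k + |p j k|),
            Λ_pos := hΛ
            one_le_M := by linarith
            ha := fun j => (hsa j).mono (by linarith [h4 j])
            hb := fun j k => (hsb j k).mono (by
              linarith [h5 j k, (hsβ j k).nonneg, abs_nonneg (p j k)])
            hβ := fun j k => (hsβ j k).mono (by
              linarith [h5 j k, (hsb j k).nonneg, abs_nonneg (p j k)])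
            hp := fun j k => by linarith [h5 j k, (hsb j k).nonneg, (hsβ j k).nonneg]
            sign_pos := fun j hj x t => (hs j _ (pj_mem x) t).1 hj
            sign_neg := fun j hj x t => (hs j _ (pj_mem x) t).2 (not_lt.1 hj)
            levy := fun j k hjk x t => hβ j k hjk x t }, rfl, ?_, ?_⟩
  · intro j x hx t; simp only [pj_of_mem hx]
  · intro j k x hx t; simp only [pj_of_mem hx]

/-! ### Independence of the values of the coefficients off the strip -/

section congr

variable {a a' : Fin n → ℝ → ℝ → ℝ} {b b' : Fin n → Fin n → ℝ → ℝ → ℝ} {p : Fin n → Fin n → ℝ}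

/-- The predicate `IsCharacteristic` sees the speed only for `x` in `[0,1]`. The two predicates are
therefore equal, and so are the functions chosen from them. -/
theorem omega_congr {a a' : ℝ → ℝ → ℝ} (h : ∀ x ∈ Icc (0 : ℝ) 1, ∀ t, a x t = a' x t) :
    omega a = omega a' := by
  have hP : IsCharacteristic a = IsCharacteristic a' := by
    funext x t w
    refine propext (and_congr_right fun _ => forall₂_congr fun ξ hξ => ?_)
    rw [h ξ hξ]
  funext ξ x t
  unfold omega
  rw [hP]

theorem opC_congr (ha : ∀ j, ∀ x ∈ Icc (0 : ℝ) 1, ∀ t, a j x t = a' j x t)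
    (hb : ∀ j k, ∀ x ∈ Icc (0 : ℝ) 1, ∀ t, b j k x t = b' j k x t) (v : Fin n → ℝ → ℝ) (j : Fin n)
    {x : ℝ} (hx : x ∈ Icc (0 : ℝ) 1) (t : ℝ) : opC m a b v j x t = opC m a' b' v j x t := by
  simp only [opC, cCoef, omega_congr (ha j)]
  congr 2
  refine intervalIntegral.integral_congr fun η hη => ?_
  have hη' : η ∈ Icc (0 : ℝ) 1 := uIcc_subset_Icc hx (Sys.xIn_mem j) hη
  simp only [ha j η hη', hb j j η hη']

theorem ExtinctionCondition.congr (ha : ∀ j, ∀ x ∈ Icc (0 : ℝ) 1, ∀ t, a j x t = a' j x t)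
    (hb : ∀ j k, ∀ x ∈ Icc (0 : ℝ) 1, ∀ t, b j k x t = b' j k x t)
    (h : ExtinctionCondition m a b p) : ExtinctionCondition m a' b' p := by
  obtain ⟨k, hk⟩ := h
  refine ⟨k, fun u hu j x hx t => ?_⟩
  rw [← hk u hu j x hx t]
  have key : ∀ i : ℕ, ∀ j, ∀ x ∈ Icc (0 : ℝ) 1, ∀ t,
      ((fun w => opC m a' b' (opP m p w))^[i] u) j x t =
      ((fun w => opC m a b (opP m p w))^[i] u) j x t := by
    intro i
    induction i with
    | zero => intro j x _ t; rw [Function.iterate_zero_apply, Function.iterate_zero_apply]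
    | succ i ih =>
      intro j x hx t
      rw [Function.iterate_succ_apply', Function.iterate_succ_apply']
      have h1 : opP m p ((fun w => opC m a' b' (opP m p w))^[i] u) =
          opP m p ((fun w => opC m a b (opP m p w))^[i] u) := by
        funext l s
        exact Finset.sum_congr rfl fun r _ => by rw [ih r _ (Sys.xOut_mem r)]
      rw [h1]
      exact (opC_congr ha hb _ j hx t).symm
  exact key k j x hx t

theorem IsClassicalSolution.congr {τ : ℝ} {φ : Fin n → ℝ → ℝ} {u : Fin n → ℝ → ℝ → ℝ}
    (ha : ∀ j, ∀ x ∈ Icc (0 : ℝ) 1, ∀ t, a j x t = a' j x t)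
    (hb : ∀ j k, ∀ x ∈ Icc (0 : ℝ) 1, ∀ t, b j k x t = b' j k x t)
    (h : IsClassicalSolution m a b p τ φ u) : IsClassicalSolution m a' b' p τ φ u := by
  obtain ⟨⟨ux, ut, h1, h2⟩, h3⟩ := h
  refine ⟨⟨ux, ut, h1, fun j x hx t ht => ?_⟩, h3⟩
  rw [← h2 j x hx t ht, ha j x (Ioo_subset_Icc_self hx)]
  simp only [hb j _ x (Ioo_subset_Icc_self hx)]

theorem IsGeneratedBy.congr {U : ℝ → ℝ → L2 n →L[ℝ] L2 n}
    (ha : ∀ j, ∀ x ∈ Icc (0 : ℝ) 1, ∀ t, a j x t = a' j x t)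
    (hb : ∀ j k, ∀ x ∈ Icc (0 : ℝ) 1, ∀ t, b j k x t = b' j k x t)
    (h : IsGeneratedBy m a b p U) : IsGeneratedBy m a' b' p U := by
  refine ⟨h.1, fun τ φ => ⟨(h.2 τ φ).1, fun φl hφl hlim => ?_⟩⟩
  obtain ⟨ul, h1, h2⟩ := (h.2 τ φ).2 φl hφl hlim
  exact ⟨ul, fun l => (h1 l).congr ha hb, h2⟩

end congr

end HypSmoothing
end

open HypSmoothing in
theorem theorem2p2 (n m : ℕ) (hn : 2 ≤ n) (hm : m ≤ n)
    (a : Fin n → ℝ → ℝ → ℝ) (b : Fin n → Fin n → ℝ → ℝ → ℝ) (p : Fin n → Fin n → ℝ)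
    (ha : ∀ j, IsBC1 (a j))
    (hsign : ∃ Λ₀ : ℝ, 0 < Λ₀ ∧ ∀ j : Fin n, ∀ x ∈ Set.Icc (0 : ℝ) 1, ∀ t : ℝ,
      (j.val < m → Λ₀ ≤ a j x t) ∧ (m ≤ j.val → a j x t ≤ -Λ₀))
    (hb : ∀ j k, IsBC1 (b j k))
    (hext : ExtinctionCondition m a b p)
    (hlevy : ∀ j k : Fin n, j ≠ k → ∃ β : ℝ → ℝ → ℝ, IsBC1 β ∧
      ∀ x ∈ Set.Icc (0 : ℝ) 1, ∀ t : ℝ, b j k x t = β x t * (a k x t - a j x t)) :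
    (∃ U : ℝ → ℝ → L2 n →L[ℝ] L2 n, IsGeneratedBy m a b p U) ∧
    ∀ U : ℝ → ℝ → L2 n →L[ℝ] L2 n, IsGeneratedBy m a b p U → IsSmoothingL2C1 U := by
  -- The extended system agrees with the given one on the strip, so the generation and extinction
  -- properties transfer between the two.
  obtain ⟨S, rfl, hSa, hSb⟩ := exists_sys (m := m) p ha hsign hb hlevy
  refine ⟨⟨S.evol, S.isGeneratedBy_evol.congr (fun j x hx t => (hSa j x hx t).symm)
    fun j k x hx t => (hSb j k x hx t).symm⟩, fun U hU => ?_⟩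
  exact Sys.isSmoothing_of_isGeneratedBy (hext.congr hSa hSb) (hU.congr hSa hSb)
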